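/- Let $(X,g)$ be a closed (compact, without boundary) connected smooth Riemannian surface, let $N\ge 0$ be an integer and let $\phi_1,\dots,\phi_N$ be smooth positive functions on $X$. Let $X^\ast=X\times\mathbb R^N$ be the corresponding warped $\mathbb T^N$-extension of $X$, that is, $X\times\mathbb R^N$ with the Riemannian metric $$g^\ast=g(x)+\phi_1(x)^2\,dt_1^2+\phi_2(x)^2\,dt_2^2+\dots+\phi_N(x)^2\,dt_N^2 .$$ If, for a real number $\sigma>0$, the scalar curvature of $g^\ast$ satisfies $Sc(X^\ast)\ge\sigma$ everywhere on $X^\ast$, then the diameter of $X$ with respect to the Riemannian distance of $g$ satisfies $$\operatorname{diam}(X)\;\le\;2\pi\sqrt{\frac{N+1}{(N+2)\sigma}}\;<\;\frac{2\pi}{\sqrt\sigma}.$$ -/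

import Mathlib

open Set Manifold Bundle Bornology
open scoped ContDiff ENNReal Topology

noncomputable section

section RiemannianGeometry

variable {ι E H M : Type*} [NormedAddCommGroup E] [NormedSpace ℝ E]
  [TopologicalSpace H] [TopologicalSpace M] [ChartedSpace H M]

/-! ### Coordinate calculus of a metric tensor

`G : E → Matrix ι ι ℝ` is the matrix `g_{ij}` of a metric as a function of the point of the
coordinate space `E`, and `b` is the basis of `E` that defines the coordinates. -/

/-- The partial derivative `∂_i f` at `y`, in the coordinates given by the basis `b`. -/
def coordDeriv (b : Module.Basis ι ℝ E) (i : ι) (f : E → ℝ) (y : E) : ℝ :=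
  fderiv ℝ f y (b i)

/-- The Christoffel symbol
`Γ^k_{ij} = ½ ∑ₗ g^{kl} (∂_i g_{jl} + ∂_j g_{il} - ∂_l g_{ij})` at `y`. -/
def christoffel [Fintype ι] [DecidableEq ι] (b : Module.Basis ι ℝ E) (G : E → Matrix ι ι ℝ)
    (k i j : ι) (y : E) : ℝ :=
  (1 / 2) * ∑ l, (G y)⁻¹ k l *
    (coordDeriv b i (fun z => G z j l) y + coordDeriv b j (fun z => G z i l) y
      - coordDeriv b l (fun z => G z i j) y)

/-- The Ricci tensor `R_{jk} = ∑ᵢ (∂_i Γ^i_{jk} - ∂_j Γ^i_{ik})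
+ ∑ᵢₚ (Γ^i_{ip} Γ^p_{jk} - Γ^i_{jp} Γ^p_{ik})` at `y`. -/
def ricciCoord [Fintype ι] [DecidableEq ι] (b : Module.Basis ι ℝ E) (G : E → Matrix ι ι ℝ)
    (j k : ι) (y : E) : ℝ :=
  ∑ i, (coordDeriv b i (christoffel b G i j k) y - coordDeriv b j (christoffel b G i i k) y)
    + ∑ i, ∑ p, (christoffel b G i i p y * christoffel b G p j k y
      - christoffel b G i j p y * christoffel b G p i k y)

/-- The scalar curvature `∑ⱼₖ g^{jk} R_{jk}` at `y`; it is `2` on the unit sphere `S²`. -/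
def scalarCurvatureCoord [Fintype ι] [DecidableEq ι] (b : Module.Basis ι ℝ E)
    (G : E → Matrix ι ι ℝ) (y : E) : ℝ :=
  ∑ j, ∑ k, (G y)⁻¹ j k * ricciCoord b G j k y

/-! ### Riemannian metrics on manifolds -/

/-- The matrix `g(∂_i, ∂_j)` of a Riemannian metric in the preferred chart at `x₀`, as a function
of the coordinates `y`, where `∂_i` are the coordinate vector fields of this chart (for a manifold
without boundary). -/
def metricInChart {I : ModelWithCorners ℝ E H} [IsManifold I ∞ M]
    (g : ContMDiffRiemannianMetric I ∞ E (fun x : M => TangentSpace I x))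
    (b : Module.Basis ι ℝ E) (x₀ : M) (y : E) : Matrix ι ι ℝ :=
  Matrix.of fun i j => g.inner ((extChartAt I x₀).symm y)
    (mfderiv 𝓘(ℝ, E) I (extChartAt I x₀).symm y (b i))
    (mfderiv 𝓘(ℝ, E) I (extChartAt I x₀).symm y (b j))

/-- The scalar curvature of a Riemannian metric at the point `x` of a manifold without boundary,
computed in the preferred chart at `x`. Neither the chart nor the basis `b` matters. -/
def scalarCurvature [Fintype ι] [DecidableEq ι] {I : ModelWithCorners ℝ E H} [IsManifold I ∞ M]
    (g : ContMDiffRiemannianMetric I ∞ E (fun x : M => TangentSpace I x))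
    (b : Module.Basis ι ℝ E) (x : M) : ℝ :=
  scalarCurvatureCoord b (metricInChart g b x) (extChartAt I x x)

/-- The diameter of a manifold for the distance of a Riemannian metric (the infimum of the
lengths of `C¹` paths). -/
def riemannianDiam {I : ModelWithCorners ℝ E H} [IsManifold I ∞ M]
    (g : ContMDiffRiemannianMetric I ∞ E (fun x : M => TangentSpace I x)) : ℝ≥0∞ :=
  letI : RiemannianBundle (fun x : M => TangentSpace I x) := ⟨g.toRiemannianMetric⟩
  ⨆ (x : M) (y : M), riemannianEDist I x y

/-! ### Warped extensions -/

/-- The bilinear form `g(x) + ∑ᵢ φᵢ(x)² dtᵢ²` on `T_x M × ℝ^N = T_{(x,t)} (M × ℝ^N)`. -/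
def warpedForm {I : ModelWithCorners ℝ E H} [IsManifold I ∞ M] {N : ℕ}
    (g : ContMDiffRiemannianMetric I ∞ E (fun x : M => TangentSpace I x))
    (φ : Fin N → M → ℝ) (p : M × EuclideanSpace ℝ (Fin N)) :
    (E × EuclideanSpace ℝ (Fin N)) →L[ℝ] (E × EuclideanSpace ℝ (Fin N)) →L[ℝ] ℝ :=
  letI A : E →L[ℝ] E →L[ℝ] ℝ := g.inner p.1
  A.bilinearComp (ContinuousLinearMap.fst ℝ _ _) (ContinuousLinearMap.fst ℝ _ _)
    + ∑ i, (φ i p.1) ^ 2 •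
      (ContinuousLinearMap.mul ℝ ℝ).bilinearComp
        ((EuclideanSpace.proj i).comp (ContinuousLinearMap.snd ℝ E (EuclideanSpace ℝ (Fin N))))
        ((EuclideanSpace.proj i).comp (ContinuousLinearMap.snd ℝ E (EuclideanSpace ℝ (Fin N))))

theorem warpedForm_apply {I : ModelWithCorners ℝ E H} [IsManifold I ∞ M] {N : ℕ}
    (g : ContMDiffRiemannianMetric I ∞ E (fun x : M => TangentSpace I x))
    (φ : Fin N → M → ℝ) (p : M × EuclideanSpace ℝ (Fin N))
    (v w : E × EuclideanSpace ℝ (Fin N)) :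
    warpedForm g φ p v w = g.inner p.1 v.1 w.1 + ∑ i, (φ i p.1) ^ 2 * (v.2 i * w.2 i) := by
  simp [warpedForm]
  rfl

/-- On a product `M × F` with a vector space, the trivialization of the tangent bundle is the
product of that of `TM` with the identity. -/
theorem trivializationAt_prod_symm {I : ModelWithCorners ℝ E H} [IsManifold I ∞ M]
    {F : Type*} [NormedAddCommGroup F] [NormedSpace ℝ F]
    (p q : M × F) (hq : q.1 ∈ (chartAt H p.1).source) (v : E × F) :
    (trivializationAt (E × F) (fun z : M × F => TangentSpace (I.prod 𝓘(ℝ, F)) z) p).symm q v =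
      ((trivializationAt E (fun x : M => TangentSpace I x) p.1).symm q.1 v.1, v.2) := by
  have hq' : q ∈ (chartAt (ModelProd H F) p).source := by
    simp [prodChartedSpace_chartAt, hq, chartAt_self_eq]
  have hfun : ((extChartAt (I.prod 𝓘(ℝ, F)) p).symm : E × F → M × F) =
      Prod.map (extChartAt I p.1).symm id := by
    rw [extChartAt_prod]; ext z <;> simp [chartAt_self_eq]
  have hpt : extChartAt (I.prod 𝓘(ℝ, F)) p q = (extChartAt I p.1 q.1, q.2) := by
    rw [extChartAt_prod]; simp [chartAt_self_eq]
  have hrange : range (I.prod 𝓘(ℝ, F)) = range I ×ˢ (univ : Set F) := by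
    rw [modelWithCorners_prod_coe, range_prodMap]; simp
  have hd : mfderivWithin (𝓘(ℝ, E).prod 𝓘(ℝ, F)) (I.prod 𝓘(ℝ, F))
      (Prod.map (extChartAt I p.1).symm (id : F → F))
      (range I ×ˢ (univ : Set F)) (extChartAt I p.1 q.1, q.2) =
      (mfderivWithin 𝓘(ℝ, E) I (extChartAt I p.1).symm (range I)
        (extChartAt I p.1 q.1)).prodMap
      (mfderivWithin 𝓘(ℝ, F) 𝓘(ℝ, F) (id : F → F) univ q.2) := by
    apply mfderivWithin_prodMap (p := (extChartAt I p.1 q.1, q.2))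
    · exact mdifferentiableWithinAt_extChartAt_symm (by simp [hq])
    · exact mdifferentiableWithinAt_id
    · exact I.uniqueDiffOn.uniqueMDiffOn _ (by simp [extChartAt])
    · exact uniqueMDiffWithinAt_univ _
  have h1 := TangentBundle.symmL_trivializationAt (I := I.prod 𝓘(ℝ, F)) hq'
  have h2 := TangentBundle.symmL_trivializationAt (I := I) hq
  rw [hfun, hpt, hrange, modelWithCornersSelf_prod, ← chartedSpaceSelf_prod] at h1
  have h1v := DFunLike.congr_fun h1 v
  have h2v := DFunLike.congr_fun h2 v.1
  rw [Trivialization.symmL_apply _ (by simpa using hq)] at h2v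
  rw [Trivialization.symmL_apply _ (by rw [TangentBundle.trivializationAt_baseSet]; exact hq')]
    at h1v
  have hdv := h1v.trans (DFunLike.congr_fun hd v)
  refine Eq.trans hdv ?_
  refine Prod.ext h2v.symm ?_
  change mfderivWithin 𝓘(ℝ, F) 𝓘(ℝ, F) (id : F → F) univ q.2 v.2 = v.2
  rw [mfderivWithin_univ, mfderiv_id]
  rfl

/-- The bilinear form induced on `E × F` by a bilinear form on `E`. -/
def pullFst (E F : Type*) [NormedAddCommGroup E] [NormedSpace ℝ E] [NormedAddCommGroup F]
    [NormedSpace ℝ F] : (E →L[ℝ] E →L[ℝ] ℝ) →L[ℝ] (E × F) →L[ℝ] (E × F) →L[ℝ] ℝ :=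
  ((ContinuousLinearMap.compL ℝ (E × F) E ((E × F) →L[ℝ] ℝ)).flip
      (ContinuousLinearMap.fst ℝ E F)).comp
    (ContinuousLinearMap.compL ℝ E (E →L[ℝ] ℝ) ((E × F) →L[ℝ] ℝ)
      ((ContinuousLinearMap.compL ℝ (E × F) E ℝ).flip (ContinuousLinearMap.fst ℝ E F)))

set_option synthInstance.maxHeartbeats 200000 in
theorem contDiff_pullFst (E F : Type*) [NormedAddCommGroup E] [NormedSpace ℝ E]
    [NormedAddCommGroup F] [NormedSpace ℝ F] : ContDiff ℝ ∞ (fun A => pullFst E F A) :=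
  ContinuousLinearMap.contDiff (𝕜 := ℝ) (E := E →L[ℝ] E →L[ℝ] ℝ)
    (F := (E × F) →L[ℝ] (E × F) →L[ℝ] ℝ) (pullFst E F)

theorem contDiff_sq_smul {V : Type*} [NormedAddCommGroup V] [NormedSpace ℝ V] (B : V) :
    ContDiff ℝ ∞ (fun c : ℝ => c ^ 2 • B) :=
  (contDiff_id.pow 2).smul contDiff_const

theorem trivial_linearMapAt {B : Type*} [TopologicalSpace B] (x y : B) (c : ℝ) :
    (trivializationAt ℝ (Bundle.Trivial B ℝ) x).linearMapAt ℝ y c = c := by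
  simp

theorem pullFst_apply (F : Type*) [NormedAddCommGroup F] [NormedSpace ℝ F]
    (A : E →L[ℝ] E →L[ℝ] ℝ) (v w : E × F) : pullFst E F A v w = A v.1 w.1 := rfl

set_option synthInstance.maxHeartbeats 200000 in
theorem contMDiff_warpedForm {I : ModelWithCorners ℝ E H} [IsManifold I ∞ M] {N : ℕ}
    (g : ContMDiffRiemannianMetric I ∞ E (fun x : M => TangentSpace I x))
    (φ : Fin N → M → ℝ) (hφ : ∀ i, ContMDiff I 𝓘(ℝ, ℝ) ∞ (φ i)) :
    ContMDiff (I.prod (𝓡 N)) ((I.prod (𝓡 N)).prod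
      𝓘(ℝ, (E × EuclideanSpace ℝ (Fin N)) →L[ℝ] (E × EuclideanSpace ℝ (Fin N)) →L[ℝ] ℝ)) ∞
      (fun p : M × EuclideanSpace ℝ (Fin N) => TotalSpace.mk'
        ((E × EuclideanSpace ℝ (Fin N)) →L[ℝ] (E × EuclideanSpace ℝ (Fin N)) →L[ℝ] ℝ)
        (E := fun p : M × EuclideanSpace ℝ (Fin N) => TangentSpace (I.prod (𝓡 N)) p →L[ℝ]
          TangentSpace (I.prod (𝓡 N)) p →L[ℝ] ℝ) p (warpedForm g φ p)) := by
  intro p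
  rw [contMDiffAt_hom_bundle]
  refine ⟨contMDiffAt_id, ?_⟩
  let A : M → E →L[ℝ] E →L[ℝ] ℝ := fun x => ContinuousLinearMap.inCoordinates E
    (fun x : M => TangentSpace I x) (E →L[ℝ] ℝ) (fun x : M => TangentSpace I x →L[ℝ] ℝ)
    p.1 x p.1 x (g.inner x)
  have hg : ContMDiffAt I 𝓘(ℝ, E →L[ℝ] E →L[ℝ] ℝ) ∞ A p.1 :=
    ((contMDiffAt_hom_bundle _).1 (g.contMDiff p.1)).2
  have hA : ContMDiffAt (I.prod (𝓡 N)) 𝓘(ℝ, E →L[ℝ] E →L[ℝ] ℝ) ∞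
      (fun q : M × EuclideanSpace ℝ (Fin N) => A q.1) p :=
    ContMDiffAt.comp (I' := I) p hg contMDiffAt_fst
  have hg' : ContMDiffAt (I.prod (𝓡 N))
      𝓘(ℝ, (E × EuclideanSpace ℝ (Fin N)) →L[ℝ] (E × EuclideanSpace ℝ (Fin N)) →L[ℝ] ℝ) ∞
      (fun q : M × EuclideanSpace ℝ (Fin N) => pullFst E (EuclideanSpace ℝ (Fin N)) (A q.1)) p :=
    (contDiff_pullFst E (EuclideanSpace ℝ (Fin N))).contDiffAt.comp_contMDiffAt hA
  have hs : ContMDiffAt (I.prod (𝓡 N))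
      𝓘(ℝ, (E × EuclideanSpace ℝ (Fin N)) →L[ℝ] (E × EuclideanSpace ℝ (Fin N)) →L[ℝ] ℝ) ∞
      (fun q : M × EuclideanSpace ℝ (Fin N) => ∑ i, (φ i q.1) ^ 2 •
      (ContinuousLinearMap.mul ℝ ℝ).bilinearComp
        ((EuclideanSpace.proj i).comp (ContinuousLinearMap.snd ℝ E (EuclideanSpace ℝ (Fin N))))
        ((EuclideanSpace.proj i).comp (ContinuousLinearMap.snd ℝ E (EuclideanSpace ℝ (Fin N)))))
      p := by
    apply ContMDiffAt.sum
    intro i _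
    have h1 : ContMDiffAt (I.prod (𝓡 N)) 𝓘(ℝ, ℝ) ∞
        (fun q : M × EuclideanSpace ℝ (Fin N) => φ i q.1) p :=
      (hφ i).contMDiffAt.comp p contMDiffAt_fst
    exact (contDiff_sq_smul _).contDiffAt.comp_contMDiffAt h1
  refine (hg'.add hs).congr_of_eventuallyEq ?_
  have hnhds : ∀ᶠ q in 𝓝 p, q.1 ∈ (chartAt H p.1).source :=
    continuous_fst.continuousAt.eventually
      ((chartAt H p.1).open_source.mem_nhds (mem_chart_source H p.1))
  filter_upwards [hnhds] with q hq
  have hq' : q ∈ (chartAt (ModelProd H (EuclideanSpace ℝ (Fin N))) p).source := by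
    simp [prodChartedSpace_chartAt, hq, chartAt_self_eq]
  refine ContinuousLinearMap.ext fun v => ContinuousLinearMap.ext fun w => ?_
  have e1 := inCoordinates_apply_eq₂ (𝕜 := ℝ)
    (E₁ := fun p : M × EuclideanSpace ℝ (Fin N) => TangentSpace (I.prod (𝓡 N)) p)
    (E₂ := fun p : M × EuclideanSpace ℝ (Fin N) => TangentSpace (I.prod (𝓡 N)) p)
    (F₁ := E × EuclideanSpace ℝ (Fin N)) (F₂ := E × EuclideanSpace ℝ (Fin N))
    (E₃ := Bundle.Trivial (M × EuclideanSpace ℝ (Fin N)) ℝ) (F₃ := ℝ)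
    (x₀ := p) (x := q) (ϕ := warpedForm g φ q) (v := v) (w := w)
    (by rw [TangentBundle.trivializationAt_baseSet]; exact hq')
    (by rw [TangentBundle.trivializationAt_baseSet]; exact hq') (by simp)
  have e2 := inCoordinates_apply_eq₂ (𝕜 := ℝ)
    (E₁ := fun x : M => TangentSpace I x) (E₂ := fun x : M => TangentSpace I x)
    (F₁ := E) (F₂ := E) (E₃ := Bundle.Trivial M ℝ) (F₃ := ℝ)
    (x₀ := p.1) (x := q.1) (ϕ := g.inner q.1) (v := v.1) (w := w.1)
    (by simpa using hq) (by simpa using hq) (by simp)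
  rw [trivializationAt_prod_symm p q hq v, trivializationAt_prod_symm p q hq w] at e1
  refine (e1.trans (trivial_linearMapAt _ _ _)).trans ?_
  replace e2 := e2.trans (trivial_linearMapAt _ _ _)
  refine (warpedForm_apply g φ q _ _).trans ?_
  simp only [Pi.add_apply]
  rw [add_apply, add_apply, pullFst_apply]
  refine congrArg₂ (· + ·) e2.symm ?_
  simp

/-- The warped `𝕋^N`-extension of `(M, g)`: the manifold `M × ℝ^N` with the iterated warped product
metric `g(x) + φ₁(x)² dt₁² + ⋯ + φ_N(x)² dt_N²`, where the `φᵢ` are smooth and positive on `M`. -/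
def warpedExtension {I : ModelWithCorners ℝ E H} [IsManifold I ∞ M] {N : ℕ}
    (g : ContMDiffRiemannianMetric I ∞ E (fun x : M => TangentSpace I x))
    (φ : Fin N → M → ℝ) (hφ : ∀ i, ContMDiff I 𝓘(ℝ, ℝ) ∞ (φ i)) (hpos : ∀ i x, 0 < φ i x) :
    ContMDiffRiemannianMetric (I.prod (𝓡 N)) ∞ (E × EuclideanSpace ℝ (Fin N))
      (fun p : M × EuclideanSpace ℝ (Fin N) => TangentSpace (I.prod (𝓡 N)) p) where
  inner p := warpedForm g φ p
  symm p v w := by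
    refine (warpedForm_apply g φ p v w).trans (Eq.trans ?_ (warpedForm_apply g φ p w v).symm)
    exact congrArg₂ (· + ·) (g.symm p.1 _ _)
      (Finset.sum_congr rfl fun i _ => congrArg _ (mul_comm _ _))
  pos p v hv := by
    refine lt_of_lt_of_eq ?_ (warpedForm_apply g φ p v v).symm
    change E × EuclideanSpace ℝ (Fin N) at v
    have h2 : ∀ i, 0 ≤ (φ i p.1) ^ 2 * (v.2 i * v.2 i) := fun i =>
      mul_nonneg (sq_nonneg _) (mul_self_nonneg _)
    by_cases h1 : v.1 = 0
    · have hv2 : v.2 ≠ 0 := fun h => hv (Prod.ext h1 h)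
      obtain ⟨i, hi⟩ : ∃ i, v.2 i ≠ 0 := by
        by_contra! h
        exact hv2 (PiLp.ext h)
      have h3 : 0 < ∑ i, (φ i p.1) ^ 2 * (v.2 i * v.2 i) :=
        Finset.sum_pos' (fun i _ => h2 i) ⟨i, Finset.mem_univ i,
          mul_pos (pow_pos (hpos i p.1) 2) (mul_self_pos.2 hi)⟩
      have h4 : g.inner p.1 v.1 v.1 = 0 := by rw [h1]; exact map_zero _
      linarith
    · exact add_pos_of_pos_of_nonneg (g.pos p.1 v.1 h1) (Finset.sum_nonneg fun i _ => h2 i)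
  isVonNBounded p := by
    change IsVonNBounded ℝ {v : E × EuclideanSpace ℝ (Fin N) | warpedForm g φ p v v < 1}
    have hA : IsVonNBounded ℝ {v : E | g.inner p.1 v v < 1} := g.isVonNBounded p.1
    obtain ⟨C, hC⟩ := (NormedSpace.isVonNBounded_iff' ℝ).1 hA
    have h2 : ∀ (v : E × EuclideanSpace ℝ (Fin N)) i, 0 ≤ (φ i p.1) ^ 2 * (v.2 i * v.2 i) :=
      fun v i => mul_nonneg (sq_nonneg _) (mul_self_nonneg _)
    have h0 : ∀ v : E, 0 ≤ g.inner p.1 v v := fun v => by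
      by_cases h : v = 0
      · rw [h]; exact (map_zero _).ge
      · exact (g.pos p.1 v h).le
    refine (NormedSpace.isVonNBounded_iff' ℝ).2 ⟨C + √(∑ i, ((φ i p.1) ^ 2)⁻¹), fun v hv => ?_⟩
    have hv : warpedForm g φ p v v < 1 := hv
    rw [warpedForm_apply] at hv
    have hs := Finset.sum_nonneg fun i (_ : i ∈ Finset.univ) => h2 v i
    have hv1 : ‖v.1‖ ≤ C := hC v.1 (show g.inner p.1 v.1 v.1 < 1 by linarith)
    have hv2 : ‖v.2‖ ≤ √(∑ i, ((φ i p.1) ^ 2)⁻¹) := by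
      rw [EuclideanSpace.norm_eq]
      refine Real.sqrt_le_sqrt (Finset.sum_le_sum fun i _ => ?_)
      have hle := Finset.single_le_sum (fun i _ => h2 v i) (Finset.mem_univ i)
      have hp : 0 < (φ i p.1) ^ 2 := pow_pos (hpos i p.1) 2
      have h3 : (φ i p.1) ^ 2 * (v.2 i * v.2 i) ≤ 1 := by linarith [h0 v.1]
      rw [Real.norm_eq_abs, sq_abs, ← one_div, le_div_iff₀ hp]
      linarith
    refine (max_le ?_ ?_ : max ‖v.1‖ ‖v.2‖ ≤ _)
    · exact hv1.trans (le_add_of_nonneg_right (Real.sqrt_nonneg _))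
    · exact hv2.trans (le_add_of_nonneg_left ((norm_nonneg _).trans hv1))
  contMDiff := contMDiff_warpedForm g φ hφ

end RiemannianGeometry

end

/-!
Write `u_a = log φ_a`, `U = ∑ u_a`, and let `g' = e^{2U} g`. If `K'` is the Gauss curvature of `g'`,
the scalar curvature of the warped extension is
`Sc* = e^{2U} (2 K' - ∑ |∇u_a|²_{g'} - |∇U|²_{g'})`
(`scalarCurvatureCoord_warpedMatrix_conformal`). So the curvature hypothesis bounds `K'` from below
along every curve by the derivatives of the `u_a` in the direction of the curve
(`eventually_le_frameCurvature`).

Two points of `X` are joined by a minimizing geodesic `γ` of `g'` (`exists_rdist_geodesic`). The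
second variation formula for its length gives `∫ (η'² - K' η²) ≥ 0` for every `η` that vanishes at
the ends of an interval (`IsMinimizing.integral_nonneg`). The function `η = e^{U/2} sin (π s / ℓ)`,
where `s = ∫ e^{-U}` is the arc length of `γ` for `g` and `ℓ` is its total length, yields
`σ ℓ² ≤ 4 π² (N + 1) / (N + 2)`: all terms that contain derivatives of the `u_a` are absorbed by
completing a square (`mul_mul_le_of_sum`, `sq_integral_exp_mul_le`). The number `ℓ` bounds the
`g`-distance of the ends.

The geodesic is used without a theory of connections. The Riemannian distance, read in a chart, is
abstracted to the notion of a local metric (`IsLocalMetric`): a distance on an open set of a vector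
space that is infinitesimally given by a smooth field of scalar products. A curve that realizes the
distance is Lipschitz; comparing it with the curves `c + ε h e`, the lemma of du Bois-Reymond
shows that it is twice continuously differentiable and solves the geodesic equation
(`IsLocalMetric.geodesic`). The second variation formula (`IsLocalMetric.second_variation`) is
likewise a Taylor expansion of the length in a chart. To pass from charts to the whole geodesic, the
transversal curves are recorded through their geodesic jets (`IsGeodesicJet`), which do not depend on
the chart, and the estimates for adjacent intervals are added with the triangle inequality
(`rel_Icc_of_locally`).
-/

noncomputable section

set_option linter.unusedSectionVars false
set_option linter.unusedSimpArgs false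

open Filter MeasureTheory

/-! ### Riemannian metrics in charts -/

/-- The product of two smooth sections of a bundle with a smooth metric, along a map, is smooth. -/
theorem contMDiffAt_metric_apply
    {EB : Type*} [NormedAddCommGroup EB] [NormedSpace ℝ EB]
    {HB : Type*} [TopologicalSpace HB] {IB : ModelWithCorners ℝ EB HB} {n : WithTop ℕ∞}
    {B : Type*} [TopologicalSpace B] [ChartedSpace HB B]
    {F : Type*} [NormedAddCommGroup F] [NormedSpace ℝ F]
    {V : B → Type*} [TopologicalSpace (TotalSpace F V)]
    [∀ b, TopologicalSpace (V b)] [∀ b, AddCommGroup (V b)] [∀ b, Module ℝ (V b)]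
    [∀ b, IsTopologicalAddGroup (V b)] [∀ b, ContinuousConstSMul ℝ (V b)]
    [FiberBundle F V] [VectorBundle ℝ F V] (g : ContMDiffRiemannianMetric IB n F V)
    {EM : Type*} [NormedAddCommGroup EM] [NormedSpace ℝ EM]
    {HM : Type*} [TopologicalSpace HM] {IM : ModelWithCorners ℝ EM HM}
    {M : Type*} [TopologicalSpace M] [ChartedSpace HM M]
    {b : M → B} {v w : ∀ x, V (b x)} {x : M}
    (hv : ContMDiffAt IM (IB.prod 𝓘(ℝ, F)) n (fun m => TotalSpace.mk' F (b m) (v m)) x)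
    (hw : ContMDiffAt IM (IB.prod 𝓘(ℝ, F)) n (fun m => TotalSpace.mk' F (b m) (w m)) x) :
    ContMDiffAt IM 𝓘(ℝ, ℝ) n (fun m => g.inner (b m) (v m) (w m)) x := by
  let _ : RiemannianBundle V := ⟨g.toRiemannianMetric⟩
  exact ContMDiffAt.inner_bundle hv hw

section ChartForm

variable {E H M : Type*} [NormedAddCommGroup E] [NormedSpace ℝ E]
  [TopologicalSpace H] [TopologicalSpace M] [ChartedSpace H M]
  {I : ModelWithCorners ℝ E H} [IsManifold I ∞ M]

/-- The coordinate expression of a Riemannian metric in the preferred chart at `x₀`, as a field of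
bilinear forms on the coordinate space. -/
def chartForm (g : ContMDiffRiemannianMetric I ∞ E (fun x : M => TangentSpace I x)) (x₀ : M)
    (y : E) : E →L[ℝ] E →L[ℝ] ℝ :=
  letI A : E →L[ℝ] E →L[ℝ] ℝ := g.inner ((extChartAt I x₀).symm y)
  letI D : E →L[ℝ] E := mfderiv 𝓘(ℝ, E) I (extChartAt I x₀).symm y
  A.bilinearComp D D

variable (g : ContMDiffRiemannianMetric I ∞ E (fun x : M => TangentSpace I x))

theorem chartForm_apply (x₀ : M) (y v w : E) :
    chartForm g x₀ y v w = g.inner ((extChartAt I x₀).symm y)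
      (mfderiv 𝓘(ℝ, E) I (extChartAt I x₀).symm y v)
      (mfderiv 𝓘(ℝ, E) I (extChartAt I x₀).symm y w) := rfl

theorem chartForm_symm (x₀ : M) (y v w : E) : chartForm g x₀ y v w = chartForm g x₀ y w v :=
  g.symm ((extChartAt I x₀).symm y) (mfderiv 𝓘(ℝ, E) I (extChartAt I x₀).symm y v)
    (mfderiv 𝓘(ℝ, E) I (extChartAt I x₀).symm y w)

variable [I.Boundaryless]

theorem contMDiffAt_extChartAt_symm {x₀ : M} {y : E} (hy : y ∈ (extChartAt I x₀).target) :
    ContMDiffAt 𝓘(ℝ, E) I ∞ (extChartAt I x₀).symm y :=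
  (contMDiffOn_extChartAt_symm x₀).contMDiffAt (extChartAt_target_mem_nhds' hy)

theorem contMDiffAt_extChartAt_of_mem {x₀ x : M} (hx : x ∈ (extChartAt I x₀).source) :
    ContMDiffAt I 𝓘(ℝ, E) ∞ (extChartAt I x₀) x :=
  contMDiffAt_extChartAt' (by simpa using hx)

theorem mfderiv_extChartAt_comp_symm {x₀ : M} {y : E} (hy : y ∈ (extChartAt I x₀).target) (v : E) :
    mfderiv I 𝓘(ℝ, E) (extChartAt I x₀) ((extChartAt I x₀).symm y)
      (mfderiv 𝓘(ℝ, E) I (extChartAt I x₀).symm y v) = v := by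
  have h := mfderiv_extChartAt_comp_mfderivWithin_extChartAt_symm (I := I) hy
  rw [I.range_eq_univ, mfderivWithin_univ] at h
  exact DFunLike.congr_fun h v

theorem mfderiv_extChartAt_symm_comp {x₀ x : M} (hx : x ∈ (extChartAt I x₀).source)
    (v : TangentSpace I x) :
    mfderiv 𝓘(ℝ, E) I (extChartAt I x₀).symm (extChartAt I x₀ x)
      (mfderiv I 𝓘(ℝ, E) (extChartAt I x₀) x v) = v := by
  have h := mfderivWithin_extChartAt_symm_comp_mfderiv_extChartAt' (I := I) hx
  rw [I.range_eq_univ, mfderivWithin_univ] at h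
  exact DFunLike.congr_fun h v

theorem chartForm_pos {x₀ : M} {y : E} (hy : y ∈ (extChartAt I x₀).target) {v : E} (hv : v ≠ 0) :
    0 < chartForm g x₀ y v v := by
  refine g.pos _ _ fun h => hv ?_
  have h1 := mfderiv_extChartAt_comp_symm hy v
  exact h1.symm.trans ((congrArg _ h).trans (map_zero _))

/-- Coordinate vector fields with constant components are smooth, as maps into the tangent bundle. -/
theorem contMDiffAt_coordVector {x₀ : M} {y : E} (hy : y ∈ (extChartAt I x₀).target) (v : E) :
    ContMDiffAt 𝓘(ℝ, E) I.tangent ∞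
      (fun z : E => (⟨(extChartAt I x₀).symm z,
        mfderiv 𝓘(ℝ, E) I (extChartAt I x₀).symm z v⟩ : TangentBundle I M)) y := by
  -- The field is the tangent map of the inverse chart applied to a constant section.
  have h1 : ContMDiffOn 𝓘(ℝ, E).tangent I.tangent ∞
      (tangentMapWithin 𝓘(ℝ, E) I (extChartAt I x₀).symm (extChartAt I x₀).target)
      (Bundle.TotalSpace.proj ⁻¹' (extChartAt I x₀).target) :=
    (contMDiffOn_extChartAt_symm (n := ∞) x₀).contMDiffOn_tangentMapWithin (by simp)
      (isOpen_extChartAt_target x₀).uniqueMDiffOn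
  have h2 : ContMDiff 𝓘(ℝ, E) 𝓘(ℝ, E).tangent ∞
      (fun z : E => (⟨z, (v : TangentSpace 𝓘(ℝ, E) z)⟩ : TangentBundle 𝓘(ℝ, E) E)) := by
    intro z
    rw [contMDiffAt_totalSpace]
    refine ⟨contMDiffAt_id, ?_⟩
    simpa using contMDiffAt_const
  have h3 := (h1.comp h2.contMDiffOn (s := (extChartAt I x₀).target) (fun z hz => hz)).contMDiffAt
    (extChartAt_target_mem_nhds' hy)
  refine h3.congr_of_eventuallyEq ?_
  filter_upwards [extChartAt_target_mem_nhds' hy] with z hz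
  simp only [tangentMapWithin, Function.comp_apply]
  rw [mfderivWithin_of_mem_nhds (extChartAt_target_mem_nhds' hz)]

theorem contDiffAt_chartForm_apply {x₀ : M} {y : E} (hy : y ∈ (extChartAt I x₀).target) (v w : E) :
    ContDiffAt ℝ ∞ (fun z => chartForm g x₀ z v w) y := by
  have h := contMDiffAt_metric_apply g (contMDiffAt_coordVector hy v) (contMDiffAt_coordVector hy w)
  exact contMDiffAt_iff_contDiffAt.1 h

theorem contDiffOn_chartForm [FiniteDimensional ℝ E] (x₀ : M) :
    ContDiffOn ℝ ∞ (chartForm g x₀) (extChartAt I x₀).target := by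
  rw [contDiffOn_clm_apply]
  intro v
  rw [contDiffOn_clm_apply]
  intro w y hy
  exact (contDiffAt_chartForm_apply g hy v w).contDiffWithinAt

/-- The coordinate expressions of a metric in two charts are related by pullback under the
transition map. -/
theorem chartForm_transition {x₀ x₁ : M} {y : E} (hy : y ∈ (extChartAt I x₀).target)
    (hy1 : (extChartAt I x₀).symm y ∈ (extChartAt I x₁).source) (v w : E) :
    chartForm g x₀ y v w =
      chartForm g x₁ (extChartAt I x₁ ((extChartAt I x₀).symm y))
        (fderiv ℝ (fun z => extChartAt I x₁ ((extChartAt I x₀).symm z)) y v)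
        (fderiv ℝ (fun z => extChartAt I x₁ ((extChartAt I x₀).symm z)) y w) := by
  have h1 : MDifferentiableAt 𝓘(ℝ, E) I (extChartAt I x₀).symm y :=
    (contMDiffAt_extChartAt_symm hy).mdifferentiableAt (by simp)
  have h2 : MDifferentiableAt I 𝓘(ℝ, E) (extChartAt I x₁) ((extChartAt I x₀).symm y) :=
    (contMDiffAt_extChartAt_of_mem hy1).mdifferentiableAt (by simp)
  have h3 : ∀ v : E, fderiv ℝ (fun z => extChartAt I x₁ ((extChartAt I x₀).symm z)) y v =
      mfderiv I 𝓘(ℝ, E) (extChartAt I x₁) ((extChartAt I x₀).symm y)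
      (mfderiv 𝓘(ℝ, E) I (extChartAt I x₀).symm y v) := by
    intro v
    rw [← mfderiv_eq_fderiv]
    exact DFunLike.congr_fun (mfderiv_comp y h2 h1) v
  have h4 : ∀ v : E, mfderiv 𝓘(ℝ, E) I (extChartAt I x₁).symm
      (extChartAt I x₁ ((extChartAt I x₀).symm y))
      (fderiv ℝ (fun z => extChartAt I x₁ ((extChartAt I x₀).symm z)) y v) =
      mfderiv 𝓘(ℝ, E) I (extChartAt I x₀).symm y v := by
    intro v
    rw [h3]
    exact mfderiv_extChartAt_symm_comp hy1 _
  rw [chartForm_apply, chartForm_apply, (extChartAt I x₁).left_inv hy1]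
  exact (congrArg₂ (fun a b => g.inner ((extChartAt I x₀).symm y) a b) (h4 v) (h4 w)).symm

/-- The distance of a Riemannian metric: the infimum of the lengths of `C¹` paths. -/
def riemDist (g : ContMDiffRiemannianMetric I ∞ E (fun x : M => TangentSpace I x)) (x y : M) :
    ℝ≥0∞ :=
  letI : RiemannianBundle (fun x : M => TangentSpace I x) := ⟨g.toRiemannianMetric⟩
  riemannianEDist I x y

end ChartForm

/-! ### The Riemannian distance and its infinitesimal form -/

section RiemDist

variable {E H M : Type*} [NormedAddCommGroup E] [NormedSpace ℝ E]
  [TopologicalSpace H] [TopologicalSpace M] [ChartedSpace H M]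
  {I : ModelWithCorners ℝ E H} [IsManifold I ∞ M]
  (g : ContMDiffRiemannianMetric I ∞ E (fun x : M => TangentSpace I x))

theorem riemDist_self (x : M) : riemDist g x x = 0 := by
  let _ : RiemannianBundle (fun x : M => TangentSpace I x) := ⟨g.toRiemannianMetric⟩
  exact riemannianEDist_self

theorem riemDist_comm (x y : M) : riemDist g x y = riemDist g y x := by
  let _ : RiemannianBundle (fun x : M => TangentSpace I x) := ⟨g.toRiemannianMetric⟩
  exact riemannianEDist_comm

theorem riemDist_triangle (x y z : M) : riemDist g x z ≤ riemDist g x y + riemDist g y z := by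
  let _ : RiemannianBundle (fun x : M => TangentSpace I x) := ⟨g.toRiemannianMetric⟩
  exact riemannianEDist_triangle

theorem eventually_riemDist_lt (x : M) {c : ℝ≥0∞} (hc : 0 < c) : ∀ᶠ y in 𝓝 x, riemDist g x y < c := by
  let _ : RiemannianBundle (fun x : M => TangentSpace I x) := ⟨g.toRiemannianMetric⟩
  have : IsContinuousRiemannianBundle E (fun x : M => TangentSpace I x) :=
    ⟨g.inner, g.contMDiff.continuous, fun _ _ _ => rfl⟩
  exact eventually_riemannianEDist_lt I x hc

theorem exists_riemDist_ball_subset [RegularSpace M] {x : M} {s : Set M} (hs : s ∈ 𝓝 x) :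
    ∃ c > 0, {y | riemDist g x y < c} ⊆ s := by
  let _ : RiemannianBundle (fun x : M => TangentSpace I x) := ⟨g.toRiemannianMetric⟩
  have : IsContinuousRiemannianBundle E (fun x : M => TangentSpace I x) :=
    ⟨g.inner, g.contMDiff.continuous, fun _ _ _ => rfl⟩
  exact setOfPred_riemannianEDist_lt_subset_nhds' I hs

/-- The length of a path for a Riemannian metric. -/
def riemLength (γ : ℝ → M) (a b : ℝ) : ℝ≥0∞ :=
  letI : RiemannianBundle (fun x : M => TangentSpace I x) := ⟨g.toRiemannianMetric⟩
  pathELength I γ a b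

theorem riemLength_eq (γ : ℝ → M) (a b : ℝ) :
    riemLength g γ a b = ∫⁻ t in Icc a b, ENNReal.ofReal
      (√(g.inner (γ t) (mfderivWithin 𝓘(ℝ, ℝ) I γ (Icc a b) t (1 : ℝ))
        (mfderivWithin 𝓘(ℝ, ℝ) I γ (Icc a b) t (1 : ℝ)))) := by
  let _ : RiemannianBundle (fun x : M => TangentSpace I x) := ⟨g.toRiemannianMetric⟩
  refine (pathELength_eq_lintegral_mfderivWithin_Icc (I := I)).trans ?_
  refine lintegral_congr fun t => ?_
  rw [← ofReal_norm]
  exact congrArg ENNReal.ofReal (norm_eq_sqrt_real_inner _)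

theorem riemLength_mono (γ : ℝ → M) {a b a' b' : ℝ} (h : a' ≤ a) (h' : b ≤ b') :
    riemLength g γ a b ≤ riemLength g γ a' b' := by
  let _ : RiemannianBundle (fun x : M => TangentSpace I x) := ⟨g.toRiemannianMetric⟩
  exact pathELength_mono h h'

theorem riemLength_add (γ : ℝ → M) {a b c : ℝ} (h : a ≤ b) (h' : b ≤ c) :
    riemLength g γ a b + riemLength g γ b c = riemLength g γ a c := by
  let _ : RiemannianBundle (fun x : M => TangentSpace I x) := ⟨g.toRiemannianMetric⟩
  exact pathELength_add h h'

theorem riemDist_le_riemLength {γ : ℝ → M} {a b : ℝ} (hγ : ContMDiffOn 𝓘(ℝ, ℝ) I 1 γ (Icc a b))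
    (hab : a ≤ b) : riemDist g (γ a) (γ b) ≤ riemLength g γ a b := by
  let _ : RiemannianBundle (fun x : M => TangentSpace I x) := ⟨g.toRiemannianMetric⟩
  exact riemannianEDist_le_pathELength hγ rfl rfl hab

theorem exists_riemLength_lt {x y : M} {r : ℝ≥0∞} (hr : riemDist g x y < r) :
    ∃ γ : ℝ → M, γ 0 = x ∧ γ 1 = y ∧ ContMDiffOn 𝓘(ℝ, ℝ) I 1 γ (Icc 0 1) ∧
      riemLength g γ 0 1 < r := by
  let _ : RiemannianBundle (fun x : M => TangentSpace I x) := ⟨g.toRiemannianMetric⟩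
  exact exists_lt_of_riemannianEDist_lt hr

end RiemDist

section BilinearForms

variable {E : Type*} [NormedAddCommGroup E] [NormedSpace ℝ E]

theorem abs_bilin_sub_le (A B : E →L[ℝ] E →L[ℝ] ℝ) {ε : ℝ} (h : dist A B ≤ ε) (v : E) :
    |A v v - B v v| ≤ ε * ‖v‖ ^ 2 := by
  have h2 : |A v v - B v v| ≤ ‖A - B‖ * ‖v‖ * ‖v‖ := (A - B).le_opNorm₂ v v
  have h3 : ‖A - B‖ ≤ ε := (dist_eq_norm A B).symm.trans_le h
  have h4 : ‖A - B‖ * ‖v‖ * ‖v‖ ≤ ε * ‖v‖ * ‖v‖ := by gcongr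
  nlinarith

theorem sqrt_le_sqrt_add_of_abs_sub_le {a b c : ℝ} (hc : 0 ≤ c) (h : |a - b| ≤ c ^ 2) :
    √a ≤ √b + c := by
  have h1 := (abs_le.1 h).2
  refine Real.sqrt_le_iff.2 ⟨by positivity, ?_⟩
  rcases le_total 0 b with h6 | h6
  · nlinarith [Real.sq_sqrt h6, Real.sqrt_nonneg b, mul_nonneg (Real.sqrt_nonneg b) hc]
  · nlinarith [Real.sqrt_eq_zero_of_nonpos h6]

/-- A positive definite form on a finite-dimensional space dominates the norm. -/
theorem exists_norm_le_sqrt_bilin [FiniteDimensional ℝ E] (A : E →L[ℝ] E →L[ℝ] ℝ)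
    (hA : ∀ v, v ≠ 0 → 0 < A v v) : ∃ μ > 0, ∀ v, μ * ‖v‖ ≤ √(A v v) := by
  have hc : Continuous fun v : E => √(A v v) := by fun_prop
  rcases (Metric.sphere (0 : E) 1).eq_empty_or_nonempty with h | h
  · refine ⟨1, one_pos, fun v => ?_⟩
    by_cases hv : v = 0
    · simp [hv]
    · exfalso
      have : ‖v‖⁻¹ • v ∈ Metric.sphere (0 : E) 1 := by
        simp [norm_smul, norm_ne_zero_iff.2 hv]
      simp [h] at this
  · obtain ⟨w, hw, hmin⟩ := (isCompact_sphere (0 : E) 1).exists_isMinOn h hc.continuousOn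
    have hw0 : w ≠ 0 := by
      rintro rfl
      simp at hw
    refine ⟨√(A w w), Real.sqrt_pos.2 (hA w hw0), fun v => ?_⟩
    by_cases hv : v = 0
    · simp [hv]
    have hv' : 0 < ‖v‖ := norm_pos_iff.2 hv
    have h1 : √(A w w) ≤ √(A (‖v‖⁻¹ • v) (‖v‖⁻¹ • v)) :=
      hmin (by simp [norm_smul, hv'.ne'] : ‖v‖⁻¹ • v ∈ Metric.sphere (0 : E) 1)
    have h2 : A (‖v‖⁻¹ • v) (‖v‖⁻¹ • v) = (‖v‖⁻¹) ^ 2 * A v v := by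
      simp; ring
    rw [h2, Real.sqrt_mul (by positivity), Real.sqrt_sq (by positivity)] at h1
    calc √(A w w) * ‖v‖ ≤ (‖v‖⁻¹ * √(A v v)) * ‖v‖ := by gcongr
      _ = √(A v v) := by field_simp

end BilinearForms

section LocalComparison

set_option synthInstance.maxHeartbeats 200000

variable {E H M : Type*} [NormedAddCommGroup E] [NormedSpace ℝ E] [FiniteDimensional ℝ E]
  [TopologicalSpace H] [TopologicalSpace M] [ChartedSpace H M]
  {I : ModelWithCorners ℝ E H} [IsManifold I ∞ M] [I.Boundaryless]
  (g : ContMDiffRiemannianMetric I ∞ E (fun x : M => TangentSpace I x))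

theorem continuousAt_chartForm {x₀ : M} {y : E} (hy : y ∈ (extChartAt I x₀).target) :
    ContinuousAt (chartForm g x₀) y :=
  (contDiffOn_chartForm g x₀).continuousOn.continuousAt (extChartAt_target_mem_nhds' hy)

/-- The coordinate expression of a metric is continuous, in the form used for comparing lengths. -/
theorem eventually_abs_chartForm_sub_le {x₀ : M} {y : E} (hy : y ∈ (extChartAt I x₀).target)
    {ε : ℝ} (hε : 0 < ε) :
    ∀ᶠ z in 𝓝 y, ∀ v, |chartForm g x₀ z v v - chartForm g x₀ y v v| ≤ (ε * ‖v‖) ^ 2 := by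
  have h : Tendsto (chartForm g x₀) (𝓝 y) (𝓝 (chartForm g x₀ y)) := continuousAt_chartForm g hy
  have h' := h.eventually (Metric.ball_mem_nhds (chartForm g x₀ y) (pow_pos hε 2))
  filter_upwards [h'] with z hz v
  have hz : dist (chartForm g x₀ z) (chartForm g x₀ y) < ε ^ 2 := hz
  rw [mul_pow]
  exact abs_bilin_sub_le _ _ hz.le v

/-- Infinitesimally, the Riemannian distance is at most the norm given by the metric. -/
theorem eventually_riemDist_le {x₀ : M} {y₀ : E} (hy : y₀ ∈ (extChartAt I x₀).target)
    {ε : ℝ} (hε : 0 < ε) : ∀ᶠ p : E × E in 𝓝 (y₀, y₀),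
      riemDist g ((extChartAt I x₀).symm p.1) ((extChartAt I x₀).symm p.2) ≤
        ENNReal.ofReal (√(chartForm g x₀ y₀ (p.2 - p.1) (p.2 - p.1)) + ε * ‖p.2 - p.1‖) := by
  have h1 := (eventually_abs_chartForm_sub_le g hy hε).and
    (extChartAt_target_mem_nhds' hy)
  obtain ⟨r, hr, hball⟩ := Metric.eventually_nhds_iff_ball.1 h1
  have h2 : Metric.ball y₀ r ×ˢ Metric.ball y₀ r ∈ 𝓝 (y₀, y₀) :=
    prod_mem_nhds (Metric.ball_mem_nhds _ hr) (Metric.ball_mem_nhds _ hr)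
  filter_upwards [h2] with p hp
  -- The straight segment in the chart is a competitor, and its speed is nearly constant.
  let η : ℝ → E := fun t => p.1 + t • (p.2 - p.1)
  have hη : ∀ t ∈ Icc (0 : ℝ) 1, η t ∈ Metric.ball y₀ r := fun t ht =>
    (convex_ball y₀ r).add_smul_sub_mem hp.1 hp.2 ht
  have hηd : ∀ t, HasDerivAt η (p.2 - p.1) t := fun t => by
    have := ((hasDerivAt_id t).smul_const (p.2 - p.1)).const_add p.1
    rwa [one_smul] at this
  have hηs : ContMDiff 𝓘(ℝ, ℝ) 𝓘(ℝ, E) 1 η := by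
    rw [contMDiff_iff_contDiff]
    exact contDiff_const.add (contDiff_id.smul contDiff_const)
  have hγ : ContMDiffOn 𝓘(ℝ, ℝ) I 1 (fun t => (extChartAt I x₀).symm (η t)) (Icc 0 1) :=
    (contMDiffOn_extChartAt_symm x₀).comp hηs.contMDiffOn
      fun t ht => (hball _ (hη t ht)).2
  have h3 := riemDist_le_riemLength g hγ zero_le_one
  simp only [η, zero_smul, add_zero, one_smul, add_sub_cancel] at h3
  refine h3.trans ?_
  rw [riemLength_eq]
  have h4 : ∀ t ∈ Icc (0 : ℝ) 1, ENNReal.ofReal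
      (√(g.inner ((extChartAt I x₀).symm (η t))
        (mfderivWithin 𝓘(ℝ, ℝ) I (fun t => (extChartAt I x₀).symm (η t)) (Icc 0 1) t (1 : ℝ))
        (mfderivWithin 𝓘(ℝ, ℝ) I (fun t => (extChartAt I x₀).symm (η t)) (Icc 0 1) t (1 : ℝ)))) ≤
      ENNReal.ofReal (√(chartForm g x₀ y₀ (p.2 - p.1) (p.2 - p.1)) + ε * ‖p.2 - p.1‖) := by
    intro t ht
    have ht' := hball _ (hη t ht)
    have hu : UniqueMDiffWithinAt 𝓘(ℝ, ℝ) (Icc (0 : ℝ) 1) t := by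
      rw [uniqueMDiffWithinAt_iff_uniqueDiffWithinAt]
      exact uniqueDiffOn_Icc zero_lt_one _ ht
    have hd : mfderivWithin 𝓘(ℝ, ℝ) I (fun t => (extChartAt I x₀).symm (η t)) (Icc 0 1) t (1 : ℝ) =
        mfderiv 𝓘(ℝ, E) I (extChartAt I x₀).symm (η t) (p.2 - p.1) := by
      have := mfderiv_comp_mfderivWithin (I := 𝓘(ℝ, ℝ)) (I' := 𝓘(ℝ, E)) (I'' := I)
        (g := (extChartAt I x₀).symm) (f := η) (s := Icc 0 1) t
        ((contMDiffAt_extChartAt_symm ht'.2).mdifferentiableAt (by simp))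
        ((hηs.mdifferentiable (by simp) t).mdifferentiableWithinAt) hu
      refine (DFunLike.congr_fun this (1 : ℝ)).trans ?_
      have h5 : mfderivWithin 𝓘(ℝ, ℝ) 𝓘(ℝ, E) η (Icc 0 1) t (1 : ℝ) = p.2 - p.1 := by
        rw [mfderivWithin_eq_fderivWithin]
        refine (DFunLike.congr_fun ((hηd t).hasDerivWithinAt.hasFDerivWithinAt.fderivWithin
          (uniqueDiffOn_Icc zero_lt_one _ ht)) (1 : ℝ)).trans ?_
        exact one_smul ℝ _
      exact congrArg _ h5
    refine ENNReal.ofReal_le_ofReal ?_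
    rw [hd]
    exact sqrt_le_sqrt_add_of_abs_sub_le (by positivity) (ht'.1 _)
  refine (setLIntegral_mono' measurableSet_Icc h4).trans ?_
  simp

/-- Infinitesimally, a linear form on the coordinate space with gradient of norm less than `C` is
`C`-Lipschitz for the Riemannian distance. -/
theorem eventually_linear_le_riemDist [RegularSpace M] {x₀ : M} {y₀ : E}
    (hy : y₀ ∈ (extChartAt I x₀).target)
    (l : E →L[ℝ] ℝ) {C₀ C : ℝ} (hC : C₀ < C) (hC₀ : 0 ≤ C₀)
    (hl : ∀ v, |l v| ≤ C₀ * √(chartForm g x₀ y₀ v v)) : ∀ᶠ p : E × E in 𝓝 (y₀, y₀),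
      ENNReal.ofReal |l (p.2 - p.1)| ≤ ENNReal.ofReal C *
        riemDist g ((extChartAt I x₀).symm p.1) ((extChartAt I x₀).symm p.2) := by
  obtain ⟨μ, hμ, hμ'⟩ := exists_norm_le_sqrt_bilin (chartForm g x₀ y₀)
    (fun v hv => chartForm_pos g hy hv)
  have hC1 : 0 < C := hC₀.trans_lt hC
  have hε : 0 < (C - C₀) * μ / C := div_pos (mul_pos (sub_pos.2 hC) hμ) hC1
  have h1 : ∀ᶠ y in 𝓝 y₀, y ∈ (extChartAt I x₀).target ∧
      ∀ v, |l v| ≤ C * √(chartForm g x₀ y v v) := by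
    filter_upwards [eventually_abs_chartForm_sub_le g hy hε,
      extChartAt_target_mem_nhds' hy] with y hyn hyt
    refine ⟨hyt, fun v => (hl v).trans ?_⟩
    have h2 := sqrt_le_sqrt_add_of_abs_sub_le (by positivity)
      ((abs_sub_comm _ _).trans_le (hyn v))
    have h3 := hμ' v
    have h4 : C * √(chartForm g x₀ y₀ v v) ≤ C * √(chartForm g x₀ y v v)
        + (C - C₀) * μ * ‖v‖ := by
      calc _ ≤ C * (√(chartForm g x₀ y v v) + (C - C₀) * μ / C * ‖v‖) := by gcongr
        _ = _ := by field_simp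
    have h5 : (C - C₀) * (μ * ‖v‖) ≤ (C - C₀) * √(chartForm g x₀ y₀ v v) :=
      mul_le_mul_of_nonneg_left h3 (sub_pos.2 hC).le
    nlinarith
  set x := (extChartAt I x₀).symm y₀ with hx
  have hxs : x ∈ (extChartAt I x₀).source := (extChartAt I x₀).map_target hy
  have h2 : ∀ᶠ z in 𝓝 x, z ∈ (extChartAt I x₀).source ∧
      ∀ v, |l v| ≤ C * √(chartForm g x₀ (extChartAt I x₀ z) v v) := by
    have hc : Tendsto (extChartAt I x₀) (𝓝 x) (𝓝 y₀) := by
      have := (contMDiffAt_extChartAt_of_mem (I := I) hxs).continuousAt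
      rwa [ContinuousAt, hx, (extChartAt I x₀).right_inv hy] at this
    filter_upwards [hc.eventually h1, (isOpen_extChartAt_source (I := I) x₀).mem_nhds hxs]
      with z hz hzs
    exact ⟨hzs, hz.2⟩
  -- A path of length less than `r / 2` that starts close to `x` cannot leave the neighbourhood on
  -- which `l` is bounded by `C` times the norm of the metric.
  obtain ⟨r, hr, hW⟩ := exists_riemDist_ball_subset g h2
  have hr2 : 0 < r / 2 := ENNReal.half_pos hr.ne'
  have hr4 : 0 < r / 2 / 2 := ENNReal.half_pos hr2.ne'
  have h3 : ∀ᶠ y in 𝓝 y₀, riemDist g x ((extChartAt I x₀).symm y) < r / 2 / 2 ∧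
      y ∈ (extChartAt I x₀).target :=
    ((contMDiffAt_extChartAt_symm hy).continuousAt.eventually
      (eventually_riemDist_lt g x hr4)).and (extChartAt_target_mem_nhds' hy)
  have h4 : ∀ᶠ p : E × E in 𝓝 (y₀, y₀), (riemDist g x ((extChartAt I x₀).symm p.1) < r / 2 / 2 ∧
      p.1 ∈ (extChartAt I x₀).target) ∧ (riemDist g x ((extChartAt I x₀).symm p.2) < r / 2 / 2 ∧
      p.2 ∈ (extChartAt I x₀).target) := by
    rw [nhds_prod_eq]
    exact h3.prod_mk h3
  filter_upwards [h4] with p hp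
  set z1 := (extChartAt I x₀).symm p.1
  set z2 := (extChartAt I x₀).symm p.2
  have hd : riemDist g z1 z2 < r / 2 := by
    refine (riemDist_triangle g z1 x z2).trans_lt ?_
    rw [riemDist_comm g z1 x, ← ENNReal.add_halves (r / 2)]
    exact ENNReal.add_lt_add hp.1.1 hp.2.1
  have key : ∀ R, riemDist g z1 z2 < R → R ≤ r / 2 →
      ENNReal.ofReal |l (p.2 - p.1)| ≤ ENNReal.ofReal C * R := by
    intro R hR hRr
    obtain ⟨γ, h0, h1', hγ, hlen⟩ := exists_riemLength_lt g hR
    have hin : ∀ t ∈ Icc (0 : ℝ) 1, γ t ∈ (extChartAt I x₀).source ∧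
        ∀ v, |l v| ≤ C * √(chartForm g x₀ (extChartAt I x₀ (γ t)) v v) := by
      intro t ht
      apply hW
      have h5 : riemDist g z1 (γ t) < r / 2 := by
        have := riemDist_le_riemLength g (hγ.mono (Icc_subset_Icc_right ht.2)) ht.1
        rw [h0] at this
        exact ((this.trans (riemLength_mono g γ le_rfl ht.2)).trans_lt hlen).trans_le hRr
      refine (riemDist_triangle g x z1 (γ t)).trans_lt ?_
      rw [← ENNReal.add_halves r]
      exact ENNReal.add_lt_add (hp.1.1.trans_le ENNReal.half_le_self) h5
    -- Integrate the derivative of `l` along the path.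
    let f : ℝ → ℝ := fun t => l (extChartAt I x₀ (γ t))
    have hφγ : ContMDiffOn 𝓘(ℝ, ℝ) 𝓘(ℝ, E) 1 (fun t => extChartAt I x₀ (γ t)) (Icc 0 1) :=
      ContMDiffOn.comp (t := (extChartAt I x₀).source) (I' := I)
        (by simpa using contMDiffOn_extChartAt (I := I) (n := 1) (x := x₀)) hγ
        fun t ht => (hin t ht).1
    have hf : ContDiffOn ℝ 1 f (Icc 0 1) :=
      l.contDiff.comp_contDiffOn (contMDiffOn_iff_contDiffOn.1 hφγ)
    have h6 := enorm_sub_le_lintegral_derivWithin_Icc_of_contDiffOn_Icc hf zero_le_one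
    have h7 : f 1 - f 0 = l (p.2 - p.1) := by
      simp only [f, h0, h1', map_sub, z1, z2]
      rw [(extChartAt I x₀).right_inv hp.1.2, (extChartAt I x₀).right_inv hp.2.2]
    rw [h7, Real.enorm_eq_ofReal_abs] at h6
    refine h6.trans (le_trans ?_ (mul_le_mul_right hlen.le _))
    rw [riemLength_eq, ← lintegral_const_mul' _ _ ENNReal.ofReal_ne_top]
    refine setLIntegral_mono' measurableSet_Icc fun t ht => ?_
    rw [Real.enorm_eq_ofReal_abs, ← ENNReal.ofReal_mul hC1.le]
    refine ENNReal.ofReal_le_ofReal ?_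
    have hu : UniqueDiffWithinAt ℝ (Icc (0 : ℝ) 1) t := uniqueDiffOn_Icc zero_lt_one _ ht
    have hum : UniqueMDiffWithinAt 𝓘(ℝ, ℝ) (Icc (0 : ℝ) 1) t :=
      uniqueMDiffWithinAt_iff_uniqueDiffWithinAt.2 hu
    have hγd : MDifferentiableWithinAt 𝓘(ℝ, ℝ) I γ (Icc 0 1) t :=
      hγ.mdifferentiableOn (by simp) t ht
    set w := mfderivWithin 𝓘(ℝ, ℝ) I γ (Icc 0 1) t (1 : ℝ) with hw
    have h8 : derivWithin f (Icc 0 1) t = l (mfderiv I 𝓘(ℝ, E) (extChartAt I x₀) (γ t) w) := by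
      have e1 := mfderiv_comp_mfderivWithin (I := 𝓘(ℝ, ℝ)) (I' := I) (I'' := 𝓘(ℝ, E))
        (g := extChartAt I x₀) (f := γ) (s := Icc 0 1) t
        ((contMDiffAt_extChartAt_of_mem (hin t ht).1).mdifferentiableAt (by simp)) hγd hum
      rw [mfderivWithin_eq_fderivWithin] at e1
      have e2 := DFunLike.congr_fun e1 (1 : ℝ)
      have e3 : DifferentiableWithinAt ℝ (extChartAt I x₀ ∘ γ) (Icc 0 1) t :=
        (contMDiffOn_iff_contDiffOn.1 hφγ).differentiableOn (by simp) t ht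
      have e4 := (l.hasFDerivAt.comp_hasFDerivWithinAt t e3.hasFDerivWithinAt).fderivWithin hu
      rw [← fderivWithin_derivWithin]
      refine (DFunLike.congr_fun e4 (1 : ℝ)).trans ?_
      exact congrArg l e2
    rw [h8]
    refine ((hin t ht).2 _).trans (le_of_eq ?_)
    have e5 := mfderiv_extChartAt_symm_comp (hin t ht).1 w
    have e6 : ∀ v : E, chartForm g x₀ (extChartAt I x₀ (γ t)) v v = g.inner (γ t)
        (mfderiv 𝓘(ℝ, E) I (extChartAt I x₀).symm (extChartAt I x₀ (γ t)) v)
        (mfderiv 𝓘(ℝ, E) I (extChartAt I x₀).symm (extChartAt I x₀ (γ t)) v) := by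
      intro v
      rw [chartForm_apply, (extChartAt I x₀).left_inv (hin t ht).1]
    have e7 := (e6 (mfderiv I 𝓘(ℝ, E) (extChartAt I x₀) (γ t) w)).trans
      (congrArg₂ (fun a b => g.inner (γ t) a b) e5 e5)
    exact congrArg (fun a => C * √a) e7
  refine le_of_forall_gt_imp_ge_of_dense fun b hb => ?_
  have hCt : ENNReal.ofReal C ≠ 0 := by simpa using hC1
  have hb' : riemDist g z1 z2 < b / ENNReal.ofReal C := by
    rw [ENNReal.lt_div_iff_mul_lt (Or.inl hCt) (Or.inl ENNReal.ofReal_ne_top), mul_comm]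
    exact hb
  refine (key (min (b / ENNReal.ofReal C) (r / 2)) (lt_min hb' hd) (min_le_right _ _)).trans ?_
  refine (mul_le_mul_right (min_le_left _ _) _).trans ?_
  rw [ENNReal.mul_div_cancel hCt ENNReal.ofReal_ne_top]

end LocalComparison

/-! ### Metric geodesics -/

section MetricGeodesics

/-- A transitive relation on an interval that holds locally, on both sides of each point, holds
between the endpoints. -/
theorem rel_Icc_of_locally {P : ℝ → ℝ → Prop} {a b : ℝ} (hab : a ≤ b)
    (htrans : ∀ r s t, a ≤ r → r ≤ s → s ≤ t → t ≤ b → P r s → P s t → P r t)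
    (hloc : ∀ t ∈ Icc a b, ∃ ε > 0, ∀ r s, r ∈ Icc a b → s ∈ Icc a b → t - ε < r → r ≤ s →
      s < t + ε → P r s) : P a b := by
  -- The supremum of the times that are related to `a` is attained and equals `b`.
  let S : Set ℝ := {t | t ∈ Icc a b ∧ P a t}
  have haa : a ∈ S := by
    obtain ⟨ε, hε, h⟩ := hloc a ⟨le_rfl, hab⟩
    exact ⟨⟨le_rfl, hab⟩, h a a ⟨le_rfl, hab⟩ ⟨le_rfl, hab⟩ (by linarith) le_rfl (by linarith)⟩
  have hbdd : BddAbove S := ⟨b, fun t ht => ht.1.2⟩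
  set c := sSup S with hc
  have hcm : c ∈ Icc a b := ⟨le_csSup hbdd haa, csSup_le ⟨a, haa⟩ fun t ht => ht.1.2⟩
  obtain ⟨ε, hε, h⟩ := hloc c hcm
  obtain ⟨s, hs, hsc⟩ := exists_lt_of_lt_csSup ⟨a, haa⟩ (show c - ε < sSup S by rw [← hc]; linarith)
  have hsle : s ≤ c := le_csSup hbdd hs
  have h1 : ∀ t ∈ Icc a b, c ≤ t → t < c + ε → t ∈ S := fun t ht h1 h2 =>
    ⟨ht, htrans a s t le_rfl hs.1.1 (hsle.trans h1) ht.2 hs.2 (h s t hs.1 ht hsc (hsle.trans h1) h2)⟩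
  rcases hcm.2.eq_or_lt with hcb | hcb
  · rw [← hcb]
    exact (h1 c hcm le_rfl (by linarith)).2
  · exfalso
    have h2 : min b (c + ε / 2) ∈ S := by
      refine h1 _ ⟨le_min (hcm.1.trans hcb.le) (by linarith [hcm.1]), min_le_left _ _⟩
        (le_min hcb.le (by linarith)) ((min_le_right _ _).trans_lt (by linarith))
    have h3 := le_csSup hbdd h2
    rw [← hc] at h3
    exact absurd h3 (not_le.2 (lt_min hcb (by linarith)))

/-- In a compact space with a continuous distance for which intermediate points exist, any two
points are joined by a minimizing geodesic. -/
theorem exists_metric_geodesic {X : Type*} [TopologicalSpace X] [CompactSpace X] {d : X → X → ℝ}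
    (hd : Continuous fun p : X × X => d p.1 p.2) (htri : ∀ x y z, d x z ≤ d x y + d y z)
    (hself : ∀ x, d x x = 0) (hnonneg : ∀ x y, 0 ≤ d x y)
    (hmid : ∀ x y s, 0 ≤ s → s ≤ d x y → ∃ z, d x z = s ∧ d z y = d x y - s) (x y : X) :
    ∃ γ : ℝ → X, d x (γ 0) ≤ 0 ∧ d (γ (d x y)) y ≤ 0 ∧
      ∀ s t, 0 ≤ s → s ≤ t → t ≤ d x y → d (γ s) (γ t) = t - s := by
  -- A geodesic on a finite set of times: the point for the largest time is chosen between `x` and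
  -- `y`, the others between `x` and that point.
  have hfin : ∀ F : Finset ℝ, (∀ s ∈ F, 0 ≤ s) → ∀ x y, (∀ s ∈ F, s ≤ d x y) →
      ∃ γ : ℝ → X, (∀ s ∈ F, d x (γ s) ≤ s ∧ d (γ s) y ≤ d x y - s) ∧
        ∀ s ∈ F, ∀ t ∈ F, s < t → d (γ s) (γ t) ≤ t - s := by
    intro F
    induction F using Finset.induction_on_max with
    | empty => exact fun _ x y _ => ⟨fun _ => x, by simp, by simp⟩
    | insert t F htF ih =>
      intro h0 x y hle
      obtain ⟨z, hz1, hz2⟩ := hmid x y t (h0 t (by simp)) (hle t (by simp))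
      obtain ⟨γ, h1, h2⟩ := ih (fun s hs => h0 s (by simp [hs])) x z
        (fun s hs => (htF s hs).le.trans hz1.ge)
      have hne : ∀ s ∈ F, s ≠ t := fun s hs => (htF s hs).ne
      refine ⟨Function.update γ t z, ?_, ?_⟩
      · intro s hs
        rcases Finset.mem_insert.1 hs with rfl | hs
        · simp [hz1, hz2]
        · rw [Function.update_of_ne (hne s hs)]
          refine ⟨(h1 s hs).1, (htri _ z _).trans ?_⟩
          linarith [(h1 s hs).2]
      · intro s hs u hu hsu
        rcases Finset.mem_insert.1 hu with rfl | hu'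
        · rcases Finset.mem_insert.1 hs with rfl | hs
          · exact absurd hsu (lt_irrefl _)
          · rw [Function.update_of_ne (hne s hs), Function.update_self]
            linarith [(h1 s hs).2]
        · rcases Finset.mem_insert.1 hs with rfl | hs
          · exact absurd hsu (htF u hu').le.not_gt
          · rw [Function.update_of_ne (hne s hs), Function.update_of_ne (hne u hu')]
            exact h2 s hs u hu' hsu
  have hfin' : ∀ F : Finset ℝ, ∃ γ : ℝ → X,
      (∀ s ∈ F, 0 ≤ s → s ≤ d x y → d x (γ s) ≤ s ∧ d (γ s) y ≤ d x y - s) ∧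
      ∀ s ∈ F, ∀ t ∈ F, 0 ≤ s → s < t → t ≤ d x y → d (γ s) (γ t) ≤ t - s := by
    intro F
    obtain ⟨γ, h1, h2⟩ := hfin (F.filter fun s => 0 ≤ s ∧ s ≤ d x y)
      (fun s hs => (Finset.mem_filter.1 hs).2.1) x y (fun s hs => (Finset.mem_filter.1 hs).2.2)
    refine ⟨γ, fun s hs h3 h4 => h1 s (Finset.mem_filter.2 ⟨hs, h3, h4⟩),
      fun s hs t ht h3 h4 h5 => h2 s (Finset.mem_filter.2 ⟨hs, h3, h4.le.trans h5⟩) t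
        (Finset.mem_filter.2 ⟨ht, h3.trans h4.le, h5⟩) h4⟩
  choose γ hγ1 hγ2 using hfin'
  -- The limit along an ultrafilter finer than the filter of large finite sets of times.
  let 𝒰 : Ultrafilter (Finset ℝ) := Ultrafilter.of atTop
  have hle : (𝒰 : Filter (Finset ℝ)) ≤ atTop := Ultrafilter.of_le _
  have hlim : ∀ s, ∃ z, Tendsto (fun F => γ F s) 𝒰 (𝓝 z) := fun s => by
    obtain ⟨z, -, hz⟩ := isCompact_univ.ultrafilter_le_nhds (𝒰.map fun F => γ F s) (by simp)
    exact ⟨z, hz⟩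
  choose Γ hΓ using hlim
  have hmem : ∀ s, ∀ᶠ F in (𝒰 : Filter (Finset ℝ)), s ∈ F := fun s =>
    hle (by filter_upwards [eventually_ge_atTop ({s} : Finset ℝ)] with F hF using hF (by simp))
  have hA : ∀ s, 0 ≤ s → s ≤ d x y → d x (Γ s) ≤ s ∧ d (Γ s) y ≤ d x y - s := fun s h0 h1 => by
    constructor
    · refine le_of_tendsto ((hd.tendsto (x, Γ s)).comp (tendsto_const_nhds.prodMk_nhds (hΓ s))) ?_
      filter_upwards [hmem s] with F hF using (hγ1 F s hF h0 h1).1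
    · refine le_of_tendsto ((hd.tendsto (Γ s, y)).comp ((hΓ s).prodMk_nhds tendsto_const_nhds)) ?_
      filter_upwards [hmem s] with F hF using (hγ1 F s hF h0 h1).2
  have hB : ∀ s t, 0 ≤ s → s ≤ t → t ≤ d x y → d (Γ s) (Γ t) ≤ t - s := fun s t h0 h1 h2 => by
    rcases h1.eq_or_lt with rfl | h1
    · rw [hself, sub_self]
    refine le_of_tendsto ((hd.tendsto (Γ s, Γ t)).comp ((hΓ s).prodMk_nhds (hΓ t))) ?_
    filter_upwards [hmem s, hmem t] with F hF hF' using hγ2 F s hF t hF' h0 h1 h2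
  refine ⟨Γ, (hA 0 le_rfl (hnonneg x y)).1, by simpa using (hA _ (hnonneg x y) le_rfl).2, fun s t h0 h1 h2 => ?_⟩
  refine le_antisymm (hB s t h0 h1 h2) ?_
  have h3 := htri x (Γ s) y
  have h4 := htri (Γ s) (Γ t) y
  linarith [(hA s h0 (h1.trans h2)).1, (hA t (h0.trans h1) h2).2]

end MetricGeodesics

section RiemDistReal

variable {E H M : Type*} [NormedAddCommGroup E] [NormedSpace ℝ E]
  [TopologicalSpace H] [TopologicalSpace M] [ChartedSpace H M]
  {I : ModelWithCorners ℝ E H} [IsManifold I ∞ M]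
  (g : ContMDiffRiemannianMetric I ∞ E (fun x : M => TangentSpace I x))

/-- On a connected manifold the distance is finite: the points at finite distance from a given one
form a set that is both open and closed. -/
theorem riemDist_ne_top [PreconnectedSpace M] (x y : M) : riemDist g x y ≠ ⊤ := by
  have hclopen : IsClopen {y | riemDist g x y < ⊤} := by
    constructor
    · rw [← isOpen_compl_iff, isOpen_iff_mem_nhds]
      intro y hy
      filter_upwards [eventually_riemDist_lt g y (zero_lt_one)] with z hz hlt
      refine hy ((riemDist_triangle g x z y).trans_lt ?_)
      rw [riemDist_comm g z y]
      exact ENNReal.add_lt_top.2 ⟨hlt, hz.trans ENNReal.one_lt_top⟩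
    · rw [isOpen_iff_mem_nhds]
      intro y hy
      filter_upwards [eventually_riemDist_lt g y (zero_lt_one)] with z hz
      exact (riemDist_triangle g x y z).trans_lt
        (ENNReal.add_lt_top.2 ⟨hy, hz.trans ENNReal.one_lt_top⟩)
  have h := hclopen.eq_univ ⟨x, by simp [riemDist_self]⟩
  have : y ∈ {y | riemDist g x y < ⊤} := h ▸ mem_univ y
  exact this.ne

/-- The real-valued distance of a Riemannian metric on a connected manifold. -/
def rdist (x y : M) : ℝ := (riemDist g x y).toReal

theorem rdist_nonneg (x y : M) : 0 ≤ rdist g x y := ENNReal.toReal_nonneg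

theorem rdist_self (x : M) : rdist g x x = 0 := by simp [rdist, riemDist_self]

theorem rdist_comm (x y : M) : rdist g x y = rdist g y x := by rw [rdist, riemDist_comm, rdist]

variable [PreconnectedSpace M]

theorem ofReal_rdist (x y : M) : ENNReal.ofReal (rdist g x y) = riemDist g x y :=
  ENNReal.ofReal_toReal (riemDist_ne_top g x y)

theorem rdist_triangle (x y z : M) : rdist g x z ≤ rdist g x y + rdist g y z := by
  rw [rdist, rdist, rdist, ← ENNReal.toReal_add (riemDist_ne_top g _ _) (riemDist_ne_top g _ _)]
  exact ENNReal.toReal_mono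
    (ENNReal.add_ne_top.2 ⟨riemDist_ne_top g _ _, riemDist_ne_top g _ _⟩) (riemDist_triangle g x y z)

theorem eventually_rdist_lt (x : M) {c : ℝ} (hc : 0 < c) : ∀ᶠ y in 𝓝 x, rdist g x y < c := by
  filter_upwards [eventually_riemDist_lt g x (ENNReal.ofReal_pos.2 hc)] with y hy
  rw [← ofReal_rdist] at hy
  exact (ENNReal.ofReal_lt_ofReal_iff hc).1 hy

theorem continuous_rdist : Continuous fun p : M × M => rdist g p.1 p.2 := by
  rw [continuous_iff_continuousAt]
  rintro ⟨x, y⟩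
  rw [ContinuousAt, Metric.tendsto_nhds]
  intro ε hε
  have h1 := (eventually_rdist_lt g x (half_pos hε)).prod_mk (eventually_rdist_lt g y (half_pos hε))
  rw [← nhds_prod_eq] at h1
  filter_upwards [h1] with p hp
  rw [Real.dist_eq, abs_lt]
  have a1 := rdist_triangle g p.1 x p.2
  have a2 := rdist_triangle g x y p.2
  have a3 := rdist_triangle g x p.1 y
  have a4 := rdist_triangle g p.1 p.2 y
  rw [rdist_comm g p.1 x] at a1
  rw [rdist_comm g p.2 y] at a4
  constructor <;> linarith [hp.1, hp.2]

/-- On a compact manifold, the points `z` with `d(x, z) + d(z, y) = d(x, y)` occur at every distance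
from `x`: almost shortest paths give them up to `ε`, and the distance to `y` attains its minimum on
the sphere about `x`. -/
theorem exists_rdist_intermediate [CompactSpace M] (x y : M) (s : ℝ) (h0 : 0 ≤ s)
    (hs : s ≤ rdist g x y) : ∃ z, rdist g x z = s ∧ rdist g z y = rdist g x y - s := by
  have hc1 : Continuous fun z => rdist g x z :=
    (continuous_rdist g).comp (continuous_const.prodMk continuous_id)
  have hc2 : Continuous fun z => rdist g z y :=
    (continuous_rdist g).comp (continuous_id.prodMk continuous_const)
  have key : ∀ ε > 0, ∃ z, rdist g x z = s ∧ rdist g z y ≤ rdist g x y - s + ε := by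
    intro ε hε
    have hlt : riemDist g x y < ENNReal.ofReal (rdist g x y + ε) := by
      rw [← ofReal_rdist]
      exact (ENNReal.ofReal_lt_ofReal_iff (by linarith)).2 (by linarith)
    obtain ⟨γ, hγ0, hγ1, hγ, hlen⟩ := exists_riemLength_lt g hlt
    have hcont : ContinuousOn (fun t => rdist g x (γ t)) (Icc 0 1) :=
      hc1.comp_continuousOn hγ.continuousOn
    obtain ⟨t, ht, hts⟩ := intermediate_value_Icc zero_le_one hcont
      (show s ∈ Icc _ _ by simp only [hγ0, hγ1, rdist_self]; exact ⟨h0, hs⟩)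
    refine ⟨γ t, hts, ?_⟩
    have h1 := riemDist_le_riemLength g (hγ.mono (Icc_subset_Icc_right ht.2)) ht.1
    have h2 := riemDist_le_riemLength g (hγ.mono (Icc_subset_Icc_left ht.1)) ht.2
    have h3 := (add_le_add h1 h2).trans_lt ((riemLength_add g γ ht.1 ht.2).trans_lt hlen)
    rw [hγ0, hγ1, ← ofReal_rdist, ← ofReal_rdist, ← ENNReal.ofReal_add (rdist_nonneg g _ _)
      (rdist_nonneg g _ _)] at h3
    have h4 := (ENNReal.ofReal_lt_ofReal_iff (by linarith [rdist_nonneg g x y])).1 h3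
    simp only at hts
    linarith
  obtain ⟨z0, hz0, -⟩ := key 1 one_pos
  obtain ⟨z, hz, hmin⟩ := (isClosed_eq hc1 continuous_const).isCompact.exists_isMinOn
    ⟨z0, hz0⟩ hc2.continuousOn
  refine ⟨z, hz, le_antisymm ?_ ?_⟩
  · refine le_of_forall_pos_le_add fun ε hε => ?_
    obtain ⟨w, hw, hw'⟩ := key ε hε
    exact (hmin hw).trans hw'
  · have := rdist_triangle g x z y
    have hz' : rdist g x z = s := hz
    linarith

/-- Two points of a compact connected manifold are joined by a curve parametrized by arc length that
realizes the distance. No smoothness is asserted here; it is proved in `IsLocalMetric.geodesic`. -/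
theorem exists_rdist_geodesic [CompactSpace M] [T2Space M] (x y : M) :
    ∃ γ : ℝ → M, γ 0 = x ∧ γ (rdist g x y) = y ∧
      ∀ s t, 0 ≤ s → s ≤ t → t ≤ rdist g x y → rdist g (γ s) (γ t) = t - s := by
  obtain ⟨γ, h0, h1, h2⟩ := exists_metric_geodesic (continuous_rdist g) (rdist_triangle g)
    (rdist_self g) (rdist_nonneg g)
    (fun x y s => exists_rdist_intermediate g x y s) x y
  have hsep : ∀ x y, rdist g x y ≤ 0 → x = y := by
    intro x y h
    by_contra hne
    obtain ⟨c, hc, hsub⟩ := exists_riemDist_ball_subset g (isOpen_ne.mem_nhds hne)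
    refine hsub (a := y) ?_ rfl
    have : riemDist g x y = 0 := by rw [← ofReal_rdist]; exact ENNReal.ofReal_of_nonpos h
    simpa [this] using hc
  exact ⟨γ, (hsep _ _ h0).symm, hsep _ _ h1, h2⟩

end RiemDistReal

/-! ### Bilinear forms and local metrics -/

section BilSpace

/-- The normed space of continuous bilinear forms. It is a type synonym of the space of iterated
continuous linear maps, which keeps instance search for spaces of derivatives of fields of bilinear
forms manageable. -/
def Bil (E : Type*) [NormedAddCommGroup E] [NormedSpace ℝ E] := E →L[ℝ] E →L[ℝ] ℝ

variable {E : Type*} [NormedAddCommGroup E] [NormedSpace ℝ E]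

instance : NormedAddCommGroup (Bil E) := inferInstanceAs (NormedAddCommGroup (E →L[ℝ] E →L[ℝ] ℝ))

instance : NormedSpace ℝ (Bil E) := inferInstanceAs (NormedSpace ℝ (E →L[ℝ] E →L[ℝ] ℝ))

instance : FunLike (Bil E) E (E →L[ℝ] ℝ) := inferInstanceAs (FunLike (E →L[ℝ] E →L[ℝ] ℝ) E _)

instance : LinearMapClass (Bil E) ℝ E (E →L[ℝ] ℝ) :=
  inferInstanceAs (LinearMapClass (E →L[ℝ] E →L[ℝ] ℝ) ℝ E (E →L[ℝ] ℝ))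

theorem Bil.add_apply (A B : Bil E) (v : E) : (A + B) v = A v + B v := rfl

theorem Bil.smul_apply (r : ℝ) (B : Bil E) (v : E) : (r • B) v = r • B v := rfl

theorem Bil.abs_le (B : Bil E) {v w : E} {m r s : ℝ} (hB : ‖B‖ ≤ m) (hv : ‖v‖ ≤ r)
    (hw : ‖w‖ ≤ s) : |B v w| ≤ m * r * s := by
  have h1 : |B v w| ≤ ‖B‖ * ‖v‖ * ‖w‖ := ContinuousLinearMap.le_opNorm₂ (𝕜 := ℝ) (𝕜₂ := ℝ)
    (𝕜₃ := ℝ) (E := E) (F := E) (G := ℝ) B v w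
  have h2 : 0 ≤ r := (norm_nonneg _).trans hv
  have h3 : 0 ≤ m := (norm_nonneg _).trans hB
  exact h1.trans (by gcongr)

theorem Bil.continuous_apply : Continuous fun p : Bil E × E × E => p.1 p.2.1 p.2.2 := by
  have : Continuous fun p : (E →L[ℝ] E →L[ℝ] ℝ) × E × E => p.1 p.2.1 p.2.2 := by fun_prop
  exact this

theorem Bil.continuous_diag (B : Bil E) : Continuous fun v : E => B v v :=
  Bil.continuous_apply.comp (continuous_const.prodMk (continuous_id.prodMk continuous_id))

/-- The product rule for the evaluation of a bilinear form. -/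
theorem Bil.hasDerivAt_apply {B : ℝ → Bil E} {v w : ℝ → E} {B' : Bil E} {v' w' : E} {t : ℝ}
    (hB : HasDerivAt B B' t) (hv : HasDerivAt v v' t) (hw : HasDerivAt w w' t) :
    HasDerivAt (fun s => B s (v s) (w s)) (B' (v t) (w t) + B t v' (w t) + B t (v t) w') t := by
  have hB' : HasDerivAt (F := E →L[ℝ] E →L[ℝ] ℝ) B B' t := hB
  have h1 := HasDerivAt.clm_apply (F := E) (G := E →L[ℝ] ℝ) hB' hv
  exact h1.clm_apply hw

/-- The product rule for a field of bilinear forms evaluated along a curve. -/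
theorem hasDerivAt_bil_comp {A : E → Bil E} {x v w : ℝ → E} {x' v' w' : E} {t : ℝ}
    (hA : DifferentiableAt ℝ A (x t)) (hx : HasDerivAt x x' t) (hv : HasDerivAt v v' t)
    (hw : HasDerivAt w w' t) :
    HasDerivAt (fun s => A (x s) (v s) (w s))
      (fderiv ℝ A (x t) x' (v t) (w t) + A (x t) v' (w t) + A (x t) (v t) w') t :=
  Bil.hasDerivAt_apply (hA.hasFDerivAt.comp_hasDerivAt t hx) hv hw

end BilSpace

section LocalMetric

variable {E : Type*} [NormedAddCommGroup E] [NormedSpace ℝ E]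

/-- A distance `δ` that is infinitesimally given by a smooth field `A` of scalar products on the
open set `U` of a vector space. The lower bound for `δ` is expressed through linear forms. -/
structure IsLocalMetric (U : Set E) (A : E → Bil E) (δ : E → E → ℝ) : Prop where
  isOpen : IsOpen U
  smooth : ContDiffOn ℝ ∞ A U
  symm : ∀ y v w, A y v w = A y w v
  pos : ∀ y ∈ U, ∀ v, v ≠ 0 → 0 < A y v v
  self : ∀ x, δ x x = 0
  comm : ∀ x y, δ x y = δ y x
  triangle : ∀ x y z, δ x z ≤ δ x y + δ y z
  upper : ∀ y ∈ U, ∀ ε > 0, ∀ᶠ p : E × E in 𝓝 (y, y),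
    δ p.1 p.2 ≤ √(A y (p.2 - p.1) (p.2 - p.1)) + ε * ‖p.2 - p.1‖
  lower : ∀ y ∈ U, ∀ (l : E →L[ℝ] ℝ) (C₀ C : ℝ), 0 ≤ C₀ → C₀ < C →
    (∀ v, |l v| ≤ C₀ * √(A y v v)) → ∀ᶠ p : E × E in 𝓝 (y, y), |l (p.2 - p.1)| ≤ C * δ p.1 p.2

variable {U : Set E} {A : E → Bil E} {δ : E → E → ℝ}

theorem sqrt_bilin_le_opNorm (B : Bil E) (v : E) : √(B v v) ≤ √‖B‖ * ‖v‖ := by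
  rw [← Real.sqrt_sq (norm_nonneg v), ← Real.sqrt_mul (norm_nonneg B)]
  refine Real.sqrt_le_sqrt ((le_abs_self _).trans ((B.abs_le le_rfl le_rfl le_rfl).trans_eq (by ring)))

/-- A local metric is locally bounded by a multiple of the norm. -/
theorem IsLocalMetric.eventually_le (h : IsLocalMetric U A δ) {y : E} (hy : y ∈ U) :
    ∃ K, 0 ≤ K ∧ ∀ᶠ p : E × E in 𝓝 (y, y), δ p.1 p.2 ≤ K * ‖p.2 - p.1‖ := by
  refine ⟨√‖A y‖ + 1, by positivity, ?_⟩
  filter_upwards [h.upper y hy 1 one_pos] with p hp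
  refine hp.trans ?_
  have := sqrt_bilin_le_opNorm (A y) (p.2 - p.1)
  linarith

/-- The norm is locally bounded by a multiple of a local metric: the lower bound for `δ` is applied to
the coordinate forms of a basis. Hence curves that are Lipschitz for `δ` are Lipschitz. -/
theorem IsLocalMetric.eventually_norm_le [FiniteDimensional ℝ E] (h : IsLocalMetric U A δ) {y : E}
    (hy : y ∈ U) : ∃ K, 0 ≤ K ∧ ∀ᶠ p : E × E in 𝓝 (y, y), ‖p.2 - p.1‖ ≤ K * δ p.1 p.2 := by
  obtain ⟨μ, hμ, hμ'⟩ := exists_norm_le_sqrt_bilin (A y) (h.pos y hy)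
  let b := Module.finBasis ℝ E
  let l : Fin (Module.finrank ℝ E) → E →L[ℝ] ℝ := fun i => LinearMap.toContinuousLinearMap (b.coord i)
  have hl : ∀ i, ∀ᶠ p : E × E in 𝓝 (y, y), |l i (p.2 - p.1)| ≤ (‖l i‖ / μ + 1) * δ p.1 p.2 := by
    intro i
    refine h.lower y hy (l i) (‖l i‖ / μ) _ (by positivity) (by linarith) fun v => ?_
    calc |l i v| ≤ ‖l i‖ * ‖v‖ := (l i).le_opNorm v
      _ = ‖l i‖ / μ * (μ * ‖v‖) := by field_simp
      _ ≤ _ := by gcongr; exact hμ' v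
  refine ⟨∑ i, (‖l i‖ / μ + 1) * ‖b i‖, by positivity, ?_⟩
  filter_upwards [eventually_all.2 hl] with p hp
  have h1 : p.2 - p.1 = ∑ i, l i (p.2 - p.1) • b i := (b.sum_repr (p.2 - p.1)).symm
  refine (congrArg _ h1).trans_le ?_
  rw [Finset.sum_mul]
  refine (norm_sum_le _ _).trans (Finset.sum_le_sum fun i _ => ?_)
  rw [norm_smul, Real.norm_eq_abs]
  calc |l i (p.2 - p.1)| * ‖b i‖ ≤ ((‖l i‖ / μ + 1) * δ p.1 p.2) * ‖b i‖ := by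
        gcongr; exact hp i
    _ = _ := by ring

theorem IsLocalMetric.abs_sub_le (h : IsLocalMetric U A δ) (x y z : E) :
    |δ x z - δ x y| ≤ δ y z := by
  have h1 := h.triangle x y z
  have h2 := h.triangle x z y
  rw [h.comm z y] at h2
  exact abs_le.2 ⟨by linarith, by linarith⟩

/-- The distance between the endpoints of a Lipschitz curve is at most its length. -/
theorem IsLocalMetric.le_integral (h : IsLocalMetric U A δ) {V V' : ℝ → E} {L : ℝ → ℝ} {a b : ℝ}
    {K : NNReal} (hab : a ≤ b) (hV : LipschitzOnWith K V (Icc a b)) (hU : ∀ t ∈ Icc a b, V t ∈ U)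
    (hd : ∀ᵐ t, t ∈ Ioo a b → HasDerivAt V (V' t) t)
    (hL : IntervalIntegrable L volume a b)
    (hle : ∀ᵐ t, t ∈ Ioo a b → √(A (V t) (V' t) (V' t)) ≤ L t) :
    δ (V a) (V b) ≤ ∫ t in a..b, L t := by
  have hint : ∀ r s, r ∈ Icc a b → s ∈ Icc a b → IntervalIntegrable L volume r s :=
    fun r s hr hs => hL.mono_set (by
      rw [uIcc_of_le hab]; exact uIcc_subset_Icc hr hs)
  refine rel_Icc_of_locally (P := fun r s => δ (V r) (V s) ≤ ∫ t in r..s, L t) hab ?_ ?_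
  · intro r s t har hrs hst htb h1 h2
    have m1 : r ∈ Icc a b := ⟨har, (hrs.trans hst).trans htb⟩
    have m2 : s ∈ Icc a b := ⟨har.trans hrs, hst.trans htb⟩
    have m3 : t ∈ Icc a b := ⟨(har.trans hrs).trans hst, htb⟩
    rw [← intervalIntegral.integral_add_adjacent_intervals (hint r s m1 m2) (hint s t m2 m3)]
    exact (h.triangle _ (V s) _).trans (add_le_add h1 h2)
  intro t₀ ht₀
  obtain ⟨C, hC, hup⟩ := h.eventually_le (hU t₀ ht₀)
  have hcont : ContinuousWithinAt V (Icc a b) t₀ := hV.continuousOn t₀ ht₀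
  rw [nhds_prod_eq] at hup
  obtain ⟨W, hW, hWup⟩ : ∃ W ∈ 𝓝[Icc a b] t₀, ∀ s ∈ W, ∀ t ∈ W,
      δ (V s) (V t) ≤ C * ‖V t - V s‖ := by
    obtain ⟨W, hW, hWup⟩ := (Filter.eventually_prod_self_iff
      (r := fun x y => δ x y ≤ C * ‖y - x‖)).1 hup
    exact ⟨_, hcont hW, fun s hs t ht => hWup _ hs _ ht⟩
  obtain ⟨ε, hε, hball⟩ := Metric.mem_nhdsWithin_iff.1 hW
  refine ⟨ε, hε, fun r s hr hs htr hrs hst => ?_⟩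
  have hsubW : Icc r s ⊆ W := fun t ht => hball ⟨by
    rw [Metric.mem_ball, Real.dist_eq, abs_lt]; constructor <;> linarith [ht.1, ht.2],
    hr.1.trans ht.1, ht.2.trans hs.2⟩
  have hsub : Icc r s ⊆ Icc a b := Icc_subset_Icc hr.1 hs.2
  -- The distance from `V r` is absolutely continuous along the curve, so it suffices to bound its
  -- derivative.
  let F : ℝ → ℝ := fun t => δ (V r) (V t)
  have hF : LipschitzOnWith (C.toNNReal * K) F (uIcc r s) := by
    rw [uIcc_of_le hrs]
    refine LipschitzOnWith.of_dist_le_mul fun x hx y hy => ?_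
    have h1 : δ (V y) (V x) ≤ C * ‖V x - V y‖ := hWup y (hsubW hy) x (hsubW hx)
    have h2 : ‖V x - V y‖ ≤ K * dist x y := by
      rw [← dist_eq_norm]; exact hV.dist_le_mul x (hsub hx) y (hsub hy)
    rw [Real.dist_eq, NNReal.coe_mul, Real.coe_toNNReal C hC, mul_assoc]
    exact (h.abs_sub_le _ _ _).trans (h1.trans (mul_le_mul_of_nonneg_left h2 hC))
  have hac := hF.absolutelyContinuousOnInterval
  have h1 : ∫ t in r..s, deriv F t = F s - F r := hac.integral_deriv_eq_sub
  have h2 : F s - F r = δ (V r) (V s) := by simp [F, h.self]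
  rw [← h2, ← h1]
  refine intervalIntegral.integral_mono_ae_restrict hrs hac.intervalIntegrable_deriv
    (hint r s hr hs) ?_
  rw [← Measure.restrict_congr_set Ioo_ae_eq_Icc]
  refine (ae_restrict_iff' measurableSet_Ioo).2 ?_
  filter_upwards [hd, hle, hac.ae_differentiableAt] with t htd htle htF ht
  have htab : t ∈ Ioo a b := ⟨hr.1.trans_lt ht.1, ht.2.trans_le hs.2⟩
  have hFd := (htF (by rw [uIcc_of_le hrs]; exact Ioo_subset_Icc_self ht)).hasDerivAt
  have hVd := htd htab
  refine le_trans ?_ (htle htab)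
  have hslopeF := hFd.tendsto_slope_zero_right
  have hslopeV := hVd.tendsto_slope_zero_right
  refine le_of_forall_pos_le_add fun ε' hε' => ?_
  have hη : 0 < ε' / (‖V' t‖ + 1) := by positivity
  -- The difference quotient of `F` is bounded by the norm of the difference quotient of `V`.
  have hbound : ∀ᶠ k in 𝓝[>] (0 : ℝ), k⁻¹ • (F (t + k) - F t) ≤
      √(A (V t) (k⁻¹ • (V (t + k) - V t)) (k⁻¹ • (V (t + k) - V t)))
        + ε' / (‖V' t‖ + 1) * ‖k⁻¹ • (V (t + k) - V t)‖ := by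
    have hup3 := h.upper (V t) (hU t (hsub (Ioo_subset_Icc_self ht))) _ hη
    have htend : Tendsto (fun k => (V t, V (t + k))) (𝓝[>] (0 : ℝ)) (𝓝 (V t, V t)) := by
      refine tendsto_const_nhds.prodMk_nhds (Tendsto.mono_left ?_ nhdsWithin_le_nhds)
      have h3 : Tendsto (fun k : ℝ => t + k) (𝓝 0) (𝓝 t) := by
        simpa using (continuous_const.add continuous_id).tendsto (0 : ℝ) (f := fun k : ℝ => t + k)
      exact hVd.continuousAt.tendsto.comp h3
    filter_upwards [htend.eventually hup3, self_mem_nhdsWithin] with k hk hk0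
    have hk0 : 0 < k := hk0
    have h3 : F (t + k) - F t ≤ δ (V t) (V (t + k)) :=
      (le_abs_self _).trans (h.abs_sub_le _ _ _)
    have h4 : √(A (V t) (k⁻¹ • (V (t + k) - V t)) (k⁻¹ • (V (t + k) - V t))) =
        k⁻¹ * √(A (V t) (V (t + k) - V t) (V (t + k) - V t)) := by
      have h5 : ∀ v : E, A (V t) (k⁻¹ • v) (k⁻¹ • v) = (k⁻¹ * k⁻¹) * A (V t) v v := fun v => by
        simp only [map_smul, smul_apply, smul_eq_mul]
        ring
      rw [h5, Real.sqrt_mul (by positivity), Real.sqrt_mul_self (by positivity)]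
    rw [h4, norm_smul, Real.norm_of_nonneg (inv_nonneg.2 hk0.le), smul_eq_mul]
    calc k⁻¹ * (F (t + k) - F t) ≤ k⁻¹ * (√(A (V t) (V (t + k) - V t) (V (t + k) - V t))
          + ε' / (‖V' t‖ + 1) * ‖V (t + k) - V t‖) := by
            gcongr
            exact h3.trans hk
      _ = _ := by ring
  have hcontn : Continuous fun v : E => √(A (V t) v v) + ε' / (‖V' t‖ + 1) * ‖v‖ :=
    (A (V t)).continuous_diag.sqrt.add (continuous_const.mul continuous_norm)
  have hlim := le_of_tendsto_of_tendsto hslopeF ((hcontn.tendsto _).comp hslopeV) hbound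
  refine hlim.trans ?_
  gcongr
  rw [div_mul_eq_mul_div, div_le_iff₀ (by positivity)]
  nlinarith [norm_nonneg (V' t)]

end LocalMetric

/-! ### The first variation of length -/

section FirstVariation

variable {E : Type*} [NormedAddCommGroup E] [NormedSpace ℝ E]
  {U : Set E} {A : E → Bil E} {δ : E → E → ℝ}

/-- A Lipschitz curve parametrized by arc length has speed at most one. -/
theorem IsLocalMetric.speed_le_one (h : IsLocalMetric U A δ) {c : ℝ → E} {a b t : ℝ} {c' : E}
    (ht : t ∈ Ioo a b) (hU : c t ∈ U)
    (hδ : ∀ s t, a ≤ s → s ≤ t → t ≤ b → δ (c s) (c t) = t - s)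
    (hd : HasDerivAt c c' t) : A (c t) c' c' ≤ 1 := by
  by_cases hc0 : c' = 0
  · simp [hc0]
  have hpos := h.pos _ hU c' hc0
  -- The lower bound for `δ` is applied to the linear form `A (c t) c'`, whose norm is the speed by
  -- the Cauchy–Schwarz inequality.
  have hcs : ∀ v, |A (c t) c' v| ≤ √(A (c t) c' c') * √(A (c t) v v) := by
    intro v
    rw [← Real.sqrt_mul hpos.le]
    refine Real.abs_le_sqrt ?_
    have hnn : ∀ w, 0 ≤ A (c t) w w := fun w => by
      by_cases hw : w = 0
      · simp [hw]
      · exact (h.pos _ hU w hw).le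
    have h1 := hnn (A (c t) c' c' • v - A (c t) c' v • c')
    simp only [map_sub, map_smul, sub_apply, smul_apply, smul_eq_mul, h.symm (c t) v c'] at h1
    have h2 : 0 ≤ A (c t) c' c' * (A (c t) c' c' * A (c t) v v - A (c t) c' v ^ 2) := by nlinarith
    nlinarith [nonneg_of_mul_nonneg_right h2 hpos]
  have key : ∀ C, √(A (c t) c' c') < C → A (c t) c' c' ≤ C := by
    intro C hC
    have h1 := h.lower (c t) hU (A (c t) c') _ C (Real.sqrt_nonneg _) hC hcs
    have htend : Tendsto (fun k => (c t, c (t + k))) (𝓝[>] (0 : ℝ)) (𝓝 (c t, c t)) := by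
      refine tendsto_const_nhds.prodMk_nhds (Tendsto.mono_left ?_ nhdsWithin_le_nhds)
      have h3 : Tendsto (fun k : ℝ => t + k) (𝓝 0) (𝓝 t) := by
        simpa using (continuous_const.add continuous_id).tendsto (0 : ℝ) (f := fun k : ℝ => t + k)
      exact hd.continuousAt.tendsto.comp h3
    have hlt : ∀ᶠ k in 𝓝[>] (0 : ℝ), k < b - t :=
      nhdsWithin_le_nhds (Iio_mem_nhds (sub_pos.2 ht.2))
    refine le_of_tendsto (((A (c t) c').continuous.tendsto _).comp hd.tendsto_slope_zero_right) ?_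
    filter_upwards [htend.eventually h1, self_mem_nhdsWithin, hlt] with k hk hk0 hkb
    have hk0 : 0 < k := hk0
    simp only [Function.comp_apply, map_smul, smul_eq_mul]
    rw [hδ t (t + k) ht.1.le (by linarith) (by linarith)] at hk
    rw [inv_mul_le_iff₀ hk0]
    exact (le_abs_self _).trans (hk.trans_eq (by ring))
  have h1 : A (c t) c' c' ≤ √(A (c t) c' c') := le_of_forall_gt_imp_ge_of_dense key
  have h2 := Real.sq_sqrt hpos.le
  have h3 := Real.sqrt_pos.2 hpos
  nlinarith

/-- The first variation of the energy of a minimizing Lipschitz curve `c`, parametrized by arc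
length, vanishes in the direction of a Lipschitz field that vanishes at the end points and has
constant direction `e`. -/
theorem IsLocalMetric.first_variation [FiniteDimensional ℝ E] (h : IsLocalMetric U A δ) {c : ℝ → E} {a b : ℝ} (hab : a < b)
    {K : NNReal} (hc : LipschitzWith K c) (hU : ∀ t ∈ Icc a b, c t ∈ U)
    (hδ : ∀ s t, a ≤ s → s ≤ t → t ≤ b → δ (c s) (c t) = t - s)
    {ψ : ℝ → ℝ} (hψm : Measurable ψ) {B : ℝ} (hψ : ∀ t, |ψ t| ≤ B)
    (hψ0 : ∫ t in a..b, ψ t = 0) (e : E) :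
    ∫ t in a..b, (2 * A (c t) (deriv c t) e * ψ t
      + fderiv ℝ A (c t) e (deriv c t) (deriv c t) * ∫ s in a..t, ψ s) = 0 := by
  let _ : MeasurableSpace E := borel E
  have _ : BorelSpace E := ⟨rfl⟩
  have hB0 : 0 ≤ B := (abs_nonneg _).trans (hψ a)
  have hψint : ∀ s t, IntervalIntegrable ψ volume s t := fun s t =>
    (intervalIntegrable_const (c := B)).mono_fun' hψm.aestronglyMeasurable
      (Eventually.of_forall fun t => hψ t)
  set H : ℝ → ℝ := fun t => ∫ s in a..t, ψ s with hH
  have hHlip : LipschitzWith B.toNNReal H := by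
    refine LipschitzWith.of_dist_le_mul fun s t => ?_
    rw [Real.dist_eq, Real.dist_eq, Real.coe_toNNReal B hB0,
      intervalIntegral.integral_interval_sub_left (hψint _ _) (hψint _ _)]
    exact intervalIntegral.norm_integral_le_of_norm_le_const (f := ψ) fun x _ => hψ x
  have hHae : ∀ᵐ t, HasDerivAt H (ψ t) t := by
    have : LocallyIntegrable ψ := fun t => by
      refine ⟨Ioc (t - 1) (t + 1), Ioc_mem_nhds (by linarith) (by linarith), ?_⟩
      exact (intervalIntegrable_iff_integrableOn_Ioc_of_le (by linarith)).1 (hψint _ _)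
    filter_upwards [LocallyIntegrable.ae_hasDerivAt_integral this] with t ht using ht a
  have hHa : H a = 0 := by simp [hH]
  have hHb : H b = 0 := hψ0
  have hHbd : ∀ t ∈ Icc a b, |H t| ≤ B * (b - a) := fun t ht => by
    have := hHlip.dist_le_mul t a
    rw [Real.dist_eq, Real.dist_eq, hHa, sub_zero, Real.coe_toNNReal B hB0,
      abs_of_nonneg (sub_nonneg.2 ht.1)] at this
    exact this.trans (by gcongr; exact ht.2)
  have hcae : ∀ᵐ t, HasDerivAt c (deriv c t) t := by
    filter_upwards [hc.ae_differentiableAt] with t ht using ht.hasDerivAt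
  have hcd : ∀ t, ‖deriv c t‖ ≤ K := fun t => norm_deriv_le_of_lipschitz hc
  have hcdm : Measurable (deriv c) := measurable_deriv c
  -- a compact neighbourhood of the curve inside `U`
  have hcomp : IsCompact (c '' Icc a b) := isCompact_Icc.image hc.continuous
  obtain ⟨ρ, hρ, hsub⟩ := hcomp.exists_cthickening_subset_open h.isOpen (image_subset_iff.2 hU)
  set T := Metric.cthickening ρ (c '' Icc a b) with hT
  have hTc : IsCompact T := hcomp.cthickening
  have hAd : ∀ y ∈ U, DifferentiableAt ℝ A y := fun y hy =>
    (h.smooth.contDiffAt (h.isOpen.mem_nhds hy)).differentiableAt (by simp)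
  have hAc : ContinuousOn A U := h.smooth.continuousOn
  have hA'c : ContinuousOn (fderiv ℝ A) U := h.smooth.continuousOn_fderiv_of_isOpen h.isOpen (by simp)
  obtain ⟨M₀, hM₀⟩ := hTc.exists_bound_of_continuousOn (hAc.mono hsub)
  obtain ⟨M₁, hM₁⟩ := hTc.exists_bound_of_continuousOn (hA'c.mono hsub)
  set ε₀ := ρ / (B * (b - a) * ‖e‖ + 1) with hε₀
  have hden : 0 < B * (b - a) * ‖e‖ + 1 := by
    have := sub_pos.2 hab
    positivity
  have hε₀pos : 0 < ε₀ := div_pos hρ hden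
  have hmemT : ∀ ε, |ε| ≤ ε₀ → ∀ t ∈ Icc a b, c t + (ε * H t) • e ∈ T := by
    intro ε hε t ht
    refine Metric.mem_cthickening_of_dist_le _ (c t) _ _ (mem_image_of_mem c ht) ?_
    rw [dist_eq_norm, add_sub_cancel_left, norm_smul, norm_mul, Real.norm_eq_abs, Real.norm_eq_abs]
    have h1 : 0 ≤ B * (b - a) := mul_nonneg hB0 (sub_pos.2 hab).le
    calc |ε| * |H t| * ‖e‖ ≤ ε₀ * (B * (b - a)) * ‖e‖ := by
          gcongr
          exact hHbd t ht
      _ = ρ * (B * (b - a) * ‖e‖) / (B * (b - a) * ‖e‖ + 1) := by rw [hε₀]; ring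
      _ ≤ ρ := by
          rw [div_le_iff₀ hden]
          nlinarith
  let x : ℝ → ℝ → E := fun ε t => c t + (ε * H t) • e
  let W : ℝ → ℝ → E := fun ε t => deriv c t + (ε * ψ t) • e
  let F : ℝ → ℝ → ℝ := fun ε t => A (x ε t) (W ε t) (W ε t)
  let F' : ℝ → ℝ → ℝ := fun ε t => fderiv ℝ A (x ε t) (H t • e) (W ε t) (W ε t)
    + A (x ε t) (ψ t • e) (W ε t) + A (x ε t) (W ε t) (ψ t • e)
  have hHc : Continuous H := hHlip.continuous
  have hxc : ∀ ε, Continuous (x ε) := fun ε =>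
    hc.continuous.add ((continuous_const.mul hHc).smul continuous_const)
  have hWm : ∀ ε, Measurable (W ε) := fun ε =>
    hcdm.add ((measurable_const.mul hψm).smul measurable_const)
  have hIoc : uIoc a b = Ioc a b := uIoc_of_le hab.le
  have hxm : ∀ ε, |ε| ≤ ε₀ → AEStronglyMeasurable (fun t => A (x ε t)) (volume.restrict (uIoc a b)) := by
    intro ε hε
    rw [hIoc]
    refine (ContinuousOn.mono ?_ Ioc_subset_Icc_self).aestronglyMeasurable measurableSet_Ioc
      (s := Ioc a b)
    exact hAc.comp (hxc ε).continuousOn fun t ht => hsub (hmemT ε hε t ht)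
  have hev := Bil.continuous_apply (E := E)
  have hFm : ∀ ε, |ε| ≤ ε₀ → AEStronglyMeasurable (F ε) (volume.restrict (uIoc a b)) := fun ε hε =>
    hev.comp_aestronglyMeasurable ((hxm ε hε).prodMk
      ((hWm ε).aestronglyMeasurable.prodMk (hWm ε).aestronglyMeasurable))
  set R := K + ε₀ * B * ‖e‖ with hR
  have hWb : ∀ ε, |ε| ≤ ε₀ → ∀ t, ‖W ε t‖ ≤ R := by
    intro ε hε t
    refine (norm_add_le _ _).trans (add_le_add (hcd t) ?_)
    rw [norm_smul, norm_mul, Real.norm_eq_abs, Real.norm_eq_abs]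
    gcongr
    exact hψ t
  have hF0int : ∀ ε, |ε| ≤ ε₀ → IntervalIntegrable (F ε) volume a b := by
    intro ε hε
    refine (intervalIntegrable_const (c := M₀ * R * R)).mono_fun' (hFm ε hε) ?_
    rw [hIoc]
    refine (ae_restrict_iff' measurableSet_Ioc).2 (Eventually.of_forall fun t ht => ?_)
    exact (A _).abs_le (hM₀ _ (hmemT ε hε t (Ioc_subset_Icc_self ht))) (hWb ε hε t) (hWb ε hε t)
  have hε₀0 : |(0 : ℝ)| ≤ ε₀ := by simpa using hε₀pos.le
  have hnhds : Metric.ball (0 : ℝ) ε₀ ∈ 𝓝 (0 : ℝ) := Metric.ball_mem_nhds _ hε₀pos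
  have hball : ∀ ε ∈ Metric.ball (0 : ℝ) ε₀, |ε| ≤ ε₀ := fun ε hε => by
    simpa using (Metric.mem_ball.1 hε).le
  -- The energy may be differentiated under the integral sign.
  have hderiv := intervalIntegral.hasDerivAt_integral_of_dominated_loc_of_deriv_le (μ := volume)
    (F := F) (F' := F') (a := a) (b := b) (x₀ := (0 : ℝ)) (s := Metric.ball (0 : ℝ) ε₀)
    (bound := fun _ => M₁ * (B * (b - a) * ‖e‖) * R * R + M₀ * (B * ‖e‖) * R
      + M₀ * R * (B * ‖e‖)) hnhds ?_ (hF0int 0 hε₀0) ?_ ?_ intervalIntegrable_const ?_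
  rotate_left
  · filter_upwards [hnhds] with ε hε using hFm ε (hball ε hε)
  · have hx'm : AEStronglyMeasurable (fun t => fderiv ℝ A (x 0 t)) (volume.restrict (uIoc a b)) := by
      rw [hIoc]
      refine (ContinuousOn.mono ?_ Ioc_subset_Icc_self).aestronglyMeasurable measurableSet_Ioc
        (s := Ioc a b)
      exact hA'c.comp (hxc 0).continuousOn fun t ht => hsub (hmemT 0 hε₀0 t ht)
    have hev2 : Continuous fun p : (E →L[ℝ] Bil E) × E × E × E => p.1 p.2.1 p.2.2.1 p.2.2.2 :=
      Bil.continuous_apply.comp (Continuous.prodMk (by fun_prop) (by fun_prop))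
    have hW0 := (hWm 0).aestronglyMeasurable (μ := volume.restrict (uIoc a b))
    have hHm := (hHc.smul (continuous_const (y := e))).aestronglyMeasurable
      (μ := volume.restrict (uIoc a b))
    have hψm' := (hψm.smul (measurable_const (a := e))).aestronglyMeasurable
      (μ := volume.restrict (uIoc a b))
    exact ((hev2.comp_aestronglyMeasurable (hx'm.prodMk (hHm.prodMk (hW0.prodMk hW0)))).add
      (hev.comp_aestronglyMeasurable ((hxm 0 hε₀0).prodMk (hψm'.prodMk hW0)))).add
      (hev.comp_aestronglyMeasurable ((hxm 0 hε₀0).prodMk (hW0.prodMk hψm')))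
  · refine Eventually.of_forall fun t ht ε hε => ?_
    rw [hIoc] at ht
    have hm := hmemT ε (hball ε hε) t (Ioc_subset_Icc_self ht)
    have hψe : ‖ψ t • e‖ ≤ B * ‖e‖ := by
      rw [norm_smul]; gcongr; exact hψ t
    have hHe : ‖H t • e‖ ≤ B * (b - a) * ‖e‖ := by
      rw [norm_smul]; gcongr; exact hHbd t (Ioc_subset_Icc_self ht)
    have hM1 : ‖fderiv ℝ A (x ε t) (H t • e)‖ ≤ M₁ * (B * (b - a) * ‖e‖) :=
      (ContinuousLinearMap.le_opNorm _ _).trans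
        (mul_le_mul (hM₁ _ hm) hHe (norm_nonneg _) ((norm_nonneg _).trans (hM₁ _ hm)))
    have hW := hWb ε (hball ε hε) t
    exact (norm_add₃_le).trans (add_le_add (add_le_add (Bil.abs_le _ hM1 hW hW)
      ((A _).abs_le (hM₀ _ hm) hψe hW)) ((A _).abs_le (hM₀ _ hm) hW hψe))
  · refine Eventually.of_forall fun t ht ε hε => ?_
    rw [hIoc] at ht
    have hm := hsub (hmemT ε (hball ε hε) t (Ioc_subset_Icc_self ht))
    have hx : HasDerivAt (fun ε => x ε t) (H t • e) ε := by
      have := (((hasDerivAt_id ε).mul_const (H t)).smul_const e).const_add (c t)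
      rw [one_mul] at this
      exact this
    have hw : HasDerivAt (fun ε => W ε t) (ψ t • e) ε := by
      have := (((hasDerivAt_id ε).mul_const (ψ t)).smul_const e).const_add (deriv c t)
      rw [one_mul] at this
      exact this
    exact hasDerivAt_bil_comp (hAd _ hm) hx hw hw
  -- the energy is minimal at `ε = 0`
  have hlow : ∀ ε, |ε| ≤ ε₀ → b - a ≤ ∫ t in a..b, F ε t := by
    intro ε hε
    have hxlip : LipschitzWith (K + (|ε| * B * ‖e‖).toNNReal) (x ε) := by
      refine LipschitzWith.of_dist_le_mul fun s t => ?_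
      have h1 := hc.dist_le_mul s t
      have h2 := hHlip.dist_le_mul s t
      rw [Real.coe_toNNReal B hB0, Real.dist_eq (H s)] at h2
      rw [NNReal.coe_add, Real.coe_toNNReal _ (by positivity), add_mul]
      refine (dist_add_add_le _ _ _ _).trans (add_le_add h1 ?_)
      rw [dist_eq_norm, ← sub_smul, ← mul_sub, norm_smul, norm_mul, Real.norm_eq_abs,
        Real.norm_eq_abs]
      calc |ε| * |H s - H t| * ‖e‖ ≤ |ε| * (B * dist s t) * ‖e‖ := by gcongr
        _ = _ := by ring
    have hx' : ∀ᵐ t, t ∈ Ioo a b → HasDerivAt (x ε) (W ε t) t := by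
      filter_upwards [hcae, hHae] with t h1 h2 _
      exact h1.add ((h2.const_mul ε).smul_const e)
    -- The energy bounds the length, since `√F ≤ (1 + F) / 2`, with equality at unit speed.
    have h1 := h.le_integral (L := fun t => 1 / 2 * (1 + F ε t)) hab.le
      (hxlip.lipschitzOnWith (s := Icc a b)) (fun t ht => hsub (hmemT ε hε t ht)) hx'
      ((intervalIntegrable_const.add (hF0int ε hε)).const_mul _) (Eventually.of_forall fun t ht => by
        have hnn : 0 ≤ F ε t := by
          by_cases hw : W ε t = 0
          · simp [F, hw]
          · exact (h.pos _ (hsub (hmemT ε hε t (Ioo_subset_Icc_self ht))) _ hw).le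
        change √(F ε t) ≤ 1 / 2 * (1 + F ε t)
        nlinarith [Real.sq_sqrt hnn, sq_nonneg (√(F ε t) - 1)])
    have h2 : δ (x ε a) (x ε b) = b - a := by
      simp only [x, hHa, hHb, mul_zero, zero_smul, add_zero]
      exact hδ a b le_rfl hab.le le_rfl
    rw [h2, intervalIntegral.integral_const_mul, intervalIntegral.integral_add
      intervalIntegrable_const (hF0int ε hε), intervalIntegral.integral_const, smul_eq_mul] at h1
    linarith
  have hup : ∫ t in a..b, F 0 t ≤ b - a := by
    have h1 : ∫ t in a..b, F 0 t ≤ ∫ t in a..b, (1 : ℝ) := by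
      refine intervalIntegral.integral_mono_ae_restrict hab.le (hF0int 0 hε₀0)
        intervalIntegrable_const ?_
      rw [← Measure.restrict_congr_set Ioo_ae_eq_Icc]
      refine (ae_restrict_iff' measurableSet_Ioo).2 ?_
      filter_upwards [hcae] with t ht htm
      have := h.speed_le_one htm (hU t (Ioo_subset_Icc_self htm)) hδ ht
      simpa [F, x, W] using this
    simpa using h1
  have hmin : IsLocalMin (fun ε => ∫ t in a..b, F ε t) 0 := by
    filter_upwards [hnhds] with ε hε using hup.trans (hlow ε (hball ε hε))
  have hzero := hmin.hasDerivAt_eq_zero hderiv.2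
  rw [← hzero]
  refine intervalIntegral.integral_congr fun t _ => ?_
  simp only [F', x, W, zero_mul, zero_smul, add_zero, map_smul, Bil.smul_apply, smul_apply,
    smul_eq_mul, h.symm (c t) e]
  ring

end FirstVariation

/-! ### Unit speed and conservation of momentum -/

section DuBoisReymond

/-- The lemma of du Bois-Reymond: a bounded function that is orthogonal to all bounded functions of
mean zero is almost everywhere constant. -/
theorem exists_ae_eq_const_of_integral_mul_eq_zero {f : ℝ → ℝ} {a b B : ℝ} (hab : a < b)
    (hf : Measurable f) (hB : ∀ t ∈ Icc a b, |f t| ≤ B)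
    (h : ∀ ψ : ℝ → ℝ, Measurable ψ → (∃ B, ∀ t, |ψ t| ≤ B) → ∫ t in a..b, ψ t = 0 →
      ∫ t in a..b, f t * ψ t = 0) : ∃ k, ∀ᵐ t, t ∈ Ioo a b → f t = k := by
  have hfint : IntervalIntegrable f volume a b := by
    refine (intervalIntegrable_const (c := B)).mono_fun' hf.aestronglyMeasurable ?_
    rw [uIoc_of_le hab.le]
    exact (ae_restrict_iff' measurableSet_Ioc).2
      (Eventually.of_forall fun t ht => hB t (Ioc_subset_Icc_self ht))
  set k := (b - a)⁻¹ * ∫ t in a..b, f t with hk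
  set ψ : ℝ → ℝ := (Icc a b).indicator fun t => f t - k with hψ
  have hψeq : ∀ t ∈ uIcc a b, ψ t = f t - k := fun t ht => by
    rw [uIcc_of_le hab.le] at ht
    exact indicator_of_mem ht _
  -- The test function is `f` minus its mean value `k`.
  have hψ0 : ∫ t in a..b, (f t - k) = 0 := by
    rw [intervalIntegral.integral_sub hfint intervalIntegrable_const,
      intervalIntegral.integral_const, smul_eq_mul, hk]
    have := (sub_pos.2 hab).ne'
    field_simp
    ring
  have h1 := h ψ ((hf.sub_const k).indicator measurableSet_Icc) ⟨B + |k|, fun t => by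
    by_cases ht : t ∈ Icc a b
    · rw [hψ, indicator_of_mem ht]
      exact (abs_sub _ _).trans (by gcongr; exact hB t ht)
    · rw [hψ, indicator_of_notMem ht, abs_zero]
      have := (abs_nonneg _).trans (hB a ⟨le_rfl, hab.le⟩)
      positivity⟩ (by rwa [intervalIntegral.integral_congr hψeq])
  have hsq : IntervalIntegrable (fun t => (f t - k) ^ 2) volume a b := by
    refine (intervalIntegrable_const (c := (B + |k|) ^ 2)).mono_fun'
      ((hf.sub_const k).pow_const 2).aestronglyMeasurable ?_
    rw [uIoc_of_le hab.le]
    refine (ae_restrict_iff' measurableSet_Ioc).2 (Eventually.of_forall fun t ht => ?_)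
    have h2 : |f t - k| ≤ B + |k| :=
      (abs_sub _ _).trans (by gcongr; exact hB t (Ioc_subset_Icc_self ht))
    have h3 := pow_le_pow_left₀ (abs_nonneg _) h2 2
    simpa using h3
  have h2 : ∫ t in a..b, (f t - k) ^ 2 = 0 := by
    have h3 : ∫ t in a..b, (f t - k) ^ 2 = ∫ t in a..b, (f t * ψ t - k * (f t - k)) :=
      intervalIntegral.integral_congr fun t ht => by
        simp only [hψeq t ht]
        ring
    have h4 : IntervalIntegrable (fun t => k * (f t - k)) volume a b :=
      (hfint.sub intervalIntegrable_const).const_mul k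
    have h5 : IntervalIntegrable (fun t => f t * ψ t) volume a b := by
      refine IntervalIntegrable.congr (fun t ht => ?_) (hsq.add h4)
      simp only [hψeq t (uIoc_subset_uIcc ht)]
      ring
    rw [h3, intervalIntegral.integral_sub h5 h4, h1, intervalIntegral.integral_const_mul, hψ0]
    ring
  refine ⟨k, ?_⟩
  have h3 := (intervalIntegral.integral_eq_zero_iff_of_le_of_nonneg_ae hab.le
    (Eventually.of_forall fun t => sq_nonneg (f t - k)) hsq).1 h2
  rw [Filter.EventuallyEq, ae_restrict_iff' measurableSet_Ioc] at h3
  filter_upwards [h3] with t ht htm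
  exact sub_eq_zero.1 (pow_eq_zero_iff two_ne_zero |>.1 (ht (Ioo_subset_Ioc_self htm)))

end DuBoisReymond

section Geodesic

variable {E : Type*} [NormedAddCommGroup E] [NormedSpace ℝ E]
  {U : Set E} {A : E → Bil E} {δ : E → E → ℝ}

/-- A differentiable curve parametrized by arc length has speed at least one. -/
theorem IsLocalMetric.one_le_speed (h : IsLocalMetric U A δ) {c : ℝ → E} {a b t : ℝ} {c' : E}
    (ht : t ∈ Ioo a b) (hU : c t ∈ U)
    (hδ : ∀ s t, a ≤ s → s ≤ t → t ≤ b → δ (c s) (c t) = t - s)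
    (hd : HasDerivAt c c' t) : 1 ≤ A (c t) c' c' := by
  have key : ∀ ε > 0, 1 ≤ √(A (c t) c' c') + ε * ‖c'‖ := by
    intro ε hε
    have htend : Tendsto (fun k => (c t, c (t + k))) (𝓝[>] (0 : ℝ)) (𝓝 (c t, c t)) := by
      refine tendsto_const_nhds.prodMk_nhds (Tendsto.mono_left ?_ nhdsWithin_le_nhds)
      have h3 : Tendsto (fun k : ℝ => t + k) (𝓝 0) (𝓝 t) := by
        simpa using (continuous_const.add continuous_id).tendsto (0 : ℝ) (f := fun k : ℝ => t + k)
      exact hd.continuousAt.tendsto.comp h3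
    have hlt : ∀ᶠ k in 𝓝[>] (0 : ℝ), k < b - t :=
      nhdsWithin_le_nhds (Iio_mem_nhds (sub_pos.2 ht.2))
    have hcont : Continuous fun v : E => √(A (c t) v v) + ε * ‖v‖ :=
      (A (c t)).continuous_diag.sqrt.add (continuous_const.mul continuous_norm)
    refine ge_of_tendsto ((hcont.tendsto _).comp hd.tendsto_slope_zero_right) ?_
    filter_upwards [htend.eventually (h.upper (c t) hU ε hε), self_mem_nhdsWithin, hlt]
      with k hk hk0 hkb
    have hk0 : 0 < k := hk0
    rw [hδ t (t + k) ht.1.le (by linarith) (by linarith)] at hk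
    have h5 : A (c t) (k⁻¹ • (c (t + k) - c t)) (k⁻¹ • (c (t + k) - c t)) =
        (k⁻¹ * k⁻¹) * A (c t) (c (t + k) - c t) (c (t + k) - c t) := by
      simp only [map_smul, smul_apply, smul_eq_mul]
      ring
    simp only [Function.comp_apply]
    rw [h5, Real.sqrt_mul (by positivity), Real.sqrt_mul_self (by positivity), norm_smul,
      Real.norm_of_nonneg (inv_nonneg.2 hk0.le)]
    calc (1 : ℝ) = k⁻¹ * (t + k - t) := by field_simp; ring
      _ ≤ k⁻¹ * (√(A (c t) (c (t + k) - c t) (c (t + k) - c t)) + ε * ‖c (t + k) - c t‖) := by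
          gcongr
      _ = _ := by ring
  have h1 : 1 ≤ √(A (c t) c' c') := by
    refine le_of_forall_pos_le_add fun ε hε => ?_
    have h2 := key (ε / (‖c'‖ + 1)) (by positivity)
    refine h2.trans ?_
    gcongr
    rw [div_mul_eq_mul_div, div_le_iff₀ (by positivity)]
    nlinarith [norm_nonneg c']
  exact Real.one_le_sqrt.1 h1

/-- The integrated geodesic equation. -/
theorem IsLocalMetric.exists_ae_momentum_eq [FiniteDimensional ℝ E] (h : IsLocalMetric U A δ)
    {c : ℝ → E} {a b : ℝ} (hab : a < b) {K : NNReal} (hc : LipschitzWith K c) (hU : ∀ t, c t ∈ U)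
    (hδ : ∀ s t, a ≤ s → s ≤ t → t ≤ b → δ (c s) (c t) = t - s) (e : E) :
    IntervalIntegrable (fun t => 1 / 2 * fderiv ℝ A (c t) e (deriv c t) (deriv c t)) volume a b ∧
    ∃ k, ∀ᵐ t, t ∈ Ioo a b → A (c t) (deriv c t) e =
      k + ∫ s in a..t, 1 / 2 * fderiv ℝ A (c s) e (deriv c s) (deriv c s) := by
  let _ : MeasurableSpace E := borel E
  have _ : BorelSpace E := ⟨rfl⟩
  have hcd : ∀ t, ‖deriv c t‖ ≤ K := fun t => norm_deriv_le_of_lipschitz hc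
  have hcdm : StronglyMeasurable (deriv c) := stronglyMeasurable_deriv c
  have hAc : Continuous fun t => A (c t) :=
    h.smooth.continuousOn.comp_continuous hc.continuous hU
  have hA'c : Continuous fun t => fderiv ℝ A (c t) e :=
    ((h.smooth.continuousOn_fderiv_of_isOpen h.isOpen (by simp)).comp_continuous
      hc.continuous hU).clm_apply continuous_const
  set p : ℝ → ℝ := fun t => A (c t) (deriv c t) e with hp
  set q : ℝ → ℝ := fun t => 1 / 2 * fderiv ℝ A (c t) e (deriv c t) (deriv c t) with hq
  have hpm : Measurable p := (Bil.continuous_apply.comp_stronglyMeasurable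
    (hAc.stronglyMeasurable.prodMk (hcdm.prodMk stronglyMeasurable_const))).measurable
  have hqm : Measurable q := ((Bil.continuous_apply.comp_stronglyMeasurable
    (hA'c.stronglyMeasurable.prodMk (hcdm.prodMk hcdm))).measurable).const_mul _
  obtain ⟨M₀, hM₀⟩ := isCompact_Icc.exists_bound_of_continuousOn (hAc.continuousOn (s := Icc a b))
  obtain ⟨M₁, hM₁⟩ := isCompact_Icc.exists_bound_of_continuousOn (hA'c.continuousOn (s := Icc a b))
  have hpb : ∀ t ∈ Icc a b, |p t| ≤ M₀ * K * ‖e‖ := fun t ht =>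
    Bil.abs_le _ (hM₀ t ht) (hcd t) le_rfl
  have hqb : ∀ t ∈ Icc a b, |q t| ≤ 1 / 2 * (M₁ * K * K) := fun t ht => by
    rw [hq, abs_mul, abs_of_pos (by norm_num : (0 : ℝ) < 1 / 2)]
    exact mul_le_mul_of_nonneg_left (Bil.abs_le _ (hM₁ t ht) (hcd t) (hcd t)) (by norm_num)
  -- The integrand is modified outside `[a, b]` so as to be bounded on the line.
  set q₁ : ℝ → ℝ := (Icc a b).indicator q with hq₁
  have hq₁m : Measurable q₁ := hqm.indicator measurableSet_Icc
  have hM : 0 ≤ 1 / 2 * (M₁ * K * K) := (abs_nonneg _).trans (hqb a ⟨le_rfl, hab.le⟩)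
  have hq₁b : ∀ t, |q₁ t| ≤ 1 / 2 * (M₁ * K * K) := fun t => by
    by_cases ht : t ∈ Icc a b
    · rw [hq₁, indicator_of_mem ht]; exact hqb t ht
    · rw [hq₁, indicator_of_notMem ht, abs_zero]; exact hM
  have hbint : ∀ (ψ : ℝ → ℝ) (B : ℝ), Measurable ψ → (∀ t, |ψ t| ≤ B) →
      ∀ s t, IntervalIntegrable ψ volume s t := fun ψ B hm hb s t =>
    (intervalIntegrable_const (c := B)).mono_fun' hm.aestronglyMeasurable
      (Eventually.of_forall fun t => hb t)
  have hprim : ∀ (ψ : ℝ → ℝ) (B : ℝ), Measurable ψ → (∀ t, |ψ t| ≤ B) →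
      LipschitzWith B.toNNReal (fun t => ∫ s in a..t, ψ s) ∧
        ∀ᵐ t, HasDerivAt (fun t => ∫ s in a..t, ψ s) (ψ t) t := by
    intro ψ B hm hb
    have hi := hbint ψ B hm hb
    refine ⟨LipschitzWith.of_dist_le_mul fun s t => ?_, ?_⟩
    · rw [Real.dist_eq, Real.dist_eq, Real.coe_toNNReal B ((abs_nonneg _).trans (hb a)),
        intervalIntegral.integral_interval_sub_left (hi _ _) (hi _ _)]
      exact intervalIntegral.norm_integral_le_of_norm_le_const (f := ψ) fun x _ => hb x
    · have : LocallyIntegrable ψ := fun t => by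
        refine ⟨Ioc (t - 1) (t + 1), Ioc_mem_nhds (by linarith) (by linarith), ?_⟩
        exact (intervalIntegrable_iff_integrableOn_Ioc_of_le (by linarith)).1 (hi _ _)
      filter_upwards [LocallyIntegrable.ae_hasDerivAt_integral this] with t ht using ht a
  set Q : ℝ → ℝ := fun t => ∫ s in a..t, q₁ s with hQ
  obtain ⟨hQlip, hQd⟩ := hprim q₁ _ hq₁m hq₁b
  have hQeq : ∀ t ∈ Icc a b, Q t = ∫ s in a..t, q s := fun t ht =>
    intervalIntegral.integral_congr fun s hs => by
      rw [uIcc_of_le ht.1] at hs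
      exact indicator_of_mem (show s ∈ Icc a b from ⟨hs.1, hs.2.trans ht.2⟩) _
  obtain ⟨MQ, hMQ⟩ := isCompact_Icc.exists_bound_of_continuousOn
    (hQlip.continuous.continuousOn (s := Icc a b))
  have iq : IntervalIntegrable q volume a b := IntervalIntegrable.congr
    (fun t ht => by
      rw [uIoc_of_le hab.le] at ht
      exact indicator_of_mem (Ioc_subset_Icc_self ht) _) (hbint q₁ _ hq₁m hq₁b a b)
  refine ⟨iq, ?_⟩
  -- An integration by parts turns the first variation into an orthogonality relation for the
  -- difference of the momentum `p` and the integrated force `Q`.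
  suffices horth : ∀ ψ : ℝ → ℝ, Measurable ψ → (∃ B, ∀ t, |ψ t| ≤ B) → ∫ t in a..b, ψ t = 0 →
      ∫ t in a..b, (p t - Q t) * ψ t = 0 by
    obtain ⟨k, hk⟩ := exists_ae_eq_const_of_integral_mul_eq_zero (f := fun t => p t - Q t)
      (B := M₀ * K * ‖e‖ + MQ) hab (hpm.sub hQlip.continuous.measurable)
      (fun t ht => (abs_sub _ _).trans (add_le_add (hpb t ht) (hMQ t ht))) horth
    refine ⟨k, ?_⟩
    filter_upwards [hk] with t ht htm
    have h1 := ht htm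
    rw [← hQeq t (Ioo_subset_Icc_self htm)]
    change p t = _
    linarith
  rintro ψ hψm ⟨B, hψb⟩ hψ0
  have hfv := h.first_variation hab hc (fun t _ => hU t) hδ hψm hψb hψ0 e
  obtain ⟨hHlip, hHd⟩ := hprim ψ B hψm hψb
  set H : ℝ → ℝ := fun t => ∫ s in a..t, ψ s with hH
  have hacH := (hHlip.lipschitzOnWith (s := uIcc a b)).absolutelyContinuousOnInterval
  have hacQ := (hQlip.lipschitzOnWith (s := uIcc a b)).absolutelyContinuousOnInterval
  have hparts := hacQ.integral_mul_deriv_eq_deriv_mul hacH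
  have e1 : ∫ t in a..b, Q t * deriv H t = ∫ t in a..b, Q t * ψ t :=
    intervalIntegral.integral_congr_ae (by
      filter_upwards [hHd] with t ht _ using by rw [ht.deriv])
  have e2 : ∫ t in a..b, deriv Q t * H t = ∫ t in a..b, q t * H t :=
    intervalIntegral.integral_congr_ae (by
      filter_upwards [hQd] with t ht htm
      rw [uIoc_of_le hab.le] at htm
      rw [ht.deriv, hq₁, indicator_of_mem (Ioc_subset_Icc_self htm)])
  have hHa : H a = 0 := by simp [hH]
  have hHb : H b = 0 := hψ0
  rw [e1, e2, hHa, hHb, mul_zero, mul_zero, sub_zero, zero_sub] at hparts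
  have i0 : IntervalIntegrable ψ volume a b := hbint ψ B hψm hψb a b
  have i1 : IntervalIntegrable (fun t => p t * ψ t) volume a b := by
    refine (intervalIntegrable_const (c := M₀ * K * ‖e‖ * B)).mono_fun'
      (hpm.mul hψm).aestronglyMeasurable ?_
    rw [uIoc_of_le hab.le]
    refine (ae_restrict_iff' measurableSet_Ioc).2 (Eventually.of_forall fun t ht => ?_)
    change ‖p t * ψ t‖ ≤ _
    rw [Real.norm_eq_abs, abs_mul]
    have h1 := hpb t (Ioc_subset_Icc_self ht)
    exact mul_le_mul h1 (hψb t) (abs_nonneg _) ((abs_nonneg _).trans h1)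
  have i2 : IntervalIntegrable (fun t => Q t * ψ t) volume a b :=
    i0.continuousOn_mul hQlip.continuous.continuousOn
  have i3 : IntervalIntegrable (fun t => q t * H t) volume a b :=
    iq.mul_continuousOn hHlip.continuous.continuousOn
  have h1 : ∫ t in a..b, (2 * (p t * ψ t) + 2 * (q t * H t)) = 0 := by
    rw [← hfv]
    refine intervalIntegral.integral_congr fun t _ => ?_
    simp only [hp, hq, hH]
    ring
  rw [intervalIntegral.integral_add (i1.const_mul 2) (i3.const_mul 2),
    intervalIntegral.integral_const_mul, intervalIntegral.integral_const_mul] at h1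
  simp only [sub_mul]
  rw [intervalIntegral.integral_sub i1 i2]
  linarith

end Geodesic

/-! ### The geodesic equation -/

section Inverse

variable {E : Type*} [NormedAddCommGroup E] [NormedSpace ℝ E] [FiniteDimensional ℝ E]

/-- The vector that represents a linear form with respect to a nondegenerate bilinear form. -/
def Bil.inv (B : Bil E) (l : E →L[ℝ] ℝ) : E :=
  ContinuousLinearMap.inverse (M := E) (M₂ := E →L[ℝ] ℝ) (R := ℝ) B l

theorem Bil.isInvertible (B : Bil E) (hB : ∀ v, v ≠ 0 → 0 < B v v) :
    ContinuousLinearMap.IsInvertible (M := E) (M₂ := E →L[ℝ] ℝ) (R := ℝ) B := by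
  let B' : E →L[ℝ] E →L[ℝ] ℝ := B
  let L : E →ₗ[ℝ] (E →L[ℝ] ℝ) := B'
  have hinj : Function.Injective L := by
    refine (injective_iff_map_eq_zero L).2 fun v hv => ?_
    by_contra hv0
    have h1 : B v v = 0 := congrArg (fun l : E →L[ℝ] ℝ => l v) hv
    exact (hB v hv0).ne' h1
  have hdim : Module.finrank ℝ E = Module.finrank ℝ (E →L[ℝ] ℝ) := by
    rw [← (LinearMap.toContinuousLinearMap (𝕜 := ℝ) (E := E) (F' := ℝ)).finrank_eq]
    exact (Subspace.dual_finrank_eq (K := ℝ) (V := E)).symm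
  exact ⟨(L.linearEquivOfInjective hinj hdim).toContinuousLinearEquiv, rfl⟩

theorem Bil.inv_eq_iff (B : Bil E) (hB : ∀ v, v ≠ 0 → 0 < B v v) {l : E →L[ℝ] ℝ} {v : E} :
    B.inv l = v ↔ B v = l :=
  (B.isInvertible hB).inverse_apply_eq.trans eq_comm

theorem Bil.apply_inv (B : Bil E) (hB : ∀ v, v ≠ 0 → 0 < B v v) (l : E →L[ℝ] ℝ) :
    B (B.inv l) = l := (B.inv_eq_iff hB).1 rfl

set_option synthInstance.maxHeartbeats 200000 in
theorem Bil.contDiffAt_inv {n : WithTop ℕ∞} (B : Bil E) (hB : ∀ v, v ≠ 0 → 0 < B v v)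
    (l : E →L[ℝ] ℝ) :
    ContDiffAt ℝ n (fun p : Bil E × (E →L[ℝ] ℝ) => p.1.inv p.2) (B, l) := by
  have h1 := (B.isInvertible hB).contDiffAt_map_inverse (n := n)
  have h2 : ContDiffAt ℝ n (fun p : Bil E × (E →L[ℝ] ℝ) =>
      ContinuousLinearMap.inverse (M := E) (M₂ := E →L[ℝ] ℝ) (R := ℝ) p.1) (B, l) :=
    ContDiffAt.comp (E := Bil E × (E →L[ℝ] ℝ)) (F := E →L[ℝ] E →L[ℝ] ℝ) (B, l) h1 contDiffAt_fst
  exact h2.clm_apply contDiffAt_snd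

end Inverse

section Geodesic

variable {E : Type*} [NormedAddCommGroup E] [NormedSpace ℝ E] [FiniteDimensional ℝ E]
  {U : Set E} {A : E → Bil E} {δ : E → E → ℝ}

theorem hasDerivAt_integral_of_continuousOn {F : Type*} [NormedAddCommGroup F] [NormedSpace ℝ F]
    [CompleteSpace F] {f : ℝ → F} {a b t : ℝ} (hf : ContinuousOn f (Icc a b)) (ht : t ∈ Ioo a b) :
    HasDerivAt (fun t => ∫ s in a..t, f s) (f t) t := by
  refine intervalIntegral.integral_hasDerivAt_right
    (ContinuousOn.intervalIntegrable ?_) ?_ (hf.continuousAt (Icc_mem_nhds ht.1 ht.2))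
  · rw [uIcc_of_le ht.1.le]
    exact hf.mono (Icc_subset_Icc_right ht.2.le)
  · exact (hf.mono Ioo_subset_Icc_self).stronglyMeasurableAtFilter isOpen_Ioo t ht

/-- A minimizing Lipschitz curve is continuously differentiable and satisfies the geodesic
equation in weak form. -/
theorem IsLocalMetric.exists_velocity (h : IsLocalMetric U A δ)
    {c : ℝ → E} {a b : ℝ} (hab : a < b) {K : NNReal} (hc : LipschitzWith K c) (hU : ∀ t, c t ∈ U)
    (hδ : ∀ s t, a ≤ s → s ≤ t → t ≤ b → δ (c s) (c t) = t - s) :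
    ∃ v : ℝ → E, ContDiffOn ℝ 1 v (Ioo a b) ∧ ∀ t ∈ Ioo a b, HasDerivAt c (v t) t ∧
      ∀ e, HasDerivAt (fun t => A (c t) (v t) e)
        (1 / 2 * fderiv ℝ A (c t) e (v t) (v t)) t := by
  have hfin := fun e => h.exists_ae_momentum_eq hab hc hU hδ e
  choose hqi k hk using hfin
  set q : E → ℝ → ℝ := fun e t => 1 / 2 * fderiv ℝ A (c t) e (deriv c t) (deriv c t) with hq
  have hAc : Continuous fun t => A (c t) :=
    h.smooth.continuousOn.comp_continuous hc.continuous hU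
  have hA'c : ∀ e, Continuous fun t => fderiv ℝ A (c t) e := fun e =>
    ((h.smooth.continuousOn_fderiv_of_isOpen h.isOpen (by simp)).comp_continuous
      hc.continuous hU).clm_apply continuous_const
  have hpos := fun t => h.pos (c t) (hU t)
  let bs := Module.finBasis ℝ E
  let l : Fin (Module.finrank ℝ E) → E →L[ℝ] ℝ := fun i =>
    LinearMap.toContinuousLinearMap (bs.coord i)
  have hlb : ∀ e, e = ∑ i, l i e • bs i := fun e => (bs.sum_repr e).symm
  -- the momentum
  let P : ℝ → E →L[ℝ] ℝ := fun t => ∑ i, (k (bs i) + ∫ s in a..t, q (bs i) s) • l i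
  have hPc : ContinuousOn P (Icc a b) := by
    refine continuousOn_finsetSum _ fun i _ => ?_
    have h1 := intervalIntegral.continuousOn_primitive_interval' (hqi (bs i)) left_mem_uIcc
    rw [uIcc_of_le hab.le] at h1
    exact (continuousOn_const.add h1).smul continuousOn_const
  -- The momentum is continuous, hence so is the velocity obtained from it by inverting the metric;
  -- the curve is then `C¹`, the momentum `C¹`, and finally the velocity `C¹`.
  let v : ℝ → E := fun t => (A (c t)).inv (P t)
  have hAv : ∀ t, A (c t) (v t) = P t := fun t => (A (c t)).apply_inv (hpos t) _
  have hvc : ContinuousOn v (Icc a b) := fun t ht =>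
    ((A (c t)).contDiffAt_inv (n := 0) (hpos t) (P t)).continuousAt.comp_continuousWithinAt
      (f := fun t => (A (c t), P t)) (hAc.continuousAt.continuousWithinAt.prodMk (hPc t ht))
  have hvae : ∀ᵐ t, t ∈ Ioo a b → deriv c t = v t := by
    have h1 : ∀ᵐ t, ∀ i, t ∈ Ioo a b → A (c t) (deriv c t) (bs i) =
      k (bs i) + ∫ s in a..t, q (bs i) s := ae_all_iff.2 fun i => hk (bs i)
    filter_upwards [h1] with t ht htm
    refine ((Bil.inv_eq_iff _ (hpos t)).2 ?_).symm
    refine ContinuousLinearMap.ext fun e => ?_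
    conv_lhs => rw [hlb e]
    simp only [map_sum, map_smul, P, sum_apply, smul_apply, smul_eq_mul]
    exact Finset.sum_congr rfl fun i _ => by rw [ht i htm, mul_comm]
  have hvi : IntervalIntegrable v volume a b :=
    ContinuousOn.intervalIntegrable (by rwa [uIcc_of_le hab.le])
  have hcv : ∀ t ∈ Icc a b, c t = c a + ∫ s in a..t, v s := by
    obtain ⟨M, hM⟩ := isCompact_Icc.exists_bound_of_continuousOn hvc
    have hM0 : 0 ≤ M := (norm_nonneg _).trans (hM a ⟨le_rfl, hab.le⟩)
    have hvlip : LipschitzOnWith M.toNNReal (fun t => ∫ s in a..t, v s) (uIcc a b) := by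
      rw [uIcc_of_le hab.le]
      refine LipschitzOnWith.of_dist_le_mul fun s hs t ht => ?_
      have hi : ∀ r ∈ Icc a b, IntervalIntegrable v volume a r := fun r hr =>
        hvi.mono_set (by
          rw [uIcc_of_le hab.le, uIcc_of_le hr.1]; exact Icc_subset_Icc_right hr.2)
      rw [dist_eq_norm, Real.coe_toNNReal M hM0,
        intervalIntegral.integral_interval_sub_left (hi s hs) (hi t ht), Real.dist_eq]
      refine intervalIntegral.norm_integral_le_of_norm_le_const fun x hx => hM x ?_
      exact uIcc_subset_Icc ht hs (uIoc_subset_uIcc hx)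
    have hac := (hc.lipschitzOnWith (s := uIcc a b)).absolutelyContinuousOnInterval.sub
      hvlip.absolutelyContinuousOnInterval
    obtain ⟨C, hC⟩ := hac.const_of_ae_hasDerivAt_zero (by
      have hne : ∀ r : ℝ, ∀ᵐ t, t ≠ r := fun r => by simp [ae_iff]
      filter_upwards [hc.ae_differentiableAt, hvae, hne a, hne b] with t h1 h2 h3 h4 h5
      rw [uIcc_of_le hab.le] at h5
      have htm : t ∈ Ioo a b := ⟨lt_of_le_of_ne h5.1 (Ne.symm h3), lt_of_le_of_ne h5.2 h4⟩
      have h6 := h1.hasDerivAt.sub (hasDerivAt_integral_of_continuousOn hvc htm)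
      rwa [h2 htm, sub_self] at h6)
    intro t ht
    rw [uIcc_of_le hab.le] at hC
    have h1 := hC t ht
    have h2 := hC a ⟨le_rfl, hab.le⟩
    simp only [Pi.sub_apply, intervalIntegral.integral_same, sub_zero] at h1 h2
    rw [h2, ← h1]
    abel
  have hcd : ∀ t ∈ Ioo a b, HasDerivAt c (v t) t := fun t ht => by
    refine ((hasDerivAt_integral_of_continuousOn hvc ht).const_add (c a)).congr_of_eventuallyEq ?_
    filter_upwards [Ioo_mem_nhds ht.1 ht.2] with s hs using hcv s (Ioo_subset_Icc_self hs)
  -- the force, as a continuous function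
  let r : E → ℝ → ℝ := fun e t => 1 / 2 * fderiv ℝ A (c t) e (v t) (v t)
  have hrc : ∀ e, ContinuousOn (r e) (Icc a b) := fun e =>
    continuousOn_const.mul (Bil.continuous_apply.comp_continuousOn
      ((hA'c e).continuousOn.prodMk (hvc.prodMk hvc)))
  have hPd : ∀ i, ∀ t ∈ Ioo a b, HasDerivAt (fun t => ∫ s in a..t, q (bs i) s) (r (bs i) t) t := by
    intro i t ht
    refine (hasDerivAt_integral_of_continuousOn (hrc (bs i)) ht).congr_of_eventuallyEq ?_
    filter_upwards [Ioo_mem_nhds ht.1 ht.2] with s hs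
    refine intervalIntegral.integral_congr_ae (Eventually.of_forall fun u hum => ?_)
    rw [uIoc_of_le hs.1.le] at hum
    have hu' : u ∈ Ioo a b := ⟨hum.1, hum.2.trans_lt hs.2⟩
    simp only [hq, r]
    rw [(hcd u hu').deriv]
  have hcC : ContDiffOn ℝ 1 c (Ioo a b) := by
    have h1 : EqOn (deriv c) v (Ioo a b) := fun t ht => (hcd t ht).deriv
    refine (contDiffOn_one_iff_derivWithin isOpen_Ioo.uniqueDiffOn).2
      ⟨fun t ht => (hcd t ht).differentiableAt.differentiableWithinAt, ?_⟩
    refine (hvc.mono Ioo_subset_Icc_self).congr fun t ht => ?_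
    rw [derivWithin_of_isOpen isOpen_Ioo ht, h1 ht]
  have hPC : ContDiffOn ℝ 1 P (Ioo a b) := by
    refine ContDiffOn.sum fun i _ => ?_
    suffices h1 : ContDiffOn ℝ 1 (fun t => ∫ s in a..t, q (bs i) s) (Ioo a b) from
      (contDiffOn_const.add h1).smul contDiffOn_const
    refine (contDiffOn_one_iff_derivWithin isOpen_Ioo.uniqueDiffOn).2
      ⟨fun t ht => (hPd i t ht).differentiableAt.differentiableWithinAt, ?_⟩
    refine ((hrc (bs i)).mono Ioo_subset_Icc_self).congr fun t ht => ?_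
    rw [derivWithin_of_isOpen isOpen_Ioo ht, (hPd i t ht).deriv]
  refine ⟨v, fun t ht => ContDiffAt.contDiffWithinAt ?_, fun t ht => ⟨hcd t ht, fun e => ?_⟩⟩
  · have h1 : ContDiffAt ℝ 1 (fun t => A (c t)) t :=
      ((h.smooth.contDiffAt (h.isOpen.mem_nhds (hU t))).of_le (by simp)).comp t
        (hcC.contDiffAt (Ioo_mem_nhds ht.1 ht.2))
    exact ((A (c t)).contDiffAt_inv (hpos t) (P t)).comp t
      (h1.prodMk (hPC.contDiffAt (Ioo_mem_nhds ht.1 ht.2)))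
  · have h1 : (fun t => A (c t) (v t) e) = fun t =>
        ∑ i, (k (bs i) + ∫ s in a..t, q (bs i) s) * l i e := by
      funext t
      rw [hAv]
      simp only [P, sum_apply, smul_apply, smul_eq_mul]
    have h2 : 1 / 2 * fderiv ℝ A (c t) e (v t) (v t) = ∑ i, r (bs i) t * l i e := by
      conv_lhs => rw [hlb e]
      have h3 : ∀ (s : Finset (Fin (Module.finrank ℝ E))) (f : Fin (Module.finrank ℝ E) → Bil E),
          (∑ i ∈ s, f i) (v t) (v t) = ∑ i ∈ s, f i (v t) (v t) := fun s f => by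
        induction s using Finset.cons_induction with
        | empty => rfl
        | cons i s hi ih => rw [Finset.sum_cons, Finset.sum_cons, ← ih]; rfl
      rw [map_sum, h3, Finset.mul_sum]
      refine Finset.sum_congr rfl fun i _ => ?_
      rw [map_smul, Bil.smul_apply, smul_apply, smul_eq_mul]
      ring
    rw [h1, h2]
    exact HasDerivAt.fun_sum fun i _ => ((hPd i t ht).const_add _).mul_const _

/-- A curve parametrized by arc length for a local metric is a `C²` geodesic of unit speed. -/
theorem IsLocalMetric.geodesic (h : IsLocalMetric U A δ) {c : ℝ → E} {a b : ℝ}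
    (hc : ContinuousOn c (Ioo a b)) (hU : ∀ t ∈ Ioo a b, c t ∈ U)
    (hδ : ∀ s t, a < s → s ≤ t → t < b → δ (c s) (c t) = t - s) :
    ContDiffOn ℝ 2 c (Ioo a b) ∧ ∀ t ∈ Ioo a b, A (c t) (deriv c t) (deriv c t) = 1 ∧
      ∀ e, A (c t) (deriv (deriv c) t) e + fderiv ℝ A (c t) (deriv c t) (deriv c t) e =
        1 / 2 * fderiv ℝ A (c t) e (deriv c t) (deriv c t) := by
  have key : ∀ t₀ ∈ Ioo a b, ContDiffAt ℝ 2 c t₀ ∧ A (c t₀) (deriv c t₀) (deriv c t₀) = 1 ∧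
      ∀ e, A (c t₀) (deriv (deriv c) t₀) e + fderiv ℝ A (c t₀) (deriv c t₀) (deriv c t₀) e =
        1 / 2 * fderiv ℝ A (c t₀) e (deriv c t₀) (deriv c t₀) := by
    intro t₀ ht₀
    have hct₀ : ContinuousAt c t₀ := hc.continuousAt (Ioo_mem_nhds ht₀.1 ht₀.2)
    obtain ⟨K, hK, hev⟩ := h.eventually_norm_le (hU t₀ ht₀)
    rw [nhds_prod_eq] at hev
    obtain ⟨W, hW, hWK⟩ := (Filter.eventually_prod_self_iff
      (r := fun x y => ‖y - x‖ ≤ K * δ x y)).1 hev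
    obtain ⟨r, hr, hball⟩ := Metric.mem_nhds_iff.1
      (inter_mem (hct₀.preimage_mem_nhds hW) (Ioo_mem_nhds ht₀.1 ht₀.2))
    set a₁ := t₀ - r / 2 with ha₁
    set b₁ := t₀ + r / 2 with hb₁
    have hab₁ : a₁ < b₁ := by linarith
    have hsub : ∀ t ∈ Icc a₁ b₁, c t ∈ W ∧ t ∈ Ioo a b := fun t ht => hball (by
      rw [Metric.mem_ball, Real.dist_eq, abs_lt]; constructor <;> linarith [ht.1, ht.2])
    have hlip : LipschitzOnWith K.toNNReal c (Icc a₁ b₁) := by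
      have h0 : ∀ s ∈ Icc a₁ b₁, ∀ t ∈ Icc a₁ b₁, s ≤ t → dist (c s) (c t) ≤ K * dist s t := by
        intro s hs t ht hst
        rw [dist_comm, dist_eq_norm, dist_comm s, Real.dist_eq, abs_of_nonneg (sub_nonneg.2 hst),
          ← hδ s t (hsub s hs).2.1 hst (hsub t ht).2.2]
        exact hWK _ (hsub s hs).1 _ (hsub t ht).1
      refine LipschitzOnWith.of_dist_le_mul fun s hs t ht => ?_
      rw [Real.coe_toNNReal K hK]
      rcases le_total s t with hst | hst
      · exact h0 s hs t ht hst
      · rw [dist_comm (c s), dist_comm s]; exact h0 t ht s hs hst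
    -- the curve is frozen outside a small interval
    set d : ℝ → E := fun t => c (projIcc a₁ b₁ hab₁.le t) with hd
    have hdc : ∀ t ∈ Icc a₁ b₁, d t = c t := fun t ht => by
      simp only [hd, projIcc_of_mem hab₁.le ht]
    have hdlip : LipschitzWith K.toNNReal d := by
      have h1 := (hlip.to_restrict).comp (LipschitzWith.projIcc hab₁.le)
      rwa [mul_one] at h1
    obtain ⟨v, hvC, hv⟩ := h.exists_velocity hab₁ hdlip
      (fun t => hU _ (hsub _ (projIcc a₁ b₁ hab₁.le t).2).2) (fun s t hs hst ht => by
        rw [hdc s ⟨hs, hst.trans ht⟩, hdc t ⟨hs.trans hst, ht⟩]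
        exact hδ s t (hsub s ⟨hs, hst.trans ht⟩).2.1 hst (hsub t ⟨hs.trans hst, ht⟩).2.2)
    have hmem : t₀ ∈ Ioo a₁ b₁ := ⟨by linarith, by linarith⟩
    have hcv : ∀ t ∈ Ioo a₁ b₁, HasDerivAt c (v t) t := fun t ht =>
      (hv t ht).1.congr_of_eventuallyEq (by
        filter_upwards [Ioo_mem_nhds ht.1 ht.2] with s hs
          using (hdc s (Ioo_subset_Icc_self hs)).symm)
    have hdcv : deriv c =ᶠ[𝓝 t₀] v := by
      filter_upwards [Ioo_mem_nhds hmem.1 hmem.2] with s hs using (hcv s hs).deriv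
    have hvat : ContDiffAt ℝ 1 v t₀ := hvC.contDiffAt (Ioo_mem_nhds hmem.1 hmem.2)
    have hC2 : ContDiffOn ℝ 2 c (Ioo a₁ b₁) := by
      refine (contDiffOn_succ_iff_deriv_of_isOpen (n := 1) isOpen_Ioo).2
        ⟨fun t ht => (hcv t ht).differentiableAt.differentiableWithinAt, by simp, ?_⟩
      exact hvC.congr fun t ht => (hcv t ht).deriv
    have hc1 := hcv t₀ hmem
    have hU0 := hU t₀ ht₀
    have hvd : HasDerivAt v (deriv (deriv c) t₀) t₀ := by
      rw [hdcv.deriv_eq]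
      exact (hvat.differentiableAt (by simp)).hasDerivAt
    refine ⟨hC2.contDiffAt (Ioo_mem_nhds hmem.1 hmem.2), ?_, fun e => ?_⟩
    · rw [hc1.deriv]
      have hδ' : ∀ s t, a₁ ≤ s → s ≤ t → t ≤ b₁ → δ (c s) (c t) = t - s := fun s t hs hst ht =>
        hδ s t (hsub s ⟨hs, hst.trans ht⟩).2.1 hst (hsub t ⟨hs.trans hst, ht⟩).2.2
      exact le_antisymm (h.speed_le_one hmem hU0 hδ' hc1) (h.one_le_speed hmem hU0 hδ' hc1)
    · have hAd : DifferentiableAt ℝ A (c t₀) :=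
        (h.smooth.contDiffAt (h.isOpen.mem_nhds hU0)).differentiableAt (by simp)
      have h1 := hasDerivAt_bil_comp hAd hc1 hvd (hasDerivAt_const t₀ e)
      have h2 := (hv t₀ hmem).2 e
      have h3 := h1.unique (h2.congr_of_eventuallyEq (by
        filter_upwards [Ioo_mem_nhds hmem.1 hmem.2] with s hs
        rw [hdc s (Ioo_subset_Icc_self hs)]))
      rw [hdc t₀ (Ioo_subset_Icc_self hmem)] at h3
      rw [hc1.deriv, ← h3, map_zero, add_zero, add_comm]
  exact ⟨fun t ht => (key t ht).1.contDiffWithinAt, fun t ht => (key t ht).2⟩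

end Geodesic

/-! ### Taylor expansion of the length -/

/-- A second order Taylor bound. -/
theorem le_taylor_two {f f' f'' : ℝ → ℝ} {r M : ℝ} (hf : ∀ x ∈ Icc 0 r, HasDerivAt f (f' x) x)
    (hf' : ∀ x ∈ Icc 0 r, HasDerivAt f' (f'' x) x) (hM : ∀ x ∈ Icc 0 r, f'' x ≤ M) :
    ∀ x ∈ Icc 0 r, f x ≤ f 0 + f' 0 * x + M / 2 * x ^ 2 := by
  have h1 : ∀ x ∈ Icc 0 r, f' x ≤ f' 0 + M * x := by
    intro x hx
    have hmono : MonotoneOn (fun x => M * x - f' x) (Icc 0 r) :=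
      monotoneOn_of_hasDerivWithinAt_nonneg (f' := fun x => M * 1 - f'' x) (convex_Icc _ _)
        (fun y hy => (((hasDerivAt_id y).const_mul M).sub (hf' y hy)).continuousAt.continuousWithinAt)
        (fun y hy => (((hasDerivAt_id y).const_mul M).sub
          (hf' y (interior_subset hy))).hasDerivWithinAt)
        (fun y hy => by linarith [hM y (interior_subset hy)])
    have := hmono ⟨le_rfl, hx.1.trans hx.2⟩ hx hx.1
    simp only [mul_zero, zero_sub] at this
    linarith
  intro x hx
  have hd : ∀ y ∈ Icc 0 r, HasDerivAt (fun x => f' 0 * x + M / 2 * x ^ 2 - f x)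
      (f' 0 * 1 + M / 2 * (2 * y) - f' y) y := fun y hy => by
    have h2 : HasDerivAt (fun x : ℝ => x ^ 2) (2 * y) y := by simpa using hasDerivAt_pow 2 y
    exact (((hasDerivAt_id y).const_mul (f' 0)).add (h2.const_mul (M / 2))).sub (hf y hy)
  have hmono : MonotoneOn (fun x => f' 0 * x + M / 2 * x ^ 2 - f x) (Icc 0 r) :=
    monotoneOn_of_hasDerivWithinAt_nonneg (convex_Icc _ _)
      (fun y hy => (hd y hy).continuousAt.continuousWithinAt)
      (fun y hy => (hd y (interior_subset hy)).hasDerivWithinAt)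
      (fun y hy => by linarith [h1 y (interior_subset hy)])
  have := hmono ⟨le_rfl, hx.1.trans hx.2⟩ hx hx.1
  simp only [mul_zero] at this
  linarith

section SecondVariation

variable {E : Type*} [NormedAddCommGroup E] [NormedSpace ℝ E]
  {U : Set E} {A : E → Bil E} {δ : E → E → ℝ}

theorem IsLocalMetric.contDiffAt (h : IsLocalMetric U A δ) {y : E} (hy : y ∈ U) :
    ContDiffAt ℝ ∞ A y :=
  h.smooth.contDiffAt (h.isOpen.mem_nhds hy)

theorem IsLocalMetric.contDiffAt_fderiv (h : IsLocalMetric U A δ) {y : E} (hy : y ∈ U) :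
    ContDiffAt ℝ ∞ (fderiv ℝ A) y :=
  (h.contDiffAt hy).fderiv_right (m := ∞) (by simp)

theorem IsLocalMetric.fderiv_symm (h : IsLocalMetric U A δ) {y : E} (hy : y ∈ U) (u a b : E) :
    fderiv ℝ A y u a b = fderiv ℝ A y u b a := by
  have hx : HasDerivAt (fun r : ℝ => y + r • u) u 0 := by
    simpa using ((hasDerivAt_id (0 : ℝ)).smul_const u).const_add y
  have hd : DifferentiableAt ℝ A (y + (0 : ℝ) • u) := by
    rw [zero_smul, add_zero]; exact (h.contDiffAt hy).differentiableAt (by simp)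
  have h1 := hasDerivAt_bil_comp (x := fun r : ℝ => y + r • u) hd hx (hasDerivAt_const 0 a)
    (hasDerivAt_const 0 b)
  have h2 := hasDerivAt_bil_comp (x := fun r : ℝ => y + r • u) hd hx (hasDerivAt_const 0 b)
    (hasDerivAt_const 0 a)
  have h3 := h1.unique (h2.congr_of_eventuallyEq (Eventually.of_forall fun r => h.symm _ _ _))
  simpa using h3

set_option maxHeartbeats 800000 in
/-- An upper bound, up to `o(ε²)`, for the length of the curves `c + ε ξ + ½ ε² w` around a curve `c`
of unit speed for which the first order term vanishes pointwise. -/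
theorem IsLocalMetric.length_expansion (h : IsLocalMetric U A δ)
    {c ξ w v ξ' w' : ℝ → E} {α β s t : ℝ} (hs : α < s) (hst : s ≤ t) (ht : t < β)
    (hU : ∀ τ ∈ Ioo α β, c τ ∈ U)
    (hc : ∀ τ ∈ Ioo α β, HasDerivAt c (v τ) τ) (hξ : ∀ τ ∈ Ioo α β, HasDerivAt ξ (ξ' τ) τ)
    (hw : ∀ τ ∈ Ioo α β, HasDerivAt w (w' τ) τ) (hv : ContinuousOn v (Ioo α β))
    (hξ' : ContinuousOn ξ' (Ioo α β)) (hw' : ContinuousOn w' (Ioo α β))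
    (hunit : ∀ τ ∈ Ioo α β, A (c τ) (v τ) (v τ) = 1)
    (hfirst : ∀ τ ∈ Ioo α β, fderiv ℝ A (c τ) (ξ τ) (v τ) (v τ) + 2 * A (c τ) (ξ' τ) (v τ) = 0)
    {Q : ℝ → ℝ} (hQ : ∀ τ ∈ Ioo α β, Q τ =
      fderiv ℝ (fderiv ℝ A) (c τ) (ξ τ) (ξ τ) (v τ) (v τ) + fderiv ℝ A (c τ) (w τ) (v τ) (v τ)
        + 4 * fderiv ℝ A (c τ) (ξ τ) (ξ' τ) (v τ) + 2 * A (c τ) (w' τ) (v τ)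
        + 2 * A (c τ) (ξ' τ) (ξ' τ)) {κ : ℝ} (hκ : 0 < κ) :
    ∀ᶠ ε in 𝓝[>] (0 : ℝ), δ (c s + ε • ξ s + (ε ^ 2 / 2) • w s)
        (c t + ε • ξ t + (ε ^ 2 / 2) • w t) ≤
      (t - s) + ε ^ 2 / 4 * (∫ τ in s..t, Q τ) + κ * ε ^ 2 := by
  have hsub : Icc s t ⊆ Ioo α β := fun τ hτ => ⟨hs.trans_le hτ.1, hτ.2.trans_lt ht⟩
  -- `V` is the variation, `W` its velocity, `X` and `Y` are their derivatives in `ε`, and `Φ` is the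
  -- second derivative of the energy density `A V W W` in `ε`.
  let V : ℝ → ℝ → E := fun ε τ => c τ + ε • ξ τ + (ε ^ 2 / 2) • w τ
  let W : ℝ → ℝ → E := fun ε τ => v τ + ε • ξ' τ + (ε ^ 2 / 2) • w' τ
  let X : ℝ → ℝ → E := fun ε τ => ξ τ + ε • w τ
  let Y : ℝ → ℝ → E := fun ε τ => ξ' τ + ε • w' τ
  let Φ : ℝ → ℝ → ℝ := fun ε τ =>
    fderiv ℝ (fderiv ℝ A) (V ε τ) (X ε τ) (X ε τ) (W ε τ) (W ε τ)
      + fderiv ℝ A (V ε τ) (w τ) (W ε τ) (W ε τ) + 4 * fderiv ℝ A (V ε τ) (X ε τ) (Y ε τ) (W ε τ)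
      + 2 * A (V ε τ) (w' τ) (W ε τ) + 2 * A (V ε τ) (Y ε τ) (Y ε τ)
  have hΦ0 : ∀ τ ∈ Ioo α β, Φ 0 τ = Q τ := fun τ hτ => by
    simp [Φ, V, W, X, Y, hQ τ hτ]
  have hA1 : ∀ y ∈ U, ContDiffAt ℝ ∞ A y := fun y hy => h.contDiffAt hy
  have hA2 : ∀ y ∈ U, ContDiffAt ℝ ∞ (fderiv ℝ A) y := fun y hy =>
    h.contDiffAt_fderiv hy
  have hA3 : ∀ y ∈ U, ContDiffAt ℝ ∞ (fderiv ℝ (fderiv ℝ A)) y := fun y hy =>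
    (hA2 y hy).fderiv_right (m := ∞) (by simp)
  have hcc : ContinuousOn c (Ioo α β) := fun τ hτ => (hc τ hτ).continuousAt.continuousWithinAt
  have hξc : ContinuousOn ξ (Ioo α β) := fun τ hτ => (hξ τ hτ).continuousAt.continuousWithinAt
  have hwc : ContinuousOn w (Ioo α β) := fun τ hτ => (hw τ hτ).continuousAt.continuousWithinAt
  have hat : ∀ {f : ℝ → E} {τ : ℝ}, ContinuousOn f (Ioo α β) → τ ∈ Ioo α β →
      ContinuousAt (fun p : ℝ × ℝ => f p.2) (0, τ) := fun hf hτ =>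
    ContinuousAt.comp (f := Prod.snd) (hf.continuousAt (Ioo_mem_nhds hτ.1 hτ.2)) continuousAt_snd
  have hVc : ∀ τ ∈ Ioo α β, ContinuousAt (fun p : ℝ × ℝ => V p.1 p.2) (0, τ) := fun τ hτ =>
    ((hat hcc hτ).add (continuousAt_fst.smul (hat hξc hτ))).add
      (((continuousAt_fst.pow 2).div_const 2).smul (hat hwc hτ))
  have hWc : ∀ τ ∈ Ioo α β, ContinuousAt (fun p : ℝ × ℝ => W p.1 p.2) (0, τ) := fun τ hτ =>
    ((hat hv hτ).add (continuousAt_fst.smul (hat hξ' hτ))).add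
      (((continuousAt_fst.pow 2).div_const 2).smul (hat hw' hτ))
  have hXc : ∀ τ ∈ Ioo α β, ContinuousAt (fun p : ℝ × ℝ => X p.1 p.2) (0, τ) := fun τ hτ =>
    (hat hξc hτ).add (continuousAt_fst.smul (hat hwc hτ))
  have hYc : ∀ τ ∈ Ioo α β, ContinuousAt (fun p : ℝ × ℝ => Y p.1 p.2) (0, τ) := fun τ hτ =>
    (hat hξ' hτ).add (continuousAt_fst.smul (hat hw' hτ))
  have hV0 : ∀ τ, V 0 τ = c τ := fun τ => by simp [V]
  have hΦc : ∀ τ ∈ Ioo α β, ContinuousAt (fun p : ℝ × ℝ => Φ p.1 p.2) (0, τ) := by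
    intro τ hτ
    have hUτ : V 0 τ ∈ U := by rw [hV0]; exact hU τ hτ
    have c1 : ContinuousAt (fun p : ℝ × ℝ => A (V p.1 p.2)) (0, τ) :=
      ContinuousAt.comp (f := fun p : ℝ × ℝ => V p.1 p.2) (hA1 _ hUτ).continuousAt (hVc τ hτ)
    have c2 : ContinuousAt (fun p : ℝ × ℝ => fderiv ℝ A (V p.1 p.2)) (0, τ) :=
      ContinuousAt.comp (f := fun p : ℝ × ℝ => V p.1 p.2) (hA2 _ hUτ).continuousAt (hVc τ hτ)
    have c3 : ContinuousAt (fun p : ℝ × ℝ => fderiv ℝ (fderiv ℝ A) (V p.1 p.2)) (0, τ) :=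
      ContinuousAt.comp (f := fun p : ℝ × ℝ => V p.1 p.2) (hA3 _ hUτ).continuousAt (hVc τ hτ)
    have hb : ∀ {B : ℝ × ℝ → Bil E} {x y : ℝ × ℝ → E}, ContinuousAt B (0, τ) →
        ContinuousAt x (0, τ) → ContinuousAt y (0, τ) →
        ContinuousAt (fun p => B p (x p) (y p)) (0, τ) := fun h1 h2 h3 =>
      (Bil.continuous_apply.tendsto _).comp (h1.prodMk (h2.prodMk h3))
    have hX := hXc τ hτ
    have hY := hYc τ hτ
    have hW := hWc τ hτ
    exact ((((hb ((c3.clm_apply hX).clm_apply hX) hW hW).add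
      (hb (c2.clm_apply (hat hwc hτ)) hW hW)).add
      (continuousAt_const.mul (hb (c2.clm_apply hX) hY hW))).add
      (continuousAt_const.mul (hb c1 (hat hw' hτ) hW))).add
      (continuousAt_const.mul (hb c1 hY hY))
  -- near `ε = 0` the curves stay in `U` and the second derivative of the energy is controlled
  set κ' := κ / (t - s + 1) with hκ'
  have hκ'pos : 0 < κ' := div_pos hκ (by linarith)
  have hloc : ∀ τ ∈ Icc s t, ∀ᶠ p : ℝ × ℝ in 𝓝 ((0 : ℝ), τ),
      V p.1 p.2 ∈ U ∧ Φ p.1 p.2 < Φ 0 p.2 + κ' := by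
    intro τ hτ
    have hτ' := hsub hτ
    have h1 : ∀ᶠ p : ℝ × ℝ in 𝓝 ((0 : ℝ), τ), V p.1 p.2 ∈ U :=
      (hVc τ hτ').preimage_mem_nhds (h.isOpen.mem_nhds (by
        change V 0 τ ∈ U; rw [hV0]; exact hU τ hτ'))
    have h2 : ContinuousAt (fun p : ℝ × ℝ => Φ 0 p.2) (0, τ) := by
      have h3 : ContinuousAt (fun p : ℝ × ℝ => ((0 : ℝ), p.2)) (0, τ) :=
        continuousAt_const.prodMk continuousAt_snd
      exact ContinuousAt.comp (f := fun p : ℝ × ℝ => ((0 : ℝ), p.2))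
        (g := fun p : ℝ × ℝ => Φ p.1 p.2) (x := ((0 : ℝ), τ)) (hΦc τ hτ') h3
    filter_upwards [h1, ((hΦc τ hτ').sub h2).eventually_lt_const (u := κ') (by simpa using hκ'pos)]
      with p hp1 hp2
    exact ⟨hp1, by linarith [show Φ p.1 p.2 - Φ 0 p.2 < κ' from hp2]⟩
  have hev : ∀ᶠ ε in 𝓝 (0 : ℝ), ∀ τ ∈ Icc s t, V ε τ ∈ U ∧ Φ ε τ < Φ 0 τ + κ' :=
    isCompact_Icc.eventually_forall_of_forall_eventually hloc
  obtain ⟨r, hr, hball⟩ := Metric.eventually_nhds_iff.1 hev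
  filter_upwards [Ioo_mem_nhdsGT hr] with ε hε
  have hεr : ∀ x ∈ Icc 0 ε, ∀ τ ∈ Icc s t, V x τ ∈ U ∧ Φ x τ < Φ 0 τ + κ' := fun x hx =>
    hball (by rw [Real.dist_eq, sub_zero, abs_of_nonneg hx.1]; exact hx.2.trans_lt hε.2)
  have hVd : ∀ τ ∈ Ioo α β, HasDerivAt (V ε) (W ε τ) τ := fun τ hτ =>
    ((hc τ hτ).add ((hξ τ hτ).const_smul ε)).add ((hw τ hτ).const_smul _)
  have hWcont : ContinuousOn (W ε) (Icc s t) :=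
    ((hv.add (continuousOn_const.smul hξ')).add (continuousOn_const.smul hw')).mono hsub
  obtain ⟨M, hM⟩ := isCompact_Icc.exists_bound_of_continuousOn hWcont
  have hVlip : LipschitzOnWith M.toNNReal (V ε) (Icc s t) := by
    refine (convex_Icc s t).lipschitzOnWith_of_nnnorm_hasDerivWithin_le
      (fun τ hτ => (hVd τ (hsub hτ)).hasDerivWithinAt) fun τ hτ => ?_
    exact NNReal.coe_le_coe.1 ((hM τ hτ).trans (Real.le_coe_toNNReal M))
  have hQc : ContinuousOn Q (Icc s t) := by
    have h1 : ContinuousOn (Φ 0) (Ioo α β) := fun τ hτ => by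
      have h3 : ContinuousAt (fun τ : ℝ => ((0 : ℝ), τ)) τ :=
        continuousAt_const.prodMk continuousAt_id
      exact (ContinuousAt.comp (f := fun τ : ℝ => ((0 : ℝ), τ))
        (g := fun p : ℝ × ℝ => Φ p.1 p.2) (x := τ) (hΦc τ hτ) h3).continuousWithinAt
    exact (h1.mono hsub).congr fun τ hτ => (hΦ0 τ (hsub hτ)).symm
  have hQi : IntervalIntegrable Q volume s t :=
    ContinuousOn.intervalIntegrable (by rwa [uIcc_of_le hst])
  have hspeed : ∀ τ ∈ Icc s t, √(A (V ε τ) (W ε τ) (W ε τ)) ≤ 1 + ε ^ 2 / 4 * (Q τ + κ') := by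
    intro τ hτ
    have hxd : ∀ x : ℝ, HasDerivAt (fun x => V x τ) (X x τ) x := fun x => by
      have h2 : HasDerivAt (fun x : ℝ => x ^ 2 / 2) x x := by
        simpa using (hasDerivAt_pow 2 x).div_const 2
      have h3 := (((hasDerivAt_id x).smul_const (ξ τ)).const_add (c τ)).add (h2.smul_const (w τ))
      rw [one_smul] at h3
      exact h3
    have hwd : ∀ x : ℝ, HasDerivAt (fun x => W x τ) (Y x τ) x := fun x => by
      have h2 : HasDerivAt (fun x : ℝ => x ^ 2 / 2) x x := by
        simpa using (hasDerivAt_pow 2 x).div_const 2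
      have h3 := (((hasDerivAt_id x).smul_const (ξ' τ)).const_add (v τ)).add (h2.smul_const (w' τ))
      rw [one_smul] at h3
      exact h3
    have hXd : ∀ x : ℝ, HasDerivAt (fun x => X x τ) (w τ) x := fun x => by
      have h3 := ((hasDerivAt_id x).smul_const (w τ)).const_add (ξ τ)
      rw [one_smul] at h3
      exact h3
    have hYd : ∀ x : ℝ, HasDerivAt (fun x => Y x τ) (w' τ) x := fun x => by
      have h3 := ((hasDerivAt_id x).smul_const (w' τ)).const_add (ξ' τ)
      rw [one_smul] at h3
      exact h3
    let F : ℝ → ℝ := fun x => A (V x τ) (W x τ) (W x τ)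
    let F' : ℝ → ℝ := fun x => fderiv ℝ A (V x τ) (X x τ) (W x τ) (W x τ)
      + 2 * A (V x τ) (Y x τ) (W x τ)
    have hF : ∀ x ∈ Icc 0 ε, HasDerivAt F (F' x) x := fun x hx => by
      have h1 := hasDerivAt_bil_comp (x := fun x => V x τ) ((hA1 _ (hεr x hx τ hτ).1).differentiableAt (by simp))
        (hxd x) (hwd x) (hwd x)
      refine h1.congr_deriv ?_
      simp only [F', h.symm (V x τ) (W x τ) (Y x τ)]
      ring
    have hF' : ∀ x ∈ Icc 0 ε, HasDerivAt F' (Φ x τ) x := fun x hx => by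
      have hm := (hεr x hx τ hτ).1
      have h0 : HasDerivAt (fun x => fderiv ℝ A (V x τ) (X x τ))
          (fderiv ℝ (fderiv ℝ A) (V x τ) (X x τ) (X x τ) + fderiv ℝ A (V x τ) (w τ)) x :=
        ((((hA2 _ hm).differentiableAt (by simp)).hasFDerivAt).comp_hasDerivAt x
          (hxd x)).clm_apply (hXd x)
      have h1 := Bil.hasDerivAt_apply h0 (hwd x) (hwd x)
      have h2 := (hasDerivAt_bil_comp (x := fun x => V x τ) ((hA1 _ hm).differentiableAt (by simp))
        (hxd x) (hYd x) (hwd x)).const_mul 2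
      refine (h1.add h2).congr_deriv ?_
      simp only [Φ, Bil.add_apply, add_apply, h.fderiv_symm hm (X x τ) (W x τ) (Y x τ)]
      ring
    -- Taylor expansion of the energy density, followed by `√F ≤ (1 + F) / 2`.
    have h0 := le_taylor_two hF hF' (M := Q τ + κ') (fun x hx => by
      rw [← hΦ0 τ (hsub hτ)]; exact (hεr x hx τ hτ).2.le) ε ⟨hε.1.le, le_rfl⟩
    have hF0 : F 0 = 1 := by
      simp only [F, hV0]
      simp [W, hunit τ (hsub hτ)]
    have hF'0 : F' 0 = 0 := by
      simp only [F', hV0]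
      simpa [W, X, Y] using hfirst τ (hsub hτ)
    rw [hF0, hF'0] at h0
    have hnn : 0 ≤ F ε := by
      by_cases hw : W ε τ = 0
      · simp [F, hw]
      · exact (h.pos _ (hεr ε ⟨hε.1.le, le_rfl⟩ τ hτ).1 _ hw).le
    change √(F ε) ≤ _
    nlinarith [Real.sq_sqrt hnn, sq_nonneg (√(F ε) - 1)]
  have hLi : IntervalIntegrable (fun τ => ε ^ 2 / 4 * (Q τ + κ')) volume s t :=
    (hQi.add intervalIntegrable_const).const_mul _
  have hlen := h.le_integral (L := fun τ => 1 + ε ^ 2 / 4 * (Q τ + κ')) hst hVlip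
    (fun τ hτ => (hεr ε ⟨hε.1.le, le_rfl⟩ τ hτ).1)
    (Eventually.of_forall fun τ hτ => hVd τ (hsub (Ioo_subset_Icc_self hτ)))
    (intervalIntegrable_const.add hLi)
    (Eventually.of_forall fun τ hτ => hspeed τ (Ioo_subset_Icc_self hτ))
  rw [intervalIntegral.integral_add intervalIntegrable_const hLi,
    intervalIntegral.integral_const_mul, intervalIntegral.integral_add hQi intervalIntegrable_const,
    intervalIntegral.integral_const, intervalIntegral.integral_const, smul_eq_mul, smul_eq_mul,
    mul_one] at hlen
  have h5 : (t - s) * κ' ≤ κ := by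
    rw [hκ', mul_div_assoc', div_le_iff₀ (by linarith)]
    nlinarith
  have h6 : 0 ≤ ε ^ 2 := sq_nonneg ε
  refine hlen.trans ?_
  nlinarith [mul_le_mul_of_nonneg_left h5 h6]

end SecondVariation

/-! ### The second variation formula on surfaces -/

section Algebra

variable {E : Type*} [NormedAddCommGroup E] [NormedSpace ℝ E]

theorem Bil.zero_apply (v : E) : (0 : Bil E) v = 0 := rfl

/-- The Gauss curvature of a two-dimensional metric, in terms of the first and second derivatives
`D`, `D₂` of the metric tensor in a chart and an orthonormal frame `v`, `n` at the point. -/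
def frameCurvature (D : E →L[ℝ] Bil E) (D₂ : E →L[ℝ] E →L[ℝ] Bil E) (v n : E) : ℝ :=
  -(1 / 2) * (D₂ n n v v - 2 * D₂ v n v n + D₂ v v n n) + 1 / 4 * (D n v v ^ 2 + D v n n ^ 2)
    - 1 / 2 * (D v v v * D n v n + D v v n * D n n n)
    + 1 / 4 * (D v v v * D v n n + D n v v * D n n n)

set_option maxHeartbeats 1000000 in
/-- The pointwise identity behind the second variation formula: the integrand for the field
`ξ = η n` is `2 (η'² - K η²)`, if the transversal curves are geodesics to second order. Here `a` is
the acceleration of a geodesic of velocity `v`, and `n'` is the derivative of its unit normal. -/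
theorem second_variation_identity {B : Bil E} {D : E →L[ℝ] Bil E} {D₂ : E →L[ℝ] E →L[ℝ] Bil E}
    (hB : ∀ x y, B x y = B y x) (hD : ∀ u x y, D u x y = D u y x)
    (hD₂ : ∀ u z x y, D₂ u z x y = D₂ u z y x)
    {v n a n' w w' : E} {η η' : ℝ} (hvv : B v v = 1) (hvn : B v n = 0) (hnn : B n n = 1)
    (ha : a = (-(1 / 2) * D v v v) • v + (1 / 2 * D n v v - D v v n) • n)
    (hn' : n' = (-(1 / 2) * D n v v) • v + (-(1 / 2) * D v n n) • n)
    (hgw : B a w + D v v w = 1 / 2 * D w v v)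
    (hw' : D v w v + B w' v + B w a =
      -(D₂ v (η • n) (η • n) v + D (η' • n + η • n') (η • n) v + D (η • n) (η' • n + η • n') v
        + D (η • n) (η • n) a)
      + 1 / 2 * (D₂ v v (η • n) (η • n) + D a (η • n) (η • n) + D v (η' • n + η • n') (η • n)
        + D v (η • n) (η' • n + η • n'))) :
    D₂ (η • n) (η • n) v v + D w v v + 4 * D (η • n) (η' • n + η • n') v + 2 * B w' v
        + 2 * B (η' • n + η • n') (η' • n + η • n') =
      2 * (η' ^ 2 - frameCurvature D D₂ v n * η ^ 2) := by
  have h1 := hB w a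
  have h2 := hD v w v
  have s1 : ∀ x, D x n v = D x v n := fun x => hD x n v
  have s2 : ∀ x y, D₂ x y n v = D₂ x y v n := fun x y => hD₂ x y n v
  have s3 : B n v = 0 := (hB n v).trans hvn
  have key : D₂ (η • n) (η • n) v v + 4 * D (η • n) (η' • n + η • n') v
      + 2 * B (η' • n + η • n') (η' • n + η • n') + 2 * (
      -(D₂ v (η • n) (η • n) v + D (η' • n + η • n') (η • n) v + D (η • n) (η' • n + η • n') v
        + D (η • n) (η • n) a)
      + 1 / 2 * (D₂ v v (η • n) (η • n) + D a (η • n) (η • n) + D v (η' • n + η • n') (η • n)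
        + D v (η • n) (η' • n + η • n'))) =
      2 * (η' ^ 2 - frameCurvature D D₂ v n * η ^ 2) := by
    rw [ha, hn']
    simp only [map_add, map_smul, Bil.add_apply, Bil.smul_apply, add_apply, smul_apply,
      smul_eq_mul, s1, s2, s3, hvv, hvn, hnn, frameCurvature]
    ring
  linear_combination key + 2 * hw' - 2 * h1 - 2 * h2 - 2 * hgw

end Algebra

section SecondVariation

variable {E : Type*} [NormedAddCommGroup E] [NormedSpace ℝ E]
  {U : Set E} {A : E → Bil E} {δ : E → E → ℝ}

theorem HasDerivAt.fderiv_bil_apply {c x y z : ℝ → E} {c' x' y' z' : E} {t : ℝ}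
    (hA : DifferentiableAt ℝ (fderiv ℝ A) (c t)) (hc : HasDerivAt c c' t) (hx : HasDerivAt x x' t)
    (hy : HasDerivAt y y' t) (hz : HasDerivAt z z' t) :
    HasDerivAt (fun t => fderiv ℝ A (c t) (x t) (y t) (z t))
      (fderiv ℝ (fderiv ℝ A) (c t) c' (x t) (y t) (z t) + fderiv ℝ A (c t) x' (y t) (z t)
        + fderiv ℝ A (c t) (x t) y' (z t) + fderiv ℝ A (c t) (x t) (y t) z') t := by
  have h0 : HasDerivAt (fun t => fderiv ℝ A (c t) (x t))
      (fderiv ℝ (fderiv ℝ A) (c t) c' (x t) + fderiv ℝ A (c t) x') t :=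
    (hA.hasFDerivAt.comp_hasDerivAt t hc).clm_apply hx
  refine (Bil.hasDerivAt_apply h0 hy hz).congr_deriv ?_
  simp only [Bil.add_apply, add_apply]

theorem IsLocalMetric.fderiv_fderiv_symm (h : IsLocalMetric U A δ) {y : E} (hy : y ∈ U)
    (u z a b : E) : fderiv ℝ (fderiv ℝ A) y u z a b = fderiv ℝ (fderiv ℝ A) y u z b a := by
  have hx : HasDerivAt (fun r : ℝ => y + r • u) u 0 := by
    simpa using ((hasDerivAt_id (0 : ℝ)).smul_const u).const_add y
  have hd : DifferentiableAt ℝ (fderiv ℝ A) (y + (0 : ℝ) • u) := by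
    rw [zero_smul, add_zero]; exact (h.contDiffAt_fderiv hy).differentiableAt (by simp)
  have h1 := HasDerivAt.fderiv_bil_apply (c := fun r : ℝ => y + r • u) hd hx
    (hasDerivAt_const 0 z) (hasDerivAt_const 0 a) (hasDerivAt_const 0 b)
  have h2 := HasDerivAt.fderiv_bil_apply (c := fun r : ℝ => y + r • u) hd hx
    (hasDerivAt_const 0 z) (hasDerivAt_const 0 b) (hasDerivAt_const 0 a)
  have hev : ∀ᶠ r in 𝓝 (0 : ℝ), y + r • u ∈ U :=
    hx.continuousAt.preimage_mem_nhds (h.isOpen.mem_nhds (by simpa using hy))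
  have h3 := h1.unique (h2.congr_of_eventuallyEq (by
    filter_upwards [hev] with r hr using h.fderiv_symm hr _ _ _))
  simpa [Bil.zero_apply] using h3

/-- Linear forms that depend differentiably on a parameter are represented by vectors that depend
differentiably on the parameter. -/
theorem exists_contDiffOn_representative [FiniteDimensional ℝ E] {B : ℝ → Bil E} {J : Set ℝ}
    (hBs : ContDiffOn ℝ 1 B J) (hB : ∀ τ ∈ J, ∀ v, v ≠ 0 → 0 < B τ v v) {q : ℝ → E →ₗ[ℝ] ℝ}
    (hq : ∀ e, ContDiffOn ℝ 1 (fun τ => q τ e) J) :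
    ∃ w : ℝ → E, ContDiffOn ℝ 1 w J ∧ ∀ τ ∈ J, ∀ e, B τ (w τ) e = q τ e := by
  let bs := Module.finBasis ℝ E
  let l : Fin (Module.finrank ℝ E) → E →L[ℝ] ℝ := fun i =>
    LinearMap.toContinuousLinearMap (bs.coord i)
  have hlb : ∀ e, e = ∑ i, l i e • bs i := fun e => (bs.sum_repr e).symm
  let L : ℝ → E →L[ℝ] ℝ := fun τ => ∑ i, q τ (bs i) • l i
  have hL : ContDiffOn ℝ 1 L J :=
    ContDiffOn.sum fun i _ => (hq (bs i)).smul contDiffOn_const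
  refine ⟨fun τ => (B τ).inv (L τ), fun τ hτ => ?_, fun τ hτ e => ?_⟩
  · exact ((B τ).contDiffAt_inv (hB τ hτ) (L τ)).comp_contDiffWithinAt
      (f := fun τ => (B τ, L τ)) τ ((hBs τ hτ).prodMk (hL τ hτ))
  · rw [(B τ).apply_inv (hB τ hτ)]
    conv_rhs => rw [hlb e]
    simp only [L, map_sum, map_smul, sum_apply, smul_apply, smul_eq_mul]
    exact Finset.sum_congr rfl fun i _ => mul_comm _ _

theorem ContDiffOn.hasDerivAt_of_isOpen {F : Type*} [NormedAddCommGroup F] [NormedSpace ℝ F]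
    {f : ℝ → F} {J : Set ℝ} (hf : ContDiffOn ℝ 1 f J) (hJ : IsOpen J) {τ : ℝ} (hτ : τ ∈ J) :
    HasDerivAt f (deriv f τ) τ :=
  ((hf.differentiableOn (by simp)).differentiableAt (hJ.mem_nhds hτ)).hasDerivAt

/-- The second variation of length in dimension two. -/
theorem IsLocalMetric.second_variation [FiniteDimensional ℝ E] (h : IsLocalMetric U A δ)
    {c n : ℝ → E} {η : ℝ → ℝ} {α β : ℝ} (hU : ∀ τ ∈ Ioo α β, c τ ∈ U)
    (hc : ContDiffOn ℝ 2 c (Ioo α β))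
    (hunit : ∀ τ ∈ Ioo α β, A (c τ) (deriv c τ) (deriv c τ) = 1)
    (hgeo : ∀ τ ∈ Ioo α β, ∀ e,
      A (c τ) (deriv (deriv c) τ) e + fderiv ℝ A (c τ) (deriv c τ) (deriv c τ) e =
        1 / 2 * fderiv ℝ A (c τ) e (deriv c τ) (deriv c τ))
    (hn : ContDiffOn ℝ 1 n (Ioo α β)) (hvn : ∀ τ ∈ Ioo α β, A (c τ) (deriv c τ) (n τ) = 0)
    (hnn : ∀ τ ∈ Ioo α β, A (c τ) (n τ) (n τ) = 1)
    (hspan : ∀ τ ∈ Ioo α β, ∀ e,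
      e = A (c τ) e (deriv c τ) • deriv c τ + A (c τ) e (n τ) • n τ)
    (hη : ContDiffOn ℝ 1 η (Ioo α β)) :
    ∃ w : ℝ → E, (∀ τ ∈ Ioo α β, ∀ e, A (c τ) (w τ) e +
        fderiv ℝ A (c τ) (η τ • n τ) (η τ • n τ) e =
        1 / 2 * fderiv ℝ A (c τ) e (η τ • n τ) (η τ • n τ)) ∧
      ∀ s t, α < s → s ≤ t → t < β → ∀ κ > 0, ∀ᶠ ε in 𝓝[>] (0 : ℝ),
        δ (c s + ε • (η s • n s) + (ε ^ 2 / 2) • w s) (c t + ε • (η t • n t) + (ε ^ 2 / 2) • w t) ≤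
          (t - s) + ε ^ 2 / 2 * (∫ τ in s..t, (deriv η τ ^ 2 -
            frameCurvature (fderiv ℝ A (c τ)) (fderiv ℝ (fderiv ℝ A) (c τ)) (deriv c τ) (n τ)
              * η τ ^ 2)) + κ * ε ^ 2 := by
  set v := deriv c with hvdef
  have hJ : IsOpen (Ioo α β) := isOpen_Ioo
  have hc1 : ContDiffOn ℝ 1 c (Ioo α β) := hc.of_le (by norm_num)
  have hv1 : ContDiffOn ℝ 1 v (Ioo α β) :=
    ((contDiffOn_succ_iff_deriv_of_isOpen (n := 1) hJ).1 hc).2.2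
  set ξ : ℝ → E := fun τ => η τ • n τ with hξdef
  have hξ1 : ContDiffOn ℝ 1 ξ (Ioo α β) := hη.smul hn
  have hcd := fun τ hτ => hc1.hasDerivAt_of_isOpen hJ (τ := τ) hτ
  have hvd := fun τ hτ => hv1.hasDerivAt_of_isOpen hJ (τ := τ) hτ
  have hnd := fun τ hτ => hn.hasDerivAt_of_isOpen hJ (τ := τ) hτ
  have hηd := fun τ hτ => hη.hasDerivAt_of_isOpen hJ (τ := τ) hτ
  have hξd : ∀ τ ∈ Ioo α β, HasDerivAt ξ (deriv η τ • n τ + η τ • deriv n τ) τ := fun τ hτ =>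
    ((hηd τ hτ).smul (hnd τ hτ)).congr_deriv (add_comm _ _)
  have hAd : ∀ τ ∈ Ioo α β, DifferentiableAt ℝ A (c τ) := fun τ hτ =>
    (h.contDiffAt (hU τ hτ)).differentiableAt (by simp)
  have hAd2 : ∀ τ ∈ Ioo α β, DifferentiableAt ℝ (fderiv ℝ A) (c τ) := fun τ hτ =>
    (h.contDiffAt_fderiv (hU τ hτ)).differentiableAt (by simp)
  have hD := fun τ hτ => h.fderiv_symm (hU τ hτ)
  have hAc : ContDiffOn ℝ 1 (fun τ => A (c τ)) (Ioo α β) := fun τ hτ =>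
    ((h.contDiffAt (hU τ hτ)).of_le (by simp)).comp_contDiffWithinAt τ (hc1 τ hτ)
  have hDc : ContDiffOn ℝ 1 (fun τ => fderiv ℝ A (c τ)) (Ioo α β) := fun τ hτ =>
    ((h.contDiffAt_fderiv (hU τ hτ)).of_le (by simp)).comp_contDiffWithinAt τ (hc1 τ hτ)
  have happ : ∀ {B : ℝ → Bil E} {x y : ℝ → E}, ContDiffOn ℝ 1 B (Ioo α β) →
      ContDiffOn ℝ 1 x (Ioo α β) → ContDiffOn ℝ 1 y (Ioo α β) →
      ContDiffOn ℝ 1 (fun τ => B τ (x τ) (y τ)) (Ioo α β) := fun {B x y} hB hx hy => by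
    have hB' : ContDiffOn ℝ 1 (F := E →L[ℝ] E →L[ℝ] ℝ) B (Ioo α β) := hB
    exact (ContDiffOn.clm_apply (G := E →L[ℝ] ℝ) hB' hx).clm_apply hy
  -- the second order part of the variation, for which transversal curves are nearly geodesics
  let q : ℝ → E →ₗ[ℝ] ℝ := fun τ =>
    { toFun := fun e => -fderiv ℝ A (c τ) (ξ τ) (ξ τ) e + 1 / 2 * fderiv ℝ A (c τ) e (ξ τ) (ξ τ)
      map_add' := fun x y => by
        simp only [map_add, Bil.add_apply, add_apply]; ring
      map_smul' := fun r x => by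
        simp only [map_smul, Bil.smul_apply, smul_apply, smul_eq_mul, RingHom.id_apply]; ring }
  have hq : ∀ e, ContDiffOn ℝ 1 (fun τ => q τ e) (Ioo α β) := fun e =>
    (happ (hDc.clm_apply hξ1) hξ1 contDiffOn_const).neg.add
      (contDiffOn_const.mul (happ (hDc.clm_apply contDiffOn_const) hξ1 hξ1))
  obtain ⟨w, hw1, hw⟩ := exists_contDiffOn_representative hAc (fun τ hτ => h.pos _ (hU τ hτ)) hq
  have hwd := fun τ hτ => hw1.hasDerivAt_of_isOpen hJ (τ := τ) hτ
  refine ⟨w, fun τ hτ e => ?_, fun s t hs hst ht κ hκ => ?_⟩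
  · rw [hw τ hτ e]
    simp only [q, LinearMap.coe_mk, AddHom.coe_mk]
    ring
  have hJs : ∀ τ ∈ Ioo α β, Ioo α β ∈ 𝓝 τ := fun τ hτ => hJ.mem_nhds hτ
  -- differentiating the relations that define the frame
  have en1 : ∀ τ ∈ Ioo α β, A (c τ) (deriv n τ) (n τ) = -(1 / 2) * fderiv ℝ A (c τ) (v τ) (n τ) (n τ) := by
    intro τ hτ
    have h1 := hasDerivAt_bil_comp (hAd τ hτ) (hcd τ hτ) (hnd τ hτ) (hnd τ hτ)
    have h2 := h1.unique ((hasDerivAt_const τ (1 : ℝ)).congr_of_eventuallyEq (by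
      filter_upwards [hJs τ hτ] with r hr using hnn r hr))
    linarith [h.symm (c τ) (n τ) (deriv n τ)]
  have en2 : ∀ τ ∈ Ioo α β, A (c τ) (deriv n τ) (v τ) = -(1 / 2) * fderiv ℝ A (c τ) (n τ) (v τ) (v τ) := by
    intro τ hτ
    have h1 := hasDerivAt_bil_comp (hAd τ hτ) (hcd τ hτ) (hvd τ hτ) (hnd τ hτ)
    have h2 := h1.unique ((hasDerivAt_const τ (0 : ℝ)).congr_of_eventuallyEq (by
      filter_upwards [hJs τ hτ] with r hr using hvn r hr))
    linarith [h.symm (c τ) (v τ) (deriv n τ), hgeo τ hτ (n τ)]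
  -- The second derivative of the energy density, simplified with the derivatives of the frame and
  -- of the equation for `w`.
  have hquad : ∀ τ ∈ Ioo α β, 2 * (deriv η τ ^ 2 -
      frameCurvature (fderiv ℝ A (c τ)) (fderiv ℝ (fderiv ℝ A) (c τ)) (v τ) (n τ) * η τ ^ 2) =
      fderiv ℝ (fderiv ℝ A) (c τ) (ξ τ) (ξ τ) (v τ) (v τ) + fderiv ℝ A (c τ) (w τ) (v τ) (v τ)
        + 4 * fderiv ℝ A (c τ) (ξ τ) (deriv η τ • n τ + η τ • deriv n τ) (v τ)
        + 2 * A (c τ) (deriv w τ) (v τ)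
        + 2 * A (c τ) (deriv η τ • n τ + η τ • deriv n τ) (deriv η τ • n τ + η τ • deriv n τ) := by
    intro τ hτ
    refine (second_variation_identity (h.symm (c τ)) (hD τ hτ)
      (h.fderiv_fderiv_symm (hU τ hτ)) (a := deriv v τ)
      (hunit τ hτ) (hvn τ hτ) (hnn τ hτ) ?_ ?_ (hgeo τ hτ (w τ)) ?_).symm
    · refine (hspan τ hτ _).trans ?_
      congr 2
      · linarith [hgeo τ hτ (v τ)]
      · linarith [hgeo τ hτ (n τ)]
    · refine (hspan τ hτ _).trans ?_
      rw [en1 τ hτ, en2 τ hτ]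
    · have h1 := hasDerivAt_bil_comp (hAd τ hτ) (hcd τ hτ) (hwd τ hτ) (hvd τ hτ)
      have h2 := (HasDerivAt.fderiv_bil_apply (hAd2 τ hτ) (hcd τ hτ) (hξd τ hτ) (hξd τ hτ)
        (hvd τ hτ)).neg.add ((HasDerivAt.fderiv_bil_apply (hAd2 τ hτ) (hcd τ hτ) (hvd τ hτ)
          (hξd τ hτ) (hξd τ hτ)).const_mul (1 / 2))
      exact h1.unique (h2.congr_of_eventuallyEq (by
        filter_upwards [hJs τ hτ] with r hr using hw r hr (v r)))
  have hmain := h.length_expansion hs hst ht hU hcd hξd hwd hv1.continuousOn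
    (((hη.continuousOn_deriv_of_isOpen hJ le_rfl).smul hn.continuousOn).add
      (hη.continuousOn.smul (hn.continuousOn_deriv_of_isOpen hJ le_rfl)))
    (hw1.continuousOn_deriv_of_isOpen hJ le_rfl) hunit (fun τ hτ => ?_) hquad hκ
  · filter_upwards [hmain] with ε hε
    refine hε.trans_eq ?_
    rw [intervalIntegral.integral_const_mul]
    ring
  · simp only [hξdef, map_add, map_smul, Bil.smul_apply, add_apply, smul_apply,
      smul_eq_mul]
    rw [show A (c τ) (n τ) (deriv c τ) = 0 from (h.symm _ _ _).trans (hvn τ hτ)]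
    have := en2 τ hτ
    rw [this]
    ring

end SecondVariation

/-! ### Curvature of warped product matrices -/

section WarpedCoordinates

variable {ι κ E F : Type*} [NormedAddCommGroup E] [NormedSpace ℝ E]
  [NormedAddCommGroup F] [NormedSpace ℝ F]

theorem coordDeriv_congr {b : Module.Basis ι ℝ E} {f g : E → ℝ} {y : E} (h : f =ᶠ[𝓝 y] g) (i : ι) :
    coordDeriv b i f y = coordDeriv b i g y := by
  rw [coordDeriv, coordDeriv, h.fderiv_eq]

theorem contDiffOn_coordDeriv {b : Module.Basis ι ℝ E} {f : E → ℝ} {W : Set E} (hW : IsOpen W)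
    (hf : ContDiffOn ℝ ∞ f W) (i : ι) : ContDiffOn ℝ ∞ (coordDeriv b i f) W :=
  (hf.fderiv_of_isOpen (m := ∞) hW (by simp)).clm_apply contDiffOn_const

/-- Functions of the base point, differentiated along the base. -/
theorem coordDeriv_prod_inl {b : Module.Basis ι ℝ E} {b' : Module.Basis κ ℝ F} {f : E → ℝ}
    {q : E × F} (hf : DifferentiableAt ℝ f q.1) (i : ι) :
    coordDeriv (b.prod b') (Sum.inl i) (fun q => f q.1) q = coordDeriv b i f q.1 := by
  have h := (hf.hasFDerivAt.comp q (hasFDerivAt_fst (p := q))).fderiv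
  change fderiv ℝ (f ∘ Prod.fst) q _ = _
  rw [h]
  simp [coordDeriv]

/-- Functions of the base point are constant along the fibre. -/
theorem coordDeriv_prod_inr {b : Module.Basis ι ℝ E} {b' : Module.Basis κ ℝ F} {f : E → ℝ}
    {q : E × F} (hf : DifferentiableAt ℝ f q.1) (i : κ) :
    coordDeriv (b.prod b') (Sum.inr i) (fun q => f q.1) q = 0 := by
  have h := (hf.hasFDerivAt.comp q (hasFDerivAt_fst (p := q))).fderiv
  change fderiv ℝ (f ∘ Prod.fst) q _ = _
  rw [h]
  simp

theorem coordDeriv_const {b : Module.Basis ι ℝ E} (r : ℝ) (y : E) (i : ι) :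
    coordDeriv b i (fun _ => r) y = 0 := by
  simp [coordDeriv]

/-- The metric `g + ∑ exp (2 uₐ) dtₐ²` in product coordinates. -/
def warpedMatrix [DecidableEq κ] (G : E → Matrix ι ι ℝ) (u : κ → E → ℝ) (q : E × F) :
    Matrix (ι ⊕ κ) (ι ⊕ κ) ℝ :=
  Matrix.fromBlocks (G q.1) 0 0 (Matrix.diagonal fun a => Real.exp (2 * u a q.1))

variable [Fintype ι] [DecidableEq ι] [Fintype κ] [DecidableEq κ]
  {G : E → Matrix ι ι ℝ} {u : κ → E → ℝ} {b : Module.Basis ι ℝ E} {b' : Module.Basis κ ℝ F}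
  {W : Set E}

/-- The inverse of a warped metric is block diagonal as well. -/
theorem warpedMatrix_inv (q : E × F) (hG : IsUnit (G q.1).det) : (warpedMatrix G u q)⁻¹ =
    Matrix.fromBlocks (G q.1)⁻¹ 0 0 (Matrix.diagonal fun a => Real.exp (-(2 * u a q.1))) := by
  refine Matrix.inv_eq_right_inv ?_
  rw [warpedMatrix, Matrix.fromBlocks_multiply, Matrix.mul_nonsing_inv _ hG,
    Matrix.diagonal_mul_diagonal]
  simp [← Real.exp_add]

/-- The components of the gradient of `f`. -/
def coordGrad (b : Module.Basis ι ℝ E) (G : E → Matrix ι ι ℝ) (f : E → ℝ) (k : ι) (y : E) : ℝ :=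
  ∑ l, (G y)⁻¹ k l * coordDeriv b l f y

/-- The Christoffel symbols of the metric `warpedMatrix G u`. -/
def warpedChristoffel (b : Module.Basis ι ℝ E) (G : E → Matrix ι ι ℝ) (u : κ → E → ℝ) :
    ι ⊕ κ → ι ⊕ κ → ι ⊕ κ → E → ℝ
  | .inl k, .inl i, .inl j => christoffel b G k i j
  | .inl _, .inl _, .inr _ => fun _ => 0
  | .inl _, .inr _, .inl _ => fun _ => 0
  | .inl k, .inr a, .inr c => fun y =>
      if a = c then -(Real.exp (2 * u a y) * coordGrad b G (u a) k y) else 0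
  | .inr _, .inl _, .inl _ => fun _ => 0
  | .inr a, .inl i, .inr c => fun y => if a = c then coordDeriv b i (u a) y else 0
  | .inr a, .inr c, .inl i => fun y => if a = c then coordDeriv b i (u a) y else 0
  | .inr _, .inr _, .inr _ => fun _ => 0

/-- Smoothness of the coordinate expressions of a metric and of the logarithms of the warping
functions. -/
structure WarpedData (G : E → Matrix ι ι ℝ) (u : κ → E → ℝ) (W : Set E) : Prop where
  isOpen : IsOpen W
  isUnit : ∀ y ∈ W, IsUnit (G y).det
  smooth : ∀ i j, ContDiffOn ℝ ∞ (fun y => G y i j) W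
  smooth_inv : ∀ i j, ContDiffOn ℝ ∞ (fun y => (G y)⁻¹ i j) W
  smooth_log : ∀ a, ContDiffOn ℝ ∞ (u a) W

theorem WarpedData.contDiffOn_christoffel (h : WarpedData G u W) (k i j : ι) :
    ContDiffOn ℝ ∞ (christoffel b G k i j) W :=
  contDiffOn_const.mul (ContDiffOn.sum fun l _ => (h.smooth_inv k l).mul
    (((contDiffOn_coordDeriv h.isOpen (h.smooth j l) i).add
      (contDiffOn_coordDeriv h.isOpen (h.smooth i l) j)).sub
      (contDiffOn_coordDeriv h.isOpen (h.smooth i j) l)))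

theorem WarpedData.contDiffOn_coordGrad (h : WarpedData G u W) (a : κ) (k : ι) :
    ContDiffOn ℝ ∞ (coordGrad b G (u a) k) W :=
  ContDiffOn.sum fun l _ => (h.smooth_inv k l).mul
    (contDiffOn_coordDeriv h.isOpen (h.smooth_log a) l)

theorem WarpedData.contDiffOn_exp (h : WarpedData G u W) (a : κ) :
    ContDiffOn ℝ ∞ (fun y => Real.exp (2 * u a y)) W :=
  (contDiffOn_const.mul (h.smooth_log a)).exp

theorem WarpedData.contDiffOn_warpedChristoffel (h : WarpedData G u W) (K I J : ι ⊕ κ) :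
    ContDiffOn ℝ ∞ (warpedChristoffel b G u K I J) W := by
  rcases K with k | k <;> rcases I with i | i <;> rcases J with j | j <;>
    simp only [warpedChristoffel]
  any_goals exact contDiffOn_const
  · exact h.contDiffOn_christoffel k i j
  · split_ifs
    · exact ((h.contDiffOn_exp i).mul (h.contDiffOn_coordGrad i k)).neg
    · exact contDiffOn_const
  · split_ifs
    · exact contDiffOn_coordDeriv h.isOpen (h.smooth_log k) i
    · exact contDiffOn_const
  · split_ifs
    · exact contDiffOn_coordDeriv h.isOpen (h.smooth_log k) j
    · exact contDiffOn_const

theorem WarpedData.differentiableAt (h : WarpedData G u W) {f : E → ℝ} (hf : ContDiffOn ℝ ∞ f W)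
    {y : E} (hy : y ∈ W) : DifferentiableAt ℝ f y :=
  (hf.contDiffAt (h.isOpen.mem_nhds hy)).differentiableAt (by simp)

/-- The Christoffel symbols of a warped metric depend only on the base point, and those without a
fibre index are the ones of the base. -/
theorem WarpedData.christoffel_eq (h : WarpedData G u W) {q : E × F} (hq : q.1 ∈ W)
    (K I J : ι ⊕ κ) : christoffel (b.prod b') (warpedMatrix G u) K I J q =
      warpedChristoffel b G u K I J q.1 := by
  have dG : ∀ i j, DifferentiableAt ℝ (fun y => G y i j) q.1 := fun i j =>
    h.differentiableAt (h.smooth i j) hq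
  have de : ∀ a, DifferentiableAt ℝ (fun y => Real.exp (2 * u a y)) q.1 := fun a =>
    h.differentiableAt (h.contDiffOn_exp a) hq
  have g1 : ∀ i j l, coordDeriv (b.prod b') (Sum.inl l)
      (fun z : E × F => warpedMatrix G u z (Sum.inl i) (Sum.inl j)) q =
      coordDeriv b l (fun y => G y i j) q.1 := fun i j l => coordDeriv_prod_inl (dG i j) l
  have g2 : ∀ i j l, coordDeriv (b.prod b') (Sum.inr l)
      (fun z : E × F => warpedMatrix G u z (Sum.inl i) (Sum.inl j)) q = 0 := fun i j l =>
    coordDeriv_prod_inr (dG i j) l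
  have g3 : ∀ i a L, coordDeriv (b.prod b') L
      (fun z : E × F => warpedMatrix G u z (Sum.inl i) (Sum.inr a)) q = 0 := fun i a L =>
    coordDeriv_const 0 q L
  have g4 : ∀ i a L, coordDeriv (b.prod b') L
      (fun z : E × F => warpedMatrix G u z (Sum.inr a) (Sum.inl i)) q = 0 := fun i a L =>
    coordDeriv_const 0 q L
  have he : ∀ a l, coordDeriv b l (fun y => Real.exp (2 * u a y)) q.1 =
      2 * Real.exp (2 * u a q.1) * coordDeriv b l (u a) q.1 := fun a l => by
    have h1 := (((h.differentiableAt (h.smooth_log a) hq).hasFDerivAt.const_mul 2).exp).fderiv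
    rw [coordDeriv, h1]
    simp only [smul_apply, smul_eq_mul, coordDeriv]
    ring
  have g5 : ∀ a c l, coordDeriv (b.prod b') (Sum.inl l)
      (fun z : E × F => warpedMatrix G u z (Sum.inr a) (Sum.inr c)) q =
      if a = c then 2 * Real.exp (2 * u a q.1) * coordDeriv b l (u a) q.1 else 0 := by
    intro a c l
    by_cases hac : a = c
    · subst hac
      simp only [warpedMatrix, Matrix.fromBlocks_apply₂₂, Matrix.diagonal_apply_eq, if_true]
      rw [coordDeriv_prod_inl (f := fun y => Real.exp (2 * u a y)) (de a), he]
    · simp only [warpedMatrix, Matrix.fromBlocks_apply₂₂, Matrix.diagonal_apply_ne _ hac, if_neg hac]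
      exact coordDeriv_const 0 q _
  have g6 : ∀ a c l, coordDeriv (b.prod b') (Sum.inr l)
      (fun z : E × F => warpedMatrix G u z (Sum.inr a) (Sum.inr c)) q = 0 := by
    intro a c l
    by_cases hac : a = c
    · subst hac
      simp only [warpedMatrix, Matrix.fromBlocks_apply₂₂, Matrix.diagonal_apply_eq]
      rw [coordDeriv_prod_inr (f := fun y => Real.exp (2 * u a y)) (de a)]
    · simp only [warpedMatrix, Matrix.fromBlocks_apply₂₂, Matrix.diagonal_apply_ne _ hac]
      exact coordDeriv_const 0 q _
  rcases K with k | k <;> rcases I with i | i <;> rcases J with j | j <;>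
    simp only [christoffel, warpedMatrix_inv q (h.isUnit _ hq), Fintype.sum_sum_type,
      Matrix.fromBlocks_apply₁₁, Matrix.fromBlocks_apply₁₂, Matrix.fromBlocks_apply₂₁,
      Matrix.fromBlocks_apply₂₂, Matrix.zero_apply, zero_mul, Finset.sum_const_zero, add_zero,
      zero_add, sub_zero, zero_sub, mul_zero, g1, g2, g3, g4, g5, g6, warpedChristoffel]
  · split_ifs with hij
    · rw [coordGrad, Finset.mul_sum, Finset.mul_sum, ← Finset.sum_neg_distrib]
      exact Finset.sum_congr rfl fun l _ => by ring
    · simp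
  · rw [Finset.sum_eq_single k (fun l _ hl => by rw [Matrix.diagonal_apply_ne' _ hl, zero_mul])
      (by simp), Matrix.diagonal_apply_eq]
    by_cases hkj : k = j
    · subst hkj
      simp only [if_true]
      rw [Real.exp_neg]
      field_simp
    · rw [if_neg hkj, if_neg (Ne.symm hkj)]
      simp
  · rw [Finset.sum_eq_single k (fun l _ hl => by rw [Matrix.diagonal_apply_ne' _ hl, zero_mul])
      (by simp), Matrix.diagonal_apply_eq]
    by_cases hki : k = i
    · subst hki
      simp only [if_true]
      rw [Real.exp_neg]
      field_simp
    · rw [if_neg hki, if_neg (Ne.symm hki)]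
      simp

theorem WarpedData.coordDeriv_christoffel_inl (h : WarpedData G u W) {q : E × F} (hq : q.1 ∈ W)
    (K I J : ι ⊕ κ) (l : ι) :
    coordDeriv (b.prod b') (Sum.inl l) (christoffel (b.prod b') (warpedMatrix G u) K I J) q =
      coordDeriv b l (warpedChristoffel b G u K I J) q.1 := by
  rw [coordDeriv_congr (g := fun q : E × F => warpedChristoffel b G u K I J q.1),
    coordDeriv_prod_inl (h.differentiableAt (h.contDiffOn_warpedChristoffel K I J) hq)]
  filter_upwards [continuousAt_fst.preimage_mem_nhds (h.isOpen.mem_nhds hq)] with z hz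
  exact h.christoffel_eq hz K I J

theorem WarpedData.coordDeriv_christoffel_inr (h : WarpedData G u W) {q : E × F} (hq : q.1 ∈ W)
    (K I J : ι ⊕ κ) (l : κ) :
    coordDeriv (b.prod b') (Sum.inr l) (christoffel (b.prod b') (warpedMatrix G u) K I J) q = 0 := by
  rw [coordDeriv_congr (g := fun q : E × F => warpedChristoffel b G u K I J q.1),
    coordDeriv_prod_inr (h.differentiableAt (h.contDiffOn_warpedChristoffel K I J) hq)]
  filter_upwards [continuousAt_fst.preimage_mem_nhds (h.isOpen.mem_nhds hq)] with z hz
  exact h.christoffel_eq hz K I J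

theorem sum_sum_ite_eq_diag (f : κ → κ → ℝ) :
    (∑ x, ∑ y, if y = x then if x = y then f x y else 0 else 0) = ∑ x, f x x := by
  refine Finset.sum_congr rfl fun x _ => ?_
  rw [Finset.sum_eq_single x (fun y _ hy => by rw [if_neg hy]) (by simp)]
  simp

/-- The Ricci tensor of a warped extension in the directions of the base. -/
theorem WarpedData.ricci_inl_inl (h : WarpedData G u W) {q : E × F} (hq : q.1 ∈ W) (j k : ι) :
    ricciCoord (b.prod b') (warpedMatrix G u) (Sum.inl j) (Sum.inl k) q =
      ricciCoord b G j k q.1 - ∑ a, (coordDeriv b j (coordDeriv b k (u a)) q.1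
        + coordDeriv b j (u a) q.1 * coordDeriv b k (u a) q.1
        - ∑ p, christoffel b G p j k q.1 * coordDeriv b p (u a) q.1) := by
  simp only [ricciCoord, Fintype.sum_sum_type, h.coordDeriv_christoffel_inl hq,
    h.coordDeriv_christoffel_inr hq, h.christoffel_eq hq, warpedChristoffel, if_true]
  simp only [mul_ite, ite_mul, mul_zero, zero_mul, sub_zero, zero_sub, add_zero,
    Finset.sum_const_zero, Finset.sum_sub_distrib, Finset.sum_add_distrib, Finset.sum_neg_distrib,
    Finset.sum_ite_eq, Finset.mem_univ, if_true]
  simp only [mul_comm]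
  rw [sum_sum_ite_eq_diag]
  ring

/-- The Ricci tensor of a warped extension in the directions of the fibre. -/
theorem WarpedData.ricci_inr_inr (h : WarpedData G u W) {q : E × F} (hq : q.1 ∈ W) (a : κ) :
    ricciCoord (b.prod b') (warpedMatrix G u) (Sum.inr a) (Sum.inr a) q =
      -(Real.exp (2 * u a q.1) * (∑ i, coordDeriv b i (coordGrad b G (u a) i) q.1
        + ∑ i, ∑ p, christoffel b G i i p q.1 * coordGrad b G (u a) p q.1
        + ∑ c, ∑ p, coordDeriv b p (u c) q.1 * coordGrad b G (u a) p q.1)) := by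
  have hd : ∀ i, coordDeriv b i (fun y => -(Real.exp (2 * u a y) * coordGrad b G (u a) i y)) q.1 =
      -(Real.exp (2 * u a q.1) * (coordDeriv b i (coordGrad b G (u a) i) q.1
        + 2 * (coordDeriv b i (u a) q.1 * coordGrad b G (u a) i q.1))) := fun i => by
    have h1 := (((h.differentiableAt (h.smooth_log a) hq).hasFDerivAt.const_mul 2).exp)
    have h2 := (h.differentiableAt (h.contDiffOn_coordGrad (b := b) a i) hq).hasFDerivAt
    have h3 := (h1.mul h2).neg.fderiv
    change fderiv ℝ (-((fun x => Real.exp (2 * u a x)) * coordGrad b G (u a) i)) q.1 (b i) = _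
    rw [h3]
    simp only [neg_apply, add_apply, smul_apply, smul_eq_mul, coordDeriv]
    ring
  simp only [ricciCoord, Fintype.sum_sum_type, h.coordDeriv_christoffel_inl hq,
    h.coordDeriv_christoffel_inr hq, h.christoffel_eq hq, warpedChristoffel, if_true, hd]
  simp only [mul_ite, ite_mul, mul_zero, zero_mul, sub_zero, zero_sub, add_zero, zero_add,
    Finset.sum_const_zero, Finset.sum_sub_distrib, Finset.sum_add_distrib, Finset.sum_neg_distrib,
    Finset.sum_ite_eq, Finset.mem_univ, if_true, Finset.mul_sum, mul_neg, neg_mul]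
  set e := Real.exp (2 * u a q.1) with he
  set X : ι → ℝ := fun i => coordGrad b G (u a) i q.1 with hX
  have e1 : (∑ x, ∑ x₁, if x₁ = a then if a = x₁ then -(e * X x * coordDeriv b x (u x₁) q.1)
      else 0 else 0) = -(e * ∑ x, coordDeriv b x (u a) q.1 * X x) := by
    rw [Finset.mul_sum, ← Finset.sum_neg_distrib]
    refine Finset.sum_congr rfl fun x _ => ?_
    rw [Finset.sum_eq_single a (fun c _ hc => by rw [if_neg hc]) (by simp)]
    simp only [if_true]
    ring
  have e2 : (∑ x, ∑ x₁, if x = a then -if x = a then coordDeriv b x₁ (u x) q.1 *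
      (Real.exp (2 * u x q.1) * coordGrad b G (u x) x₁ q.1) else 0 else 0) =
      -(e * ∑ x, coordDeriv b x (u a) q.1 * X x) := by
    rw [Finset.sum_eq_single a (fun c _ hc => by simp [hc]) (by simp), Finset.mul_sum,
      ← Finset.sum_neg_distrib]
    refine Finset.sum_congr rfl fun x _ => ?_
    simp only [if_true, hX, he]
    ring
  have e3 : ∑ x, e * (coordDeriv b x (coordGrad b G (u a) x) q.1
      + 2 * (coordDeriv b x (u a) q.1 * X x)) =
      e * ∑ x, coordDeriv b x (coordGrad b G (u a) x) q.1
        + 2 * (e * ∑ x, coordDeriv b x (u a) q.1 * X x) := by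
    rw [← Finset.mul_sum, Finset.sum_add_distrib, ← Finset.mul_sum]
    ring
  have e4 : ∑ x, ∑ x₁, christoffel b G x x x₁ q.1 * (e * X x₁) =
      e * ∑ x, ∑ x₁, christoffel b G x x x₁ q.1 * X x₁ := by
    simp only [Finset.mul_sum]
    exact Finset.sum_congr rfl fun x _ => Finset.sum_congr rfl fun y _ => by ring
  have e5 : ∑ x, ∑ x₁, coordDeriv b x₁ (u x) q.1 * (e * X x₁) =
      e * ∑ x, ∑ x₁, coordDeriv b x₁ (u x) q.1 * X x₁ := by
    simp only [Finset.mul_sum]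
    exact Finset.sum_congr rfl fun x _ => Finset.sum_congr rfl fun y _ => by ring
  rw [e1, e2, e3, e4, e5]
  ring

/-- The scalar curvature of a warped extension. -/
theorem WarpedData.scalarCurvature_eq (h : WarpedData G u W) {q : E × F} (hq : q.1 ∈ W) :
    scalarCurvatureCoord (b.prod b') (warpedMatrix G u) q =
      scalarCurvatureCoord b G q.1
        - ∑ a, ∑ j, ∑ k, (G q.1)⁻¹ j k * (coordDeriv b j (coordDeriv b k (u a)) q.1
          + coordDeriv b j (u a) q.1 * coordDeriv b k (u a) q.1
          - ∑ p, christoffel b G p j k q.1 * coordDeriv b p (u a) q.1)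
        - ∑ a, (∑ i, coordDeriv b i (coordGrad b G (u a) i) q.1
          + ∑ i, ∑ p, christoffel b G i i p q.1 * coordGrad b G (u a) p q.1
          + ∑ c, ∑ p, coordDeriv b p (u c) q.1 * coordGrad b G (u a) p q.1) := by
  rw [scalarCurvatureCoord, warpedMatrix_inv q (h.isUnit _ hq), scalarCurvatureCoord]
  simp only [Fintype.sum_sum_type, Matrix.fromBlocks_apply₁₁, Matrix.fromBlocks_apply₁₂,
    Matrix.fromBlocks_apply₂₁, Matrix.fromBlocks_apply₂₂, Matrix.zero_apply, zero_mul,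
    Finset.sum_const_zero, add_zero, zero_add, h.ricci_inl_inl hq]
  have e1 : ∀ a : κ, (∑ c, Matrix.diagonal (fun a => Real.exp (-(2 * u a q.1))) a c *
      ricciCoord (b.prod b') (warpedMatrix G u) (Sum.inr a) (Sum.inr c) q) =
      -(∑ i, coordDeriv b i (coordGrad b G (u a) i) q.1
        + ∑ i, ∑ p, christoffel b G i i p q.1 * coordGrad b G (u a) p q.1
        + ∑ c, ∑ p, coordDeriv b p (u c) q.1 * coordGrad b G (u a) p q.1) := fun a => by
    rw [Finset.sum_eq_single a (fun c _ hc => by rw [Matrix.diagonal_apply_ne' _ hc, zero_mul])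
      (by simp), Matrix.diagonal_apply_eq, h.ricci_inr_inr hq, mul_neg, ← mul_assoc,
      ← Real.exp_add, neg_add_cancel, Real.exp_zero, one_mul]
  simp only [e1, mul_sub, Finset.sum_sub_distrib, Finset.sum_neg_distrib]
  rw [sub_eq_add_neg (_ - _) (∑ a, _)]
  congr 2
  simp only [← Finset.sum_sub_distrib, ← mul_sub, Finset.mul_sum]
  rw [Finset.sum_comm_cycle]

end WarpedCoordinates

/-! ### Scalar curvature of warped extensions of surfaces -/

section SurfaceAlgebra

/-- Christoffel symbols in terms of the inverse `g` and the first derivatives `d` of a metric. -/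
def christoffelAlg (g : Fin 2 → Fin 2 → ℝ) (d : Fin 2 → Fin 2 → Fin 2 → ℝ) (k i j : Fin 2) : ℝ :=
  (1 / 2) * ∑ l, g k l * (d i j l + d j i l - d l i j)

/-- Derivatives of Christoffel symbols in terms of the inverse `g` and the first and second
derivatives `d`, `dd` of a metric. -/
def derivChristoffelAlg (g : Fin 2 → Fin 2 → ℝ) (d : Fin 2 → Fin 2 → Fin 2 → ℝ)
    (dd : Fin 2 → Fin 2 → Fin 2 → Fin 2 → ℝ) (m k i j : Fin 2) : ℝ :=
  (1 / 2) * ∑ l, ((-∑ q, ∑ p, g k p * d m p q * g q l) * (d i j l + d j i l - d l i j)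
    + g k l * (dd m i j l + dd m j i l - dd m l i j))

set_option maxHeartbeats 1000000 in
/-- The scalar curvature of a surface in an orthonormal frame `v`, `n`. -/
theorem scalar_curvature_identity {g : Fin 2 → Fin 2 → ℝ} {d : Fin 2 → Fin 2 → Fin 2 → ℝ}
    {dd : Fin 2 → Fin 2 → Fin 2 → Fin 2 → ℝ} {v n : Fin 2 → ℝ}
    (hg : ∀ i j, g i j = v i * v j + n i * n j) (hd : ∀ m, d m 1 0 = d m 0 1)
    (hdd : ∀ m p, dd m p 1 0 = dd m p 0 1) (hdd' : ∀ i j, dd 1 0 i j = dd 0 1 i j) :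
    ∑ j, ∑ k, g j k * (∑ i, (derivChristoffelAlg g d dd i i j k - derivChristoffelAlg g d dd j i i k)
      + ∑ i, ∑ p, (christoffelAlg g d i i p * christoffelAlg g d p j k
        - christoffelAlg g d i j p * christoffelAlg g d p i k)) =
    2 * (-(1 / 2) * ((∑ m, ∑ p, ∑ i, ∑ j, n m * n p * v i * v j * dd m p i j)
        - 2 * (∑ m, ∑ p, ∑ i, ∑ j, v m * n p * v i * n j * dd m p i j)
        + ∑ m, ∑ p, ∑ i, ∑ j, v m * v p * n i * n j * dd m p i j)
      + 1 / 4 * ((∑ m, ∑ i, ∑ j, n m * v i * v j * d m i j) ^ 2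
        + (∑ m, ∑ i, ∑ j, v m * n i * n j * d m i j) ^ 2)
      - 1 / 2 * ((∑ m, ∑ i, ∑ j, v m * v i * v j * d m i j)
          * (∑ m, ∑ i, ∑ j, n m * v i * n j * d m i j)
        + (∑ m, ∑ i, ∑ j, v m * v i * n j * d m i j)
          * (∑ m, ∑ i, ∑ j, n m * n i * n j * d m i j))
      + 1 / 4 * ((∑ m, ∑ i, ∑ j, v m * v i * v j * d m i j)
          * (∑ m, ∑ i, ∑ j, v m * n i * n j * d m i j)
        + (∑ m, ∑ i, ∑ j, n m * v i * v j * d m i j)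
          * (∑ m, ∑ i, ∑ j, n m * n i * n j * d m i j))) := by
  simp only [christoffelAlg, derivChristoffelAlg, Fin.sum_univ_two, hg, hd, hdd, hdd']
  ring

/-- The Laplacian of a function with derivatives `p`, `pp` in an orthonormal frame `v`, `n`. -/
def laplacianAlg (d : Fin 2 → Fin 2 → Fin 2 → ℝ) (p : Fin 2 → ℝ) (pp : Fin 2 → Fin 2 → ℝ)
    (v n : Fin 2 → ℝ) : ℝ :=
  (∑ i, ∑ j, v i * v j * pp i j) + (∑ i, ∑ j, n i * n j * pp i j)
    - ((∑ i, v i * p i) * (1 / 2 * (∑ m, ∑ i, ∑ j, v m * v i * v j * d m i j)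
        + (∑ m, ∑ i, ∑ j, n m * v i * n j * d m i j)
        - 1 / 2 * (∑ m, ∑ i, ∑ j, v m * n i * n j * d m i j))
      + (∑ i, n i * p i) * ((∑ m, ∑ i, ∑ j, v m * v i * n j * d m i j)
        - 1 / 2 * (∑ m, ∑ i, ∑ j, n m * v i * v j * d m i j)
        + 1 / 2 * (∑ m, ∑ i, ∑ j, n m * n i * n j * d m i j)))

set_option maxHeartbeats 1000000 in
/-- The trace of `∇²(e^u) / e^u` in an orthonormal frame. -/
theorem trace_hessian_identity {g : Fin 2 → Fin 2 → ℝ} {d : Fin 2 → Fin 2 → Fin 2 → ℝ}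
    {p : Fin 2 → ℝ} {pp : Fin 2 → Fin 2 → ℝ} {v n : Fin 2 → ℝ}
    (hg : ∀ i j, g i j = v i * v j + n i * n j) (hd : ∀ m, d m 1 0 = d m 0 1) :
    ∑ j, ∑ k, g j k * (pp j k + p j * p k - ∑ l, christoffelAlg g d l j k * p l) =
      laplacianAlg d p pp v n + (∑ i, v i * p i) ^ 2 + (∑ i, n i * p i) ^ 2 := by
  simp only [christoffelAlg, laplacianAlg, Fin.sum_univ_two, hg, hd]
  ring

set_option maxHeartbeats 1000000 in
/-- The divergence of the gradient, computed in coordinates, is the Laplacian in an orthonormal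
frame. -/
theorem divergence_identity {g : Fin 2 → Fin 2 → ℝ} {d : Fin 2 → Fin 2 → Fin 2 → ℝ}
    {p : Fin 2 → ℝ} {pp : Fin 2 → Fin 2 → ℝ} {v n : Fin 2 → ℝ}
    (hg : ∀ i j, g i j = v i * v j + n i * n j) (hd : ∀ m, d m 1 0 = d m 0 1)
    (hpp : pp 1 0 = pp 0 1) :
    ∑ i, ∑ l, ((-∑ q, ∑ r, g i r * d i r q * g q l) * p l + g i l * pp i l)
      + ∑ i, ∑ k, christoffelAlg g d i i k * ∑ l, g k l * p l = laplacianAlg d p pp v n := by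
  simp only [christoffelAlg, laplacianAlg, Fin.sum_univ_two, hg, hd, hpp]
  ring

end SurfaceAlgebra

section Surface

variable {κ E : Type*} [NormedAddCommGroup E] [NormedSpace ℝ E] [Fintype κ] [DecidableEq κ]
  {u : κ → E → ℝ} {b : Module.Basis (Fin 2) ℝ E} {W : Set E}

/-- In dimension two, smoothness of the inverse matrix follows from the formula for it. -/
theorem WarpedData.of_two {G : E → Matrix (Fin 2) (Fin 2) ℝ} (hW : IsOpen W)
    (hdet : ∀ y ∈ W, (G y).det ≠ 0) (hG : ∀ i j, ContDiffOn ℝ ∞ (fun y => G y i j) W)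
    (hu : ∀ a, ContDiffOn ℝ ∞ (u a) W) : WarpedData G u W where
  isOpen := hW
  isUnit y hy := (hdet y hy).isUnit
  smooth := hG
  smooth_log := hu
  smooth_inv i j := by
    have h1 : ContDiffOn ℝ ∞ (fun y => (G y).det) W := by
      simp only [Matrix.det_fin_two]
      exact ((hG 0 0).mul (hG 1 1)).sub ((hG 0 1).mul (hG 1 0))
    have h2 : ∀ y, (G y)⁻¹ i j = ((G y).det)⁻¹ * (G y).adjugate i j := fun y => by
      rw [Matrix.inv_def, Matrix.smul_apply, Ring.inverse_eq_inv', smul_eq_mul]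
    simp only [h2]
    refine (h1.inv hdet).mul ?_
    simp only [Matrix.adjugate_fin_two]
    fin_cases i <;> fin_cases j
    · exact hG 1 1
    · exact (hG 0 1).neg
    · exact (hG 1 0).neg
    · exact hG 0 0

/-- The derivative of the inverse matrix, `∂ G⁻¹ = -G⁻¹ (∂ G) G⁻¹`. -/
theorem WarpedData.coordDeriv_inv {ι : Type*} [Fintype ι] [DecidableEq ι] {G : E → Matrix ι ι ℝ}
    {b : Module.Basis ι ℝ E} (h : WarpedData G u W)
    {y : E} (hy : y ∈ W) (m k l : ι) : coordDeriv b m (fun z => (G z)⁻¹ k l) y =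
      -∑ q, ∑ p, (G y)⁻¹ k p * coordDeriv b m (fun z => G z p q) y * (G y)⁻¹ q l := by
  let P : Matrix ι ι ℝ := Matrix.of fun k l => coordDeriv b m (fun z => (G z)⁻¹ k l) y
  let d : Matrix ι ι ℝ := Matrix.of fun k l => coordDeriv b m (fun z => G z k l) y
  have h1 : P * G y + (G y)⁻¹ * d = 0 := by
    ext i j
    have h2 : ∀ p, HasFDerivAt (fun z => (G z)⁻¹ i p * G z p j)
        ((G y)⁻¹ i p • fderiv ℝ (fun z => G z p j) y
          + G y p j • fderiv ℝ (fun z => (G z)⁻¹ i p) y) y := fun p =>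
      (h.differentiableAt (h.smooth_inv i p) hy).hasFDerivAt.mul
        (h.differentiableAt (h.smooth p j) hy).hasFDerivAt
    have h3 := HasFDerivAt.fun_sum (u := Finset.univ) fun p _ => h2 p
    have h4 : HasFDerivAt (fun z => ∑ p, (G z)⁻¹ i p * G z p j) (0 : E →L[ℝ] ℝ) y := by
      refine (hasFDerivAt_const ((1 : Matrix ι ι ℝ) i j) y).congr_of_eventuallyEq ?_
      filter_upwards [h.isOpen.mem_nhds hy] with z hz
      rw [← Matrix.mul_apply, Matrix.nonsing_inv_mul _ (h.isUnit z hz)]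
    have h5 := congrArg (fun L : E →L[ℝ] ℝ => L (b m)) (h3.unique h4)
    simp only [sum_apply, add_apply, smul_apply, smul_eq_mul, zero_apply,
      Finset.sum_add_distrib] at h5
    rw [Matrix.add_apply, Matrix.mul_apply, Matrix.mul_apply, Matrix.zero_apply, ← h5, add_comm]
    simp only [P, d, Matrix.of_apply, coordDeriv]
    congr 1
    exact Finset.sum_congr rfl fun p _ => mul_comm _ _
  have h2 : P = -((G y)⁻¹ * d * (G y)⁻¹) := by
    have h3 : P * G y * (G y)⁻¹ = -((G y)⁻¹ * d) * (G y)⁻¹ := by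
      rw [eq_neg_of_add_eq_zero_left h1]
    rwa [Matrix.mul_assoc, Matrix.mul_nonsing_inv _ (h.isUnit y hy), Matrix.mul_one,
      Matrix.neg_mul] at h3
  have h3 := congrFun (congrFun h2 k) l
  rw [Matrix.neg_apply, Matrix.mul_apply] at h3
  simp only [Matrix.mul_apply, Finset.sum_mul] at h3
  exact h3

variable {A : E → Bil E}

/-- The Laplacian of a function with first and second derivatives `p`, `pp` at a point, in terms of
an orthonormal frame `v`, `n` and the derivative `D` of the metric at the point. -/
def frameLaplacian (D : E →L[ℝ] Bil E) (p : E →L[ℝ] ℝ) (pp : E →L[ℝ] E →L[ℝ] ℝ) (v n : E) : ℝ :=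
  pp v v + pp n n - (p v * (1 / 2 * D v v v + D n v n - 1 / 2 * D v n n)
    + p n * (D v v n - 1 / 2 * D n v v + 1 / 2 * D n n n))

theorem fderiv_bil_const {y : E} (hA : DifferentiableAt ℝ A y) (m x z : E) :
    fderiv ℝ (fun q => A q x z) y m = fderiv ℝ A y m x z := by
  have hx : HasDerivAt (fun r : ℝ => y + r • m) m 0 := by
    simpa using ((hasDerivAt_id (0 : ℝ)).smul_const m).const_add y
  have hd : DifferentiableAt ℝ A (y + (0 : ℝ) • m) := by rwa [zero_smul, add_zero]
  have h1 := hasDerivAt_bil_comp (x := fun r : ℝ => y + r • m) hd hx (hasDerivAt_const 0 x)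
    (hasDerivAt_const 0 z)
  have h0 : DifferentiableAt ℝ (fun q => A q x z) y := by
    have h2 : DifferentiableAt ℝ (F := E →L[ℝ] E →L[ℝ] ℝ) A y := hA
    exact (DifferentiableAt.clm_apply (H := E →L[ℝ] ℝ) h2 (differentiableAt_const x)).clm_apply
      (differentiableAt_const z)
  have h3 : HasDerivAt (fun r : ℝ => A (y + r • m) x z) (fderiv ℝ (fun q => A q x z) y m) 0 := by
    have h4 : HasFDerivAt (fun q => A q x z) (fderiv ℝ (fun q => A q x z) y) (y + (0 : ℝ) • m) := by
      rw [zero_smul, add_zero]; exact h0.hasFDerivAt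
    exact h4.comp_hasDerivAt (0 : ℝ) hx
  have h4 := h3.unique h1
  simpa [Bil.zero_apply] using h4

theorem minSmoothness_two_le_infty : minSmoothness ℝ 2 ≤ (∞ : WithTop ℕ∞) := by
  rw [minSmoothness_of_isRCLikeNormedField]
  exact WithTop.coe_le_coe.2 (le_top : (2 : ℕ∞) ≤ ⊤)

theorem basis_expand (b : Module.Basis (Fin 2) ℝ E) (v : E) :
    v = b.repr v 0 • b 0 + b.repr v 1 • b 1 := by
  conv_lhs => rw [← b.sum_repr v, Fin.sum_univ_two]

theorem bil_sum_expand (b : Module.Basis (Fin 2) ℝ E) (D : E →L[ℝ] Bil E) (x y z : E) :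
    D x y z = ∑ m, ∑ i, ∑ j, b.repr x m * b.repr y i * b.repr z j * D (b m) (b i) (b j) := by
  conv_lhs => rw [basis_expand b x, basis_expand b y, basis_expand b z]
  simp only [Fin.sum_univ_two, map_add, map_smul, Bil.add_apply, Bil.smul_apply, add_apply,
    smul_apply, smul_eq_mul]
  ring

theorem bil_sum_expand₂ (b : Module.Basis (Fin 2) ℝ E) (D₂ : E →L[ℝ] E →L[ℝ] Bil E)
    (w x y z : E) : D₂ w x y z = ∑ m, ∑ p, ∑ i, ∑ j,
      b.repr w m * b.repr x p * b.repr y i * b.repr z j * D₂ (b m) (b p) (b i) (b j) := by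
  have h1 : D₂ w x y z = ∑ m, b.repr w m * D₂ (b m) x y z := by
    conv_lhs => rw [basis_expand b w]
    simp only [Fin.sum_univ_two, map_add, map_smul, Bil.add_apply, Bil.smul_apply, add_apply,
      smul_apply, smul_eq_mul]
  rw [h1]
  refine Finset.sum_congr rfl fun m _ => ?_
  rw [bil_sum_expand b (D₂ (b m)) x y z]
  simp only [Finset.mul_sum]
  exact Finset.sum_congr rfl fun p _ => Finset.sum_congr rfl fun i _ =>
    Finset.sum_congr rfl fun j _ => by ring

theorem fderiv_fderiv_bil_const {y : E} (hA : ContDiffAt ℝ ∞ A y) (m p x z : E) :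
    fderiv ℝ (fun q => fderiv ℝ A q p x z) y m = fderiv ℝ (fderiv ℝ A) y m p x z := by
  have h1 : DifferentiableAt ℝ (fderiv ℝ A) y :=
    (hA.fderiv_right (m := ∞) (by simp)).differentiableAt (by simp)
  have h2 : HasFDerivAt (fun q => fderiv ℝ A q p)
      ((fderiv ℝ (fderiv ℝ A) y).flip p) y := by
    have h3 := h1.hasFDerivAt.clm_apply (hasFDerivAt_const p y)
    refine h3.congr_fderiv ?_
    ext m
    simp
  rw [fderiv_bil_const (A := fun q => fderiv ℝ A q p) h2.differentiableAt, h2.fderiv]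
  rfl

theorem coordDeriv_coordDeriv {f : E → ℝ} {y : E} (hf : ContDiffAt ℝ ∞ f y)
    {b : Module.Basis (Fin 2) ℝ E} (m p : Fin 2) :
    coordDeriv b m (coordDeriv b p f) y = fderiv ℝ (fderiv ℝ f) y (b m) (b p) := by
  have h1 : DifferentiableAt ℝ (fderiv ℝ f) y :=
    (hf.fderiv_right (m := ∞) (by simp)).differentiableAt (by simp)
  have h3 := h1.hasFDerivAt.clm_apply (hasFDerivAt_const (b p) y)
  change fderiv ℝ (fun q => fderiv ℝ f q (b p)) y (b m) = _
  rw [h3.fderiv]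
  simp

theorem coordDeriv_mul {ι : Type*} {b : Module.Basis ι ℝ E} {f g : E → ℝ} {y : E}
    (hf : DifferentiableAt ℝ f y) (hg : DifferentiableAt ℝ g y) (m : ι) :
    coordDeriv b m (fun z => f z * g z) y =
      coordDeriv b m f y * g y + f y * coordDeriv b m g y := by
  rw [coordDeriv, (hf.hasFDerivAt.fun_mul hg.hasFDerivAt).fderiv]
  simp only [add_apply, smul_apply, smul_eq_mul, coordDeriv]
  ring

theorem coordDeriv_sum {ι κ : Type*} {b : Module.Basis ι ℝ E} {f : κ → E → ℝ} {s : Finset κ} {y : E}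
    (hf : ∀ l ∈ s, DifferentiableAt ℝ (f l) y) (m : ι) :
    coordDeriv b m (fun z => ∑ l ∈ s, f l z) y = ∑ l ∈ s, coordDeriv b m (f l) y := by
  rw [coordDeriv, (HasFDerivAt.fun_sum fun l hl => (hf l hl).hasFDerivAt).fderiv]
  simp only [sum_apply, coordDeriv]

/-- The inverse of the Gram matrix of a basis in terms of an orthonormal frame. -/
theorem gram_inv_eq {B : Bil E} {b : Module.Basis (Fin 2) ℝ E} {v n : E}
    (hspan : ∀ e, e = B e v • v + B e n • n) (i j : Fin 2) :
    (Matrix.of fun i j => B (b i) (b j))⁻¹ i j =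
      b.repr v i * b.repr v j + b.repr n i * b.repr n j := by
  have h1 : (Matrix.of fun i j => B (b i) (b j)) *
      (Matrix.of fun i j => b.repr v i * b.repr v j + b.repr n i * b.repr n j) = 1 := by
    ext i j
    rw [Matrix.mul_apply]
    have h2 : ∀ x, B (b i) x = ∑ k, b.repr x k * B (b i) (b k) := fun x => by
      conv_lhs => rw [← b.sum_repr x]
      simp only [map_sum, map_smul, smul_eq_mul]
    have h3 : b.repr (b i) j = B (b i) v * b.repr v j + B (b i) n * b.repr n j := by
      conv_lhs => rw [hspan (b i)]
      simp
    rw [Module.Basis.repr_self, Finsupp.single_apply] at h3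
    rw [Matrix.one_apply, h3, h2 v, h2 n, Finset.sum_mul, Finset.sum_mul, ← Finset.sum_add_distrib]
    refine Finset.sum_congr rfl fun k _ => ?_
    simp only [Matrix.of_apply]
    ring
  rw [Matrix.inv_eq_right_inv h1, Matrix.of_apply]

/-- The scalar curvature of a warped extension of a surface, in an orthonormal frame of the
surface. -/
theorem scalarCurvatureCoord_warpedMatrix {F : Type*} [NormedAddCommGroup F] [NormedSpace ℝ F]
    {b' : Module.Basis κ ℝ F} (hA : ContDiffOn ℝ ∞ A W)
    (hsymm : ∀ y x z, A y x z = A y z x)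
    (h : WarpedData (fun y => Matrix.of fun i j => A y (b i) (b j)) u W) {q : E × F}
    (hq : q.1 ∈ W) {v n : E} (hspan : ∀ e, e = A q.1 e v • v + A q.1 e n • n) :
    scalarCurvatureCoord (b.prod b')
        (warpedMatrix (fun y => Matrix.of fun i j => A y (b i) (b j)) u) q =
      2 * frameCurvature (fderiv ℝ A q.1) (fderiv ℝ (fderiv ℝ A) q.1) v n
        - 2 * ∑ a, frameLaplacian (fderiv ℝ A q.1) (fderiv ℝ (u a) q.1)
            (fderiv ℝ (fderiv ℝ (u a)) q.1) v n
        - ∑ a, (fderiv ℝ (u a) q.1 v ^ 2 + fderiv ℝ (u a) q.1 n ^ 2)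
        - ((∑ a, fderiv ℝ (u a) q.1 v) ^ 2 + (∑ a, fderiv ℝ (u a) q.1 n) ^ 2) := by
  set G : E → Matrix (Fin 2) (Fin 2) ℝ := fun y => Matrix.of fun i j => A y (b i) (b j) with hG
  have hAat : ∀ y ∈ W, ContDiffAt ℝ ∞ A y := fun y hy => hA.contDiffAt (h.isOpen.mem_nhds hy)
  have huat : ∀ a, ContDiffAt ℝ ∞ (u a) q.1 := fun a =>
    (h.smooth_log a).contDiffAt (h.isOpen.mem_nhds hq)
  have hWn := h.isOpen.mem_nhds hq
  have hD : ∀ y ∈ W, ∀ m x z, fderiv ℝ A y m x z = fderiv ℝ A y m z x := fun y hy m x z => by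
    rw [← fderiv_bil_const ((hAat y hy).differentiableAt (by simp)),
      ← fderiv_bil_const ((hAat y hy).differentiableAt (by simp))]
    simp only [hsymm _ x z]
  have hD₂ : ∀ m p x z, fderiv ℝ (fderiv ℝ A) q.1 m p x z = fderiv ℝ (fderiv ℝ A) q.1 m p z x :=
    fun m p x z => by
    rw [← fderiv_fderiv_bil_const (hAat _ hq), ← fderiv_fderiv_bil_const (hAat _ hq)]
    refine congrArg (fun L : E →L[ℝ] ℝ => L m) (Filter.EventuallyEq.fderiv_eq ?_)
    filter_upwards [hWn] with y hy using hD y hy p x z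
  -- Everything is expressed through the values at the point of the inverse matrix `g` and of the
  -- first and second derivatives `d`, `dd` of the metric, so that polynomial identities apply.
  let D := fderiv ℝ A q.1
  let D₂ := fderiv ℝ (fderiv ℝ A) q.1
  let g : Fin 2 → Fin 2 → ℝ := fun i j => (G q.1)⁻¹ i j
  let d : Fin 2 → Fin 2 → Fin 2 → ℝ := fun m i j => D (b m) (b i) (b j)
  let dd : Fin 2 → Fin 2 → Fin 2 → Fin 2 → ℝ := fun m p i j => D₂ (b m) (b p) (b i) (b j)
  have hg : ∀ i j, g i j = b.repr v i * b.repr v j + b.repr n i * b.repr n j :=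
    gram_inv_eq hspan
  have hcd : ∀ y ∈ W, ∀ m i j, coordDeriv b m (fun z => G z i j) y =
      fderiv ℝ A y (b m) (b i) (b j) := fun y hy m i j =>
    fderiv_bil_const ((hAat y hy).differentiableAt (by simp)) _ _ _
  have hcdd : ∀ m p i j, coordDeriv b m (coordDeriv b p (fun z => G z i j)) q.1 = dd m p i j := by
    intro m p i j
    rw [coordDeriv_congr (g := fun y => fderiv ℝ A y (b p) (b i) (b j))]
    · exact fderiv_fderiv_bil_const (hAat _ hq) _ _ _ _
    · filter_upwards [hWn] with y hy using hcd y hy p i j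
  have hcg : ∀ m k l, coordDeriv b m (fun z => (G z)⁻¹ k l) q.1 =
      -∑ r, ∑ p, g k p * d m p r * g r l := fun m k l => by
    rw [h.coordDeriv_inv hq]
    simp only [hcd _ hq]
    rfl
  have hchr : ∀ k i j, christoffel b G k i j q.1 = christoffelAlg g d k i j := fun k i j => by
    simp only [christoffel, hcd _ hq]
    rfl
  have hdiff : ∀ {f : E → ℝ}, ContDiffOn ℝ ∞ f W → DifferentiableAt ℝ f q.1 := fun hf =>
    h.differentiableAt hf hq
  have hdG : ∀ p i j, DifferentiableAt ℝ (coordDeriv b p (fun z => G z i j)) q.1 := fun p i j =>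
    hdiff (contDiffOn_coordDeriv h.isOpen (h.smooth i j) p)
  have hdchr : ∀ m k i j, coordDeriv b m (christoffel b G k i j) q.1 =
      derivChristoffelAlg g d dd m k i j := by
    intro m k i j
    have e1 : ∀ l, DifferentiableAt ℝ (fun y => coordDeriv b i (fun z => G z j l) y
        + coordDeriv b j (fun z => G z i l) y - coordDeriv b l (fun z => G z i j) y) q.1 := fun l =>
      ((hdG i j l).add (hdG j i l)).sub (hdG l i j)
    have e2 : ∀ l, coordDeriv b m (fun y => coordDeriv b i (fun z => G z j l) y
        + coordDeriv b j (fun z => G z i l) y - coordDeriv b l (fun z => G z i j) y) q.1 =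
        dd m i j l + dd m j i l - dd m l i j := fun l => by
      rw [← hcdd, ← hcdd, ← hcdd, coordDeriv,
        (((hdG i j l).hasFDerivAt.fun_add (hdG j i l).hasFDerivAt).fun_sub
          (hdG l i j).hasFDerivAt).fderiv]
      simp only [add_apply, sub_apply, coordDeriv]
    have e3 : ∀ l, DifferentiableAt ℝ (fun y => (G y)⁻¹ k l) q.1 := fun l =>
      hdiff (h.smooth_inv k l)
    have e4 := coordDeriv_mul (b := b) (f := fun _ => 1 / 2)
      (g := fun y => ∑ l, (G y)⁻¹ k l * (coordDeriv b i (fun z => G z j l) y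
        + coordDeriv b j (fun z => G z i l) y - coordDeriv b l (fun z => G z i j) y))
      (differentiableAt_const _) (DifferentiableAt.fun_sum fun l _ => (e3 l).fun_mul (e1 l)) m
    refine e4.trans ?_
    rw [coordDeriv_const, zero_mul, zero_add, coordDeriv_sum fun l _ => (e3 l).fun_mul (e1 l),
      derivChristoffelAlg]
    refine congrArg _ (Finset.sum_congr rfl fun l _ => ?_)
    rw [coordDeriv_mul (e3 l) (e1 l), e2, hcg]
    simp only [hcd _ hq]
    rfl
  have hscal : scalarCurvatureCoord b G q.1 = 2 * frameCurvature D D₂ v n := by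
    simp only [scalarCurvatureCoord, ricciCoord, hdchr, hchr]
    refine (scalar_curvature_identity hg (fun m => hD _ hq _ _ _) (fun m p => hD₂ _ _ _ _)
      fun i j => ?_).trans ?_
    · have h1 : D₂ (b 1) (b 0) = D₂ (b 0) (b 1) :=
        ((hAat _ hq).isSymmSndFDerivAt minSmoothness_two_le_infty).eq _ _
      simp only [dd, h1]
    · rw [frameCurvature, bil_sum_expand b D n v v, bil_sum_expand b D v n n,
        bil_sum_expand b D v v v, bil_sum_expand b D n v n, bil_sum_expand b D v v n,
        bil_sum_expand b D n n n, bil_sum_expand₂ b D₂ n n v v, bil_sum_expand₂ b D₂ v n v n,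
        bil_sum_expand₂ b D₂ v v n n]
  have hp : ∀ (L : E →L[ℝ] ℝ) (x : E), ∑ i, b.repr x i * L (b i) = L x := fun L x => by
    conv_rhs => rw [← b.sum_repr x]
    simp only [map_sum, map_smul, smul_eq_mul]
  have hpp : ∀ (L : E →L[ℝ] E →L[ℝ] ℝ) (x : E),
      ∑ i, ∑ j, b.repr x i * b.repr x j * L (b i) (b j) = L x x := fun L x => by
    conv_rhs => rw [basis_expand b x]
    simp only [Fin.sum_univ_two, map_add, map_smul, add_apply, smul_apply, smul_eq_mul]
    ring
  have hlap : ∀ a, laplacianAlg d (fun i => coordDeriv b i (u a) q.1)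
      (fun i j => coordDeriv b i (coordDeriv b j (u a)) q.1) (fun i => b.repr v i)
      (fun i => b.repr n i) = frameLaplacian D (fderiv ℝ (u a) q.1)
        (fderiv ℝ (fderiv ℝ (u a)) q.1) v n := fun a => by
    simp only [coordDeriv_coordDeriv (huat a), laplacianAlg, frameLaplacian]
    rw [← hp (fderiv ℝ (u a) q.1) v, ← hp (fderiv ℝ (u a) q.1) n, hpp, hpp,
      bil_sum_expand b D n v v, bil_sum_expand b D v n n, bil_sum_expand b D v v v,
      bil_sum_expand b D n v n, bil_sum_expand b D v v n, bil_sum_expand b D n n n]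
    rfl
  have htr : ∀ a, ∑ j, ∑ k, (G q.1)⁻¹ j k * (coordDeriv b j (coordDeriv b k (u a)) q.1
          + coordDeriv b j (u a) q.1 * coordDeriv b k (u a) q.1
          - ∑ p, christoffel b G p j k q.1 * coordDeriv b p (u a) q.1) =
      frameLaplacian D (fderiv ℝ (u a) q.1) (fderiv ℝ (fderiv ℝ (u a)) q.1) v n
        + fderiv ℝ (u a) q.1 v ^ 2 + fderiv ℝ (u a) q.1 n ^ 2 := fun a => by
    rw [← hlap, ← hp (fderiv ℝ (u a) q.1) v, ← hp (fderiv ℝ (u a) q.1) n]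
    simp only [hchr]
    exact trace_hessian_identity (p := fun i => coordDeriv b i (u a) q.1)
      (pp := fun i j => coordDeriv b i (coordDeriv b j (u a)) q.1) hg (fun m => hD _ hq _ _ _)
  have hgrad : ∀ a i, coordDeriv b i (coordGrad b G (u a) i) q.1 = ∑ l,
      ((-∑ r, ∑ p, g i p * d i p r * g r l) * coordDeriv b l (u a) q.1
        + g i l * coordDeriv b i (coordDeriv b l (u a)) q.1) := fun a i => by
    have e1 : ∀ l, DifferentiableAt ℝ (fun y => (G y)⁻¹ i l) q.1 := fun l =>
      hdiff (h.smooth_inv i l)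
    have e2 : ∀ l, DifferentiableAt ℝ (coordDeriv b l (u a)) q.1 := fun l =>
      hdiff (contDiffOn_coordDeriv h.isOpen (h.smooth_log a) l)
    refine (coordDeriv_sum (f := fun l y => (G y)⁻¹ i l * coordDeriv b l (u a) y)
      (fun l _ => (e1 l).fun_mul (e2 l)) i).trans (Finset.sum_congr rfl fun l _ => ?_)
    rw [coordDeriv_mul (e1 l) (e2 l), hcg]
  have hdiv : ∀ a, ∑ i, coordDeriv b i (coordGrad b G (u a) i) q.1
          + ∑ i, ∑ p, christoffel b G i i p q.1 * coordGrad b G (u a) p q.1 =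
      frameLaplacian D (fderiv ℝ (u a) q.1) (fderiv ℝ (fderiv ℝ (u a)) q.1) v n := fun a => by
    rw [← hlap]
    simp only [hchr, hgrad]
    refine divergence_identity (p := fun i => coordDeriv b i (u a) q.1)
      (pp := fun i j => coordDeriv b i (coordDeriv b j (u a)) q.1) hg (fun m => hD _ hq _ _ _) ?_
    rw [coordDeriv_coordDeriv (huat a), coordDeriv_coordDeriv (huat a)]
    exact ((huat a).isSymmSndFDerivAt minSmoothness_two_le_infty).eq _ _
  have hin : ∀ a c, ∑ p, coordDeriv b p (u c) q.1 * coordGrad b G (u a) p q.1 =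
      fderiv ℝ (u c) q.1 v * fderiv ℝ (u a) q.1 v + fderiv ℝ (u c) q.1 n * fderiv ℝ (u a) q.1 n := by
    intro a c
    have e1 : ∀ i j, (G q.1)⁻¹ i j = b.repr v i * b.repr v j + b.repr n i * b.repr n j := hg
    rw [← hp _ v, ← hp _ v, ← hp _ n, ← hp _ n]
    simp only [coordGrad, e1, Fin.sum_univ_two, coordDeriv]
    ring
  rw [h.scalarCurvature_eq hq, hscal]
  simp only [htr, hdiv, hin, Finset.sum_add_distrib, ← Finset.sum_mul, ← Finset.mul_sum]
  ring

end Surface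

/-! ### Conformal change of the curvature -/

section Conformal

variable {κ E : Type*} [NormedAddCommGroup E] [NormedSpace ℝ E]

set_option maxHeartbeats 1000000 in
/-- The Gauss curvature of a conformal metric `e^{2f} B`, algebraically; `r = e^{-f}`. -/
theorem frameCurvature_conformal {B : Bil E} {D D' : E →L[ℝ] Bil E}
    {D₂ D₂' : E →L[ℝ] E →L[ℝ] Bil E} {p : E →L[ℝ] ℝ} {pp : E →L[ℝ] E →L[ℝ] ℝ} {r : ℝ} (hr : r ≠ 0)
    (hD' : ∀ m x z, D' m x z = r⁻¹ ^ 2 * (2 * p m * B x z + D m x z))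
    (hD₂' : ∀ m q x z, D₂' m q x z = r⁻¹ ^ 2 * ((4 * p m * p q + 2 * pp m q) * B x z
      + 2 * p m * D q x z + 2 * p q * D m x z + D₂ m q x z))
    {v n : E} (hvv : B v v = 1) (hvn : B v n = 0) (hnn : B n n = 1) :
    frameCurvature D' D₂' (r • v) (r • n) =
      r ^ 2 * (frameCurvature D D₂ v n - frameLaplacian D p pp v n) := by
  simp only [frameCurvature, frameLaplacian, map_smul, Bil.smul_apply, smul_apply, smul_eq_mul,
    hD', hD₂', hvv, hvn, hnn]
  field_simp
  ring

variable [Fintype κ] [DecidableEq κ] {A : E → Bil E} {u : κ → E → ℝ} {W : Set E}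

/-- The derivative of a conformally changed metric. -/
theorem fderiv_conformal {f : E → ℝ} {y : E} (hA : ContDiffAt ℝ ∞ A y) (hf : ContDiffAt ℝ ∞ f y)
    (m x z : E) : fderiv ℝ (fun y => Real.exp (2 * f y) • A y) y m x z =
      Real.exp (2 * f y) * (2 * fderiv ℝ f y m * A y x z + fderiv ℝ A y m x z) := by
  have hAd := hA.differentiableAt (by simp)
  have hfd := hf.differentiableAt (by simp)
  have he : HasFDerivAt (fun y => Real.exp (2 * f y))
      (Real.exp (2 * f y) • (2 : ℝ) • fderiv ℝ f y) y := (hfd.hasFDerivAt.const_mul 2).exp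
  have h := (he.fun_smul hAd.hasFDerivAt).fderiv
  rw [h]
  simp only [add_apply, smul_apply, ContinuousLinearMap.smulRight_apply, Bil.add_apply,
    Bil.smul_apply, smul_eq_mul]
  ring

theorem contDiffAt_conformal {f : E → ℝ} {y : E} (hA : ContDiffAt ℝ ∞ A y)
    (hf : ContDiffAt ℝ ∞ f y) : ContDiffAt ℝ ∞ (fun y => Real.exp (2 * f y) • A y) y :=
  (contDiffAt_const.mul hf).exp.smul hA

/-- The second derivative of a conformally changed metric. -/
theorem fderiv_fderiv_conformal {f : E → ℝ} {y : E} (hA : ContDiffOn ℝ ∞ A W)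
    (hf : ContDiffOn ℝ ∞ f W) (hW : IsOpen W) (hy : y ∈ W) (m q x z : E) :
    fderiv ℝ (fderiv ℝ (fun y => Real.exp (2 * f y) • A y)) y m q x z =
      Real.exp (2 * f y) * ((4 * fderiv ℝ f y m * fderiv ℝ f y q
          + 2 * fderiv ℝ (fderiv ℝ f) y m q) * A y x z
        + 2 * fderiv ℝ f y m * fderiv ℝ A y q x z + 2 * fderiv ℝ f y q * fderiv ℝ A y m x z
        + fderiv ℝ (fderiv ℝ A) y m q x z) := by
  have hAat : ∀ y ∈ W, ContDiffAt ℝ ∞ A y := fun y hy => hA.contDiffAt (hW.mem_nhds hy)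
  have hfat : ∀ y ∈ W, ContDiffAt ℝ ∞ f y := fun y hy => hf.contDiffAt (hW.mem_nhds hy)
  rw [← fderiv_fderiv_bil_const (contDiffAt_conformal (hAat y hy) (hfat y hy))]
  have hev : (fun y' => fderiv ℝ (fun y => Real.exp (2 * f y) • A y) y' q x z) =ᶠ[𝓝 y] fun y =>
      Real.exp (2 * f y) * (2 * fderiv ℝ f y q * A y x z + fderiv ℝ A y q x z) := by
    filter_upwards [hW.mem_nhds hy] with y' hy'
      using fderiv_conformal (hAat y' hy') (hfat y' hy') q x z
  rw [hev.fderiv_eq]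
  have hAd := (hAat y hy).differentiableAt (by simp)
  have hfd := (hfat y hy).differentiableAt (by simp)
  have e1 : HasFDerivAt (fun y => Real.exp (2 * f y))
      (Real.exp (2 * f y) • (2 : ℝ) • fderiv ℝ f y) y := (hfd.hasFDerivAt.const_mul 2).exp
  have d2 : DifferentiableAt ℝ (fderiv ℝ f) y :=
    ((hfat y hy).fderiv_right (m := ∞) (by simp)).differentiableAt (by simp)
  have e2 : HasFDerivAt (fun y => fderiv ℝ f y q) ((fderiv ℝ (fderiv ℝ f) y).flip q) y := by
    refine (d2.hasFDerivAt.clm_apply (hasFDerivAt_const q y)).congr_fderiv ?_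
    ext m
    simp
  have dA : DifferentiableAt ℝ (fun y => A y x z) y := by
    have h2 : DifferentiableAt ℝ (F := E →L[ℝ] E →L[ℝ] ℝ) A y := hAd
    exact (DifferentiableAt.clm_apply (H := E →L[ℝ] ℝ) h2 (differentiableAt_const x)).clm_apply
      (differentiableAt_const z)
  have dA' : DifferentiableAt ℝ (fun y => fderiv ℝ A y q x z) y := by
    have h1 : DifferentiableAt ℝ (fderiv ℝ A) y :=
      ((hAat y hy).fderiv_right (m := ∞) (by simp)).differentiableAt (by simp)
    have h2 : DifferentiableAt ℝ (F := E →L[ℝ] E →L[ℝ] ℝ) (fun y => fderiv ℝ A y q) y :=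
      h1.clm_apply (differentiableAt_const q)
    exact (DifferentiableAt.clm_apply (H := E →L[ℝ] ℝ) h2 (differentiableAt_const x)).clm_apply
      (differentiableAt_const z)
  have e3 := dA.hasFDerivAt
  have e4 := dA'.hasFDerivAt
  rw [(e1.fun_mul (((e2.const_mul 2).fun_mul e3).fun_add e4)).fderiv]
  simp only [add_apply, smul_apply, smul_eq_mul, ContinuousLinearMap.flip_apply,
    fderiv_bil_const hAd, fderiv_fderiv_bil_const (hAat y hy)]
  ring

/-- The scalar curvature of the warped extension of a surface in terms of the Gauss curvature of
the metric `e^{2f} A`, where `f` is the sum of the logarithms of the warping functions, and of an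
orthonormal frame of this metric. -/
theorem scalarCurvatureCoord_warpedMatrix_conformal {F : Type*} [NormedAddCommGroup F]
    [NormedSpace ℝ F] {b : Module.Basis (Fin 2) ℝ E} {b' : Module.Basis κ ℝ F}
    (hA : ContDiffOn ℝ ∞ A W) (hsymm : ∀ y x z, A y x z = A y z x)
    (h : WarpedData (fun y => Matrix.of fun i j => A y (b i) (b j)) u W) {q : E × F}
    (hq : q.1 ∈ W) {f : E → ℝ} (hf : ∀ y, f y = ∑ a, u a y) {B : E → Bil E}
    (hB : ∀ y, B y = Real.exp (2 * f y) • A y) {v n : E}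
    (hvv : B q.1 v v = 1) (hvn : B q.1 v n = 0) (hnn : B q.1 n n = 1)
    (hspan : ∀ e, e = B q.1 e v • v + B q.1 e n • n) :
    scalarCurvatureCoord (b.prod b')
        (warpedMatrix (fun y => Matrix.of fun i j => A y (b i) (b j)) u) q =
      Real.exp (2 * f q.1) * (2 * frameCurvature (fderiv ℝ B q.1) (fderiv ℝ (fderiv ℝ B) q.1) v n
        - ∑ a, (fderiv ℝ (u a) q.1 v ^ 2 + fderiv ℝ (u a) q.1 n ^ 2)
        - (fderiv ℝ f q.1 v ^ 2 + fderiv ℝ f q.1 n ^ 2)) := by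
  obtain rfl : B = fun y => Real.exp (2 * f y) • A y := funext hB
  have hfeq : f = fun y => ∑ a, u a y := funext hf
  have hfs : ContDiffOn ℝ ∞ f W := by
    rw [hfeq]; exact ContDiffOn.sum fun a _ => h.smooth_log a
  have hAat : ContDiffAt ℝ ∞ A q.1 := hA.contDiffAt (h.isOpen.mem_nhds hq)
  have hfat : ContDiffAt ℝ ∞ f q.1 := hfs.contDiffAt (h.isOpen.mem_nhds hq)
  have huat : ∀ y ∈ W, ∀ a, ContDiffAt ℝ ∞ (u a) y := fun y hy a =>
    (h.smooth_log a).contDiffAt (h.isOpen.mem_nhds hy)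
  have hdf : ∀ y ∈ W, fderiv ℝ f y = ∑ a, fderiv ℝ (u a) y := fun y hy => by
    rw [hfeq]
    exact (HasFDerivAt.fun_sum fun a _ =>
      ((huat y hy a).differentiableAt (by simp)).hasFDerivAt).fderiv
  have hddf : fderiv ℝ (fderiv ℝ f) q.1 = ∑ a, fderiv ℝ (fderiv ℝ (u a)) q.1 := by
    have h1 : fderiv ℝ f =ᶠ[𝓝 q.1] fun y => ∑ a, fderiv ℝ (u a) y := by
      filter_upwards [h.isOpen.mem_nhds hq] with y hy using hdf y hy
    rw [h1.fderiv_eq]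
    exact (HasFDerivAt.fun_sum fun a _ => (((huat _ hq a).fderiv_right (m := ∞)
      (by simp)).differentiableAt (by simp)).hasFDerivAt).fderiv
  set s := Real.exp (f q.1) with hs
  have hs0 : s ≠ 0 := (Real.exp_pos _).ne'
  have hs2 : Real.exp (2 * f q.1) = s ^ 2 := by rw [hs, ← Real.exp_nat_mul]; norm_num
  simp only [Bil.smul_apply, smul_apply, smul_eq_mul, hs2] at hvv hvn hnn hspan
  have hvn' : A q.1 v n = 0 := by
    rcases mul_eq_zero.1 hvn with h1 | h1
    · exact absurd h1 (pow_ne_zero 2 hs0)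
    · exact h1
  have hspan' : ∀ e, e = A q.1 e (s • v) • (s • v) + A q.1 e (s • n) • (s • n) := fun e => by
    refine (hspan e).trans ?_
    simp only [map_smul, smul_eq_mul, smul_smul]
    congr 2 <;> ring
  -- If `v`, `n` are orthonormal for `B = s² A`, then `s v`, `s n` are orthonormal for `A`. The
  -- conformal change of the curvature produces the Laplacian of `f`, which cancels the Laplacians of
  -- the `u a` in the scalar curvature.
  have hK := frameCurvature_conformal (B := A q.1) (D := fderiv ℝ A q.1)
    (D₂ := fderiv ℝ (fderiv ℝ A) q.1) (p := fderiv ℝ f q.1) (pp := fderiv ℝ (fderiv ℝ f) q.1)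
    (D' := fderiv ℝ (fun y => Real.exp (2 * f y) • A y) q.1)
    (D₂' := fderiv ℝ (fderiv ℝ (fun y => Real.exp (2 * f y) • A y)) q.1)
    (r := s⁻¹) (inv_ne_zero hs0) (v := s • v) (n := s • n)
    (fun m x z => by rw [inv_inv, ← hs2]; exact fderiv_conformal hAat hfat m x z)
    (fun m r x z => by
      rw [inv_inv, ← hs2]
      exact fderiv_fderiv_conformal hA hfs h.isOpen hq m r x z)
    (by
      simp only [map_smul, smul_apply, smul_eq_mul]
      rw [← mul_assoc, ← pow_two]; exact hvv)
    (by simp only [map_smul, smul_apply, smul_eq_mul, hvn', mul_zero])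
    (by
      simp only [map_smul, smul_apply, smul_eq_mul]
      rw [← mul_assoc, ← pow_two]; exact hnn)
  rw [smul_smul, smul_smul, inv_mul_cancel₀ hs0, one_smul, one_smul] at hK
  have hlap : frameLaplacian (fderiv ℝ A q.1) (fderiv ℝ f q.1) (fderiv ℝ (fderiv ℝ f) q.1)
      (s • v) (s • n) = ∑ a, frameLaplacian (fderiv ℝ A q.1) (fderiv ℝ (u a) q.1)
        (fderiv ℝ (fderiv ℝ (u a)) q.1) (s • v) (s • n) := by
    simp only [frameLaplacian, hdf _ hq, hddf, sum_apply, Finset.sum_add_distrib,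
      Finset.sum_sub_distrib, Finset.sum_mul]
  rw [scalarCurvatureCoord_warpedMatrix hA hsymm h hq hspan', hK, hlap, hs2, hdf _ hq]
  simp only [map_smul, smul_eq_mul, sum_apply, mul_pow, Finset.sum_add_distrib, ← Finset.mul_sum]
  field_simp

end Conformal

/-! ### Conformal metrics and charts of warped extensions -/

section ConformalMetric

variable {E H M : Type*} [NormedAddCommGroup E] [NormedSpace ℝ E]
  [TopologicalSpace H] [TopologicalSpace M] [ChartedSpace H M]
  {I : ModelWithCorners ℝ E H} [IsManifold I ∞ M]

set_option synthInstance.maxHeartbeats 200000 in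
/-- The conformal metric `e^{2f} g`. -/
def conformalMetric (g : ContMDiffRiemannianMetric I ∞ E (fun x : M => TangentSpace I x))
    (f : M → ℝ) (hf : ContMDiff I 𝓘(ℝ, ℝ) ∞ f) :
    ContMDiffRiemannianMetric I ∞ E (fun x : M => TangentSpace I x) where
  inner x := Real.exp (2 * f x) • g.inner x
  symm x v w := congrArg (fun r => Real.exp (2 * f x) * r) (g.symm x v w)
  pos x v hv := mul_pos (Real.exp_pos _) (g.pos x v hv)
  isVonNBounded x := by
    change IsVonNBounded ℝ {v : E | Real.exp (2 * f x) * g.inner x v v < 1}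
    have hA : IsVonNBounded ℝ {v : E | g.inner x v v < 1} := g.isVonNBounded x
    obtain ⟨C, hC⟩ := (NormedSpace.isVonNBounded_iff' ℝ).1 hA
    refine (NormedSpace.isVonNBounded_iff' ℝ).2 ⟨C / Real.exp (f x), fun v hv => ?_⟩
    have hv : Real.exp (2 * f x) * g.inner x v v < 1 := hv
    let B : E →L[ℝ] E →L[ℝ] ℝ := g.inner x
    have h1 : B (Real.exp (f x) • v) (Real.exp (f x) • v) = Real.exp (2 * f x) * B v v := by
      simp only [map_smul, smul_apply, smul_eq_mul]
      rw [← mul_assoc, ← Real.exp_add, two_mul]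
    have h2 : ‖Real.exp (f x) • v‖ ≤ C := hC (Real.exp (f x) • v) (h1.trans_lt hv)
    rw [norm_smul, Real.norm_of_nonneg (Real.exp_pos _).le] at h2
    rw [le_div_iff₀ (Real.exp_pos _)]
    linarith
  contMDiff := by
    have h1 : ContMDiff I 𝓘(ℝ, ℝ) ∞ (fun x => Real.exp (2 * f x)) :=
      (Real.contDiff_exp.comp (contDiff_const.mul contDiff_id)).contMDiff.comp hf
    exact h1.smul_section g.contMDiff

variable (g : ContMDiffRiemannianMetric I ∞ E (fun x : M => TangentSpace I x))

variable [I.Boundaryless] [FiniteDimensional ℝ E] [T2Space M] [CompactSpace M]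
  [PreconnectedSpace M]

/-- The coordinate expression of a Riemannian metric as a field of bilinear forms, in the type for
which the calculus of local metrics is set up. -/
def chartBil (x₀ : M) : E → Bil E := chartForm g x₀

/-- In a chart, the Riemannian distance is a local metric. -/
theorem isLocalMetric_chart (x₀ : M) : IsLocalMetric (extChartAt I x₀).target (chartBil g x₀)
    (fun y z => rdist g ((extChartAt I x₀).symm y) ((extChartAt I x₀).symm z)) where
  isOpen := isOpen_extChartAt_target x₀
  smooth := contDiffOn_chartForm g x₀
  symm := chartForm_symm g x₀
  pos _ hy _ hv := chartForm_pos g hy hv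
  self _ := rdist_self g _
  comm _ _ := rdist_comm g _ _
  triangle _ _ _ := rdist_triangle g _ _ _
  upper y hy ε hε := by
    filter_upwards [eventually_riemDist_le g hy hε] with p hp
    rw [← ofReal_rdist] at hp
    exact (ENNReal.ofReal_le_ofReal_iff (by positivity)).1 hp
  lower y hy l C₀ C hC₀ hC hl := by
    filter_upwards [eventually_linear_le_riemDist g hy l hC hC₀ hl] with p hp
    rw [← ofReal_rdist, ← ENNReal.ofReal_mul (hC₀.trans hC.le)] at hp
    exact (ENNReal.ofReal_le_ofReal_iff
      (mul_nonneg (hC₀.trans hC.le) (rdist_nonneg g _ _))).1 hp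

end ConformalMetric

section ScalarCurvature

variable {ι κ E F : Type*} [NormedAddCommGroup E] [NormedSpace ℝ E] [NormedAddCommGroup F]
  [NormedSpace ℝ F] [Fintype ι] [DecidableEq ι]

theorem christoffel_congr {b : Module.Basis ι ℝ E} {G G' : E → Matrix ι ι ℝ} {y : E}
    (h : G =ᶠ[𝓝 y] G') (k i j : ι) : christoffel b G k i j =ᶠ[𝓝 y] christoffel b G' k i j := by
  filter_upwards [eventually_eventually_nhds.2 h] with z hz
  have h1 : ∀ m i j, coordDeriv b m (fun z => G z i j) z = coordDeriv b m (fun z => G' z i j) z :=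
    fun m i j => coordDeriv_congr (by filter_upwards [hz] with w hw using by rw [hw]) m
  simp only [christoffel, h1, hz.self_of_nhds]

theorem scalarCurvatureCoord_congr {b : Module.Basis ι ℝ E} {G G' : E → Matrix ι ι ℝ} {y : E}
    (h : G =ᶠ[𝓝 y] G') : scalarCurvatureCoord b G y = scalarCurvatureCoord b G' y := by
  have h1 : ∀ m k i j, coordDeriv b m (christoffel b G k i j) y =
      coordDeriv b m (christoffel b G' k i j) y := fun m k i j =>
    coordDeriv_congr (christoffel_congr h k i j) m
  have h2 : ∀ k i j, christoffel b G k i j y = christoffel b G' k i j y := fun k i j =>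
    (christoffel_congr h k i j).self_of_nhds
  simp only [scalarCurvatureCoord, ricciCoord, h1, h2, h.self_of_nhds]

variable [Fintype κ] [DecidableEq κ] {G : E → Matrix ι ι ℝ} {u : κ → E → ℝ} {W : Set E}
  {b : Module.Basis ι ℝ E} {b' : Module.Basis κ ℝ F}

/-- The scalar curvature of a warped metric is continuous. The scalar curvature of a manifold is
evaluated at the centre of each chart only; continuity carries bounds to nearby points. -/
theorem WarpedData.continuousOn_scalarCurvature (h : WarpedData G u W) (z : F) :
    ContinuousOn (fun y => scalarCurvatureCoord (b.prod b') (warpedMatrix G u) (y, z)) W := by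
  have c1 : ∀ k i j, ContDiffOn ℝ ∞ (christoffel b G k i j) W := h.contDiffOn_christoffel
  have c2 : ∀ m k i j, ContinuousOn (coordDeriv b m (christoffel b G k i j)) W := fun m k i j =>
    (contDiffOn_coordDeriv h.isOpen (c1 k i j) m).continuousOn
  have c3 : ∀ k i j, ContinuousOn (christoffel b G k i j) W := fun k i j => (c1 k i j).continuousOn
  have c4 : ∀ i j, ContinuousOn (fun y => (G y)⁻¹ i j) W := fun i j => (h.smooth_inv i j).continuousOn
  have c5 : ∀ a i, ContDiffOn ℝ ∞ (coordDeriv b i (u a)) W := fun a i =>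
    contDiffOn_coordDeriv h.isOpen (h.smooth_log a) i
  have c6 : ∀ a i, ContinuousOn (coordDeriv b i (u a)) W := fun a i => (c5 a i).continuousOn
  have c7 : ∀ a i j, ContinuousOn (coordDeriv b i (coordDeriv b j (u a))) W := fun a i j =>
    (contDiffOn_coordDeriv h.isOpen (c5 a j) i).continuousOn
  have c8 : ∀ a i, ContinuousOn (coordGrad b G (u a) i) W := fun a i =>
    (h.contDiffOn_coordGrad a i).continuousOn
  have c9 : ∀ a m i, ContinuousOn (coordDeriv b m (coordGrad b G (u a) i)) W := fun a m i =>
    (contDiffOn_coordDeriv h.isOpen (h.contDiffOn_coordGrad a i) m).continuousOn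
  have c10 : ContinuousOn (scalarCurvatureCoord b G) W := by
    refine continuousOn_finsetSum _ fun j _ => continuousOn_finsetSum _ fun k _ => (c4 j k).mul ?_
    refine (continuousOn_finsetSum _ fun i _ => (c2 i i j k).sub (c2 j i i k)).add ?_
    exact continuousOn_finsetSum _ fun i _ => continuousOn_finsetSum _ fun p _ =>
      ((c3 i i p).mul (c3 p j k)).sub ((c3 i j p).mul (c3 p i k))
  refine ContinuousOn.congr (f := fun y => scalarCurvatureCoord b G y
        - ∑ a, ∑ j, ∑ k, (G y)⁻¹ j k * (coordDeriv b j (coordDeriv b k (u a)) y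
          + coordDeriv b j (u a) y * coordDeriv b k (u a) y
          - ∑ p, christoffel b G p j k y * coordDeriv b p (u a) y)
        - ∑ a, (∑ i, coordDeriv b i (coordGrad b G (u a) i) y
          + ∑ i, ∑ p, christoffel b G i i p y * coordGrad b G (u a) p y
          + ∑ c, ∑ p, coordDeriv b p (u c) y * coordGrad b G (u a) p y)) ?_
    fun y hy => h.scalarCurvature_eq (q := (y, z)) hy
  refine (c10.sub (continuousOn_finsetSum _ fun a _ => continuousOn_finsetSum _ fun j _ =>
    continuousOn_finsetSum _ fun k _ => (c4 j k).mul (((c7 a j k).add ((c6 a j).mul (c6 a k))).sub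
      (continuousOn_finsetSum _ fun p _ => (c3 p j k).mul (c6 a p))))).sub
    (continuousOn_finsetSum _ fun a _ => ?_)
  exact ((continuousOn_finsetSum _ fun i _ => c9 a i i).add
    (continuousOn_finsetSum _ fun i _ => continuousOn_finsetSum _ fun p _ =>
      (c3 i i p).mul (c8 a p))).add (continuousOn_finsetSum _ fun c _ =>
        continuousOn_finsetSum _ fun p _ => (c6 c p).mul (c8 a p))

end ScalarCurvature

section WarpedChart

variable {E H M : Type*} [NormedAddCommGroup E] [NormedSpace ℝ E]
  [TopologicalSpace H] [TopologicalSpace M] [ChartedSpace H M]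
  {I : ModelWithCorners ℝ E H} [IsManifold I ∞ M] [I.Boundaryless]
  (g : ContMDiffRiemannianMetric I ∞ E (fun x : M => TangentSpace I x))

theorem mfderiv_extChartAt_prod_symm {F : Type*} [NormedAddCommGroup F] [NormedSpace ℝ F]
    (p : M × F) {q : E × F} (hq : q.1 ∈ (extChartAt I p.1).target) (v : E × F) :
    mfderiv 𝓘(ℝ, E × F) (I.prod 𝓘(ℝ, F)) (extChartAt (I.prod 𝓘(ℝ, F)) p).symm q v =
      (mfderiv 𝓘(ℝ, E) I (extChartAt I p.1).symm q.1 v.1, v.2) := by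
  have hfun : ((extChartAt (I.prod 𝓘(ℝ, F)) p).symm : E × F → M × F) =
      Prod.map (extChartAt I p.1).symm id := by
    rw [extChartAt_prod]; ext z <;> simp [chartAt_self_eq]
  rw [hfun, modelWithCornersSelf_prod, ← chartedSpaceSelf_prod]
  have h1 := mfderiv_prodMap (I := 𝓘(ℝ, E)) (I' := 𝓘(ℝ, F)) (J := I) (J' := 𝓘(ℝ, F)) (p := q)
    (f := (extChartAt I p.1).symm) (g := (id : F → F))
    ((contMDiffAt_extChartAt_symm hq).mdifferentiableAt (by simp)) mdifferentiableAt_id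
  refine (DFunLike.congr_fun h1 v).trans ?_
  refine Prod.ext rfl ?_
  change mfderiv 𝓘(ℝ, F) 𝓘(ℝ, F) (id : F → F) q.2 v.2 = v.2
  rw [mfderiv_id]
  rfl

/-- In the product chart, the warped extension is a warped metric with exponents `log φ_a`. -/
theorem metricInChart_warpedExtension {N : ℕ} (φ : Fin N → M → ℝ)
    (hφ : ∀ i, ContMDiff I 𝓘(ℝ, ℝ) ∞ (φ i)) (hpos : ∀ i x, 0 < φ i x) {ι : Type*}
    (b : Module.Basis ι ℝ E) (p : M × EuclideanSpace ℝ (Fin N)) {q : E × EuclideanSpace ℝ (Fin N)}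
    (hq : q.1 ∈ (extChartAt I p.1).target) :
    metricInChart (warpedExtension g φ hφ hpos)
      (b.prod (EuclideanSpace.basisFun (Fin N) ℝ).toBasis) p q =
      warpedMatrix (fun y => Matrix.of fun i j => chartBil g p.1 y (b i) (b j))
        (fun a y => Real.log (φ a ((extChartAt I p.1).symm y))) q := by
  have hfun : (extChartAt (I.prod (𝓡 N)) p).symm q = ((extChartAt I p.1).symm q.1, q.2) := by
    rw [extChartAt_prod]; simp [chartAt_self_eq]
  have key : ∀ v w : E × EuclideanSpace ℝ (Fin N),
      (warpedExtension g φ hφ hpos).inner ((extChartAt (I.prod (𝓡 N)) p).symm q)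
        (mfderiv 𝓘(ℝ, E × EuclideanSpace ℝ (Fin N)) (I.prod (𝓡 N))
          (extChartAt (I.prod (𝓡 N)) p).symm q v)
        (mfderiv 𝓘(ℝ, E × EuclideanSpace ℝ (Fin N)) (I.prod (𝓡 N))
          (extChartAt (I.prod (𝓡 N)) p).symm q w) =
      chartBil g p.1 q.1 v.1 w.1
        + ∑ i, φ i ((extChartAt I p.1).symm q.1) ^ 2 * (v.2 i * w.2 i) := by
    intro v w
    have h1 := warpedForm_apply g φ ((extChartAt I p.1).symm q.1, q.2)
      (mfderiv 𝓘(ℝ, E) I (extChartAt I p.1).symm q.1 v.1, v.2)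
      (mfderiv 𝓘(ℝ, E) I (extChartAt I p.1).symm q.1 w.1, w.2)
    refine Eq.trans ?_ h1
    have h2 := mfderiv_extChartAt_prod_symm p hq v
    have h3 := mfderiv_extChartAt_prod_symm p hq w
    have h4 : ∀ (r r' : M × EuclideanSpace ℝ (Fin N)) (x x' z z' : E × EuclideanSpace ℝ (Fin N)),
        r = r' → x = x' → z = z' → warpedForm g φ r x z = warpedForm g φ r' x' z' := by
      rintro r _ x _ z _ rfl rfl rfl; rfl
    exact h4 _ _ _ _ _ _ hfun h2 h3
  have hexp : ∀ a, Real.exp (2 * Real.log (φ a ((extChartAt I p.1).symm q.1))) =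
      φ a ((extChartAt I p.1).symm q.1) ^ 2 := fun a => by
    rw [mul_comm, Real.exp_mul, Real.exp_log (hpos _ _)]
    norm_num
  ext i j
  refine (key _ _).trans ?_
  rcases i with i | i <;> rcases j with j | j
  · simp [warpedMatrix]
  · simp [warpedMatrix]
  · simp [warpedMatrix]
  · simp only [warpedMatrix, Matrix.fromBlocks_apply₂₂, Matrix.diagonal_apply, hexp]
    by_cases h : i = j
    · subst h; simp
    · simp [h, Ne.symm h]

end WarpedChart

/-! ### Orthonormal frames and geodesic jets -/

section Frame

variable {E : Type*} [NormedAddCommGroup E] [NormedSpace ℝ E]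

/-- The Gram determinant of a basis. -/
def gramDet (b : Module.Basis (Fin 2) ℝ E) (B : Bil E) : ℝ :=
  B (b 0) (b 0) * B (b 1) (b 1) - B (b 0) (b 1) ^ 2

/-- The rotation of `v` by a right angle, for the scalar product `B`. -/
def unitNormal (b : Module.Basis (Fin 2) ℝ E) (B : Bil E) (v : E) : E :=
  (√(gramDet b B))⁻¹ • (-B v (b 1) • b 0 + B v (b 0) • b 1)

theorem gramDet_pos (b : Module.Basis (Fin 2) ℝ E) {B : Bil E} (hs : ∀ x y, B x y = B y x)
    (hB : ∀ v, v ≠ 0 → 0 < B v v) : 0 < gramDet b B := by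
  have h0 := hB (b 0) (b.ne_zero 0)
  have hne : B (b 0) (b 0) • b 1 - B (b 0) (b 1) • b 0 ≠ 0 := by
    intro h
    have h1 := congrArg (fun x => b.repr x 1) h
    simp at h1
    exact h0.ne' h1
  have h1 := hB _ hne
  simp only [map_sub, map_smul, sub_apply, smul_apply, smul_eq_mul, hs (b 1) (b 0)] at h1
  rw [gramDet]
  have h2 : 0 < B (b 0) (b 0) * (B (b 0) (b 0) * B (b 1) (b 1) - B (b 0) (b 1) ^ 2) := by
    nlinarith
  exact (mul_pos_iff_of_pos_left h0).1 h2

theorem unitNormal_orth (b : Module.Basis (Fin 2) ℝ E) (B : Bil E) (v : E) :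
    B v (unitNormal b B v) = 0 := by
  simp only [unitNormal, map_add, map_smul, smul_eq_mul]
  ring

theorem inv_sqrt_gramDet_mul (b : Module.Basis (Fin 2) ℝ E) {B : Bil E}
    (hs : ∀ x y, B x y = B y x) (hB : ∀ v, v ≠ 0 → 0 < B v v) :
    (√(gramDet b B))⁻¹ * (√(gramDet b B))⁻¹ * gramDet b B = 1 := by
  have h1 := gramDet_pos b hs hB
  rw [← mul_inv, Real.mul_self_sqrt h1.le, inv_mul_cancel₀ h1.ne']

theorem unitNormal_self (b : Module.Basis (Fin 2) ℝ E) {B : Bil E} (hs : ∀ x y, B x y = B y x)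
    (hB : ∀ v, v ≠ 0 → 0 < B v v) {v : E} (hv : B v v = 1) :
    B (unitNormal b B v) (unitNormal b B v) = 1 := by
  have h1 := inv_sqrt_gramDet_mul b hs hB
  have hx := basis_expand b v
  set x := b.repr v 0
  set y := b.repr v 1
  have e0 : B v (b 0) = x * B (b 0) (b 0) + y * B (b 0) (b 1) := by
    rw [hx]
    simp only [map_add, map_smul, add_apply, smul_apply, smul_eq_mul, hs (b 1) (b 0)]
  have e1 : B v (b 1) = x * B (b 0) (b 1) + y * B (b 1) (b 1) := by
    rw [hx]
    simp only [map_add, map_smul, add_apply, smul_apply, smul_eq_mul]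
  have e2 : x * B v (b 0) + y * B v (b 1) = 1 := by
    have h2 := congrArg (B v) hx
    simp only [map_add, map_smul, smul_eq_mul] at h2
    rw [← h2, hv]
  simp only [unitNormal, map_add, map_smul, add_apply, smul_apply, smul_eq_mul, map_neg,
    neg_smul, neg_apply, hs (b 1) (b 0)]
  generalize (√(gramDet b B))⁻¹ = r at h1 ⊢
  rw [e0, e1] at e2 ⊢
  rw [gramDet] at h1
  linear_combination (r * r * (B (b 0) (b 0) * B (b 1) (b 1) - B (b 0) (b 1) ^ 2)) * e2 + h1

/-- The frame formed by a unit vector and its unit normal is an orthonormal basis. -/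
theorem unitNormal_span (b : Module.Basis (Fin 2) ℝ E) {B : Bil E} (hs : ∀ x y, B x y = B y x)
    (hB : ∀ v, v ≠ 0 → 0 < B v v) {v : E} (hv : B v v = 1) (e : E) :
    e = B e v • v + B e (unitNormal b B v) • unitNormal b B v := by
  have h1 := inv_sqrt_gramDet_mul b hs hB
  set e' := e - (B e v • v + B e (unitNormal b B v) • unitNormal b B v) with he'
  have hn := unitNormal_self b hs hB hv
  have hvn := unitNormal_orth b B v
  set n := unitNormal b B v with hnd
  have o1 : B e' v = 0 := by
    rw [he']
    simp only [map_sub, map_add, map_smul, sub_apply, add_apply, smul_apply, smul_eq_mul, hv,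
      (hs n v).trans hvn]
    ring
  have o2 : B e' n = 0 := by
    rw [he']
    simp only [map_sub, map_add, map_smul, sub_apply, add_apply, smul_apply, smul_eq_mul, hn, hvn]
    ring
  -- a vector orthogonal to the frame vanishes
  have h2 : -B v (b 1) * B e' (b 0) + B v (b 0) * B e' (b 1) = 0 := by
    rw [hnd, unitNormal] at o2
    simp only [map_add, map_smul, smul_eq_mul] at o2
    rcases mul_eq_zero.1 o2 with h3 | h3
    · rw [h3] at h1; simp at h1
    · exact h3
  have hx := basis_expand b v
  have hz := basis_expand b e'
  set x := b.repr v 0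
  set y := b.repr v 1
  have e2 : x * B v (b 0) + y * B v (b 1) = 1 := by
    have h2 := congrArg (B v) hx
    simp only [map_add, map_smul, smul_eq_mul] at h2
    rw [← h2, hv]
  have e3 : x * B e' (b 0) + y * B e' (b 1) = 0 := by
    have h2 := congrArg (B e') hx
    simp only [map_add, map_smul, smul_eq_mul] at h2
    rw [← h2, o1]
  have z0 : B e' (b 0) = 0 := by linear_combination B v (b 0) * e3 - B e' (b 0) * e2 - y * h2
  have z1 : B e' (b 1) = 0 := by linear_combination B v (b 1) * e3 - B e' (b 1) * e2 + x * h2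
  have h3 : e' = 0 := by
    by_contra hne
    refine (hB e' hne).ne' ?_
    refine (congrArg (B e') hz).trans ?_
    simp only [map_add, map_smul, smul_eq_mul, z0, z1]
    ring
  exact sub_eq_zero.1 h3

theorem contDiffOn_unitNormal (b : Module.Basis (Fin 2) ℝ E) {B : ℝ → Bil E} {v : ℝ → E} {J : Set ℝ}
    (hBs : ContDiffOn ℝ 1 B J) (hv : ContDiffOn ℝ 1 v J) (hs : ∀ τ ∈ J, ∀ x y, B τ x y = B τ y x)
    (hB : ∀ τ ∈ J, ∀ v, v ≠ 0 → 0 < B τ v v) :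
    ContDiffOn ℝ 1 (fun τ => unitNormal b (B τ) (v τ)) J := by
  have happ : ∀ {x y : ℝ → E}, ContDiffOn ℝ 1 x J → ContDiffOn ℝ 1 y J →
      ContDiffOn ℝ 1 (fun τ => B τ (x τ) (y τ)) J := fun {x y} hx hy => by
    have hB' : ContDiffOn ℝ 1 (F := E →L[ℝ] E →L[ℝ] ℝ) B J := hBs
    exact (ContDiffOn.clm_apply (G := E →L[ℝ] ℝ) hB' hx).clm_apply hy
  have hc : ∀ e : E, ContDiffOn ℝ 1 (fun _ : ℝ => e) J := fun e => contDiffOn_const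
  have hdet : ContDiffOn ℝ 1 (fun τ => gramDet b (B τ)) J :=
    ((happ (hc _) (hc _)).mul (happ (hc _) (hc _))).sub ((happ (hc _) (hc _)).pow 2)
  have hpos := fun τ hτ => gramDet_pos b (hs τ hτ) (hB τ hτ)
  exact ((hdet.sqrt fun τ hτ => (hpos τ hτ).ne').inv
    fun τ hτ => (Real.sqrt_pos.2 (hpos τ hτ)).ne').smul
    (((happ hv (hc _)).neg.smul (hc _)).add ((happ hv (hc _)).smul (hc _)))

theorem continuousOn_bil_deriv_apply {P : Type*} [TopologicalSpace P] {s : Set P}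
    {D : P → E →L[ℝ] Bil E} {x y z : P → E} (hD : ContinuousOn D s) (hx : ContinuousOn x s)
    (hy : ContinuousOn y s) (hz : ContinuousOn z s) :
    ContinuousOn (fun p => D p (x p) (y p) (z p)) s :=
  Bil.continuous_apply.comp_continuousOn ((hD.clm_apply hx).prodMk (hy.prodMk hz))

set_option maxHeartbeats 1000000 in
theorem continuousOn_frameCurvature {P : Type*} [TopologicalSpace P] {s : Set P}
    {D : P → E →L[ℝ] Bil E} {D₂ : P → E →L[ℝ] E →L[ℝ] Bil E} {v n : P → E}
    (hD : ContinuousOn D s) (hD₂ : ContinuousOn D₂ s) (hv : ContinuousOn v s)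
    (hn : ContinuousOn n s) :
    ContinuousOn (fun p => frameCurvature (D p) (D₂ p) (v p) (n p)) s := by
  have h1 := fun x y z hx hy hz =>
    continuousOn_bil_deriv_apply (x := x) (y := y) (z := z) hD hx hy hz
  have h2 := fun x y z hx hy hz => continuousOn_bil_deriv_apply (x := x) (y := y) (z := z)
    (hD₂.clm_apply hv) hx hy hz
  have h3 := fun x y z hx hy hz => continuousOn_bil_deriv_apply (x := x) (y := y) (z := z)
    (hD₂.clm_apply hn) hx hy hz
  have a1 := h3 n v v hn hv hv
  have a2 := h2 n v n hn hv hn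
  have a3 := h2 v n n hv hn hn
  have b1 := h1 n v v hn hv hv
  have b2 := h1 v n n hv hn hn
  have b3 := h1 v v v hv hv hv
  have b4 := h1 n v n hn hv hn
  have b5 := h1 v v n hv hv hn
  have b6 := h1 n n n hn hn hn
  exact (((continuousOn_const.mul ((a1.sub (continuousOn_const.mul a2)).add a3)).add
    (continuousOn_const.mul ((b1.pow 2).add (b2.pow 2)))).sub
    (continuousOn_const.mul ((b3.mul b4).add (b5.mul b6)))).add
    (continuousOn_const.mul ((b3.mul b2).add (b1.mul b6)))

end Frame

section Jets

variable {E : Type*} [NormedAddCommGroup E] [NormedSpace ℝ E]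

theorem ContDiffAt.deriv_two {y : ℝ → E} {t : ℝ} (hy : ContDiffAt ℝ 2 y t) :
    ContDiffAt ℝ 1 (deriv y) t :=
  (hy.fderiv_right (m := 1) (by norm_num)).clm_apply contDiffAt_const

/-- The curve `y` starts at `p` orthogonally to `v` with speed `|η|`, and is a geodesic of the metric
`B` to second order at `0`. -/
structure IsGeodesicJet (B : E → Bil E) (p v : E) (η : ℝ) (y : ℝ → E) : Prop where
  contDiffAt : ContDiffAt ℝ 2 y 0
  zero : y 0 = p
  speed : B p (deriv y 0) (deriv y 0) = η ^ 2
  orth : B p (deriv y 0) v = 0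
  geodesic : ∀ e, B p (deriv (deriv y) 0) e + fderiv ℝ B p (deriv y 0) (deriv y 0) e =
    1 / 2 * fderiv ℝ B p e (deriv y 0) (deriv y 0)

set_option maxHeartbeats 1000000 in
/-- The derivative of the pullback of a metric under a map `T`; the second derivatives of `T` that
occur are those in the transformation law of the Christoffel symbols. -/
theorem fderiv_bil_pullback {B B' : E → Bil E} {T : E → E} {p : E} (hT : ContDiffAt ℝ (∞ : WithTop ℕ∞) T p)
    (hB : DifferentiableAt ℝ B p) (hB' : DifferentiableAt ℝ B' (T p))
    (hpull : ∀ᶠ z in 𝓝 p, ∀ v w, B z v w = B' (T z) (fderiv ℝ T z v) (fderiv ℝ T z w)) (u a c : E) :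
    fderiv ℝ B p u a c = fderiv ℝ B' (T p) (fderiv ℝ T p u) (fderiv ℝ T p a) (fderiv ℝ T p c)
      + B' (T p) (fderiv ℝ (fderiv ℝ T) p u a) (fderiv ℝ T p c)
      + B' (T p) (fderiv ℝ T p a) (fderiv ℝ (fderiv ℝ T) p u c) := by
  have hx : HasDerivAt (fun r : ℝ => p + r • u) u 0 := by
    simpa using ((hasDerivAt_id (0 : ℝ)).smul_const u).const_add p
  have h0 : p + (0 : ℝ) • u = p := by simp
  have hTd : DifferentiableAt ℝ T p := hT.differentiableAt (by simp)
  have hTd2 : DifferentiableAt ℝ (fderiv ℝ T) p :=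
    (hT.fderiv_right (m := ∞) (by simp)).differentiableAt (by simp)
  have d1 : HasDerivAt (fun r : ℝ => T (p + r • u)) (fderiv ℝ T p u) 0 := by
    have h1 : HasFDerivAt T (fderiv ℝ T p) (p + (0 : ℝ) • u) := by rw [h0]; exact hTd.hasFDerivAt
    exact h1.comp_hasDerivAt (0 : ℝ) hx
  have d2 : ∀ a, HasDerivAt (fun r : ℝ => fderiv ℝ T (p + r • u) a)
      (fderiv ℝ (fderiv ℝ T) p u a) 0 := fun a => by
    have h1 : HasFDerivAt (fderiv ℝ T) (fderiv ℝ (fderiv ℝ T) p) (p + (0 : ℝ) • u) := by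
      rw [h0]; exact hTd2.hasFDerivAt
    simpa using (h1.comp_hasDerivAt (0 : ℝ) hx).clm_apply (hasDerivAt_const (0 : ℝ) a)
  have e1 := hasDerivAt_bil_comp (A := B') (x := fun r : ℝ => T (p + r • u)) (by rwa [h0]) d1
    (d2 a) (d2 c)
  have e2 := hasDerivAt_bil_comp (A := B) (x := fun r : ℝ => p + r • u) (by rwa [h0]) hx
    (hasDerivAt_const 0 a) (hasDerivAt_const 0 c)
  have hev : ∀ᶠ r in 𝓝 (0 : ℝ), ∀ v w, B (p + r • u) v w =
      B' (T (p + r • u)) (fderiv ℝ T (p + r • u) v) (fderiv ℝ T (p + r • u) w) := by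
    have h1 := hx.continuousAt.tendsto
    rw [h0] at h1
    exact h1.eventually hpull
  have e3 := e2.unique (e1.congr_of_eventuallyEq (by filter_upwards [hev] with r hr using hr a c))
  simpa [Bil.zero_apply] using e3

/-- Geodesic jets are preserved by changes of coordinates. -/
theorem IsGeodesicJet.comp {B B' : E → Bil E} {T : E → E} {p v : E} {η : ℝ} {y : ℝ → E}
    (hy : IsGeodesicJet B p v η y) (hT : ContDiffAt ℝ (∞ : WithTop ℕ∞) T p)
    (hB : DifferentiableAt ℝ B p) (hB' : DifferentiableAt ℝ B' (T p))
    (hsymm : ∀ x z, B' (T p) x z = B' (T p) z x)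
    (hsurj : Function.Surjective (fderiv ℝ T p))
    (hpull : ∀ᶠ z in 𝓝 p, ∀ v w, B z v w = B' (T z) (fderiv ℝ T z v) (fderiv ℝ T z w)) :
    IsGeodesicJet B' (T p) (fderiv ℝ T p v) η (fun ε => T (y ε)) := by
  have hTy : ContDiffAt ℝ (∞ : WithTop ℕ∞) T (y 0) := by rw [hy.zero]; exact hT
  have hyc : ContDiffAt ℝ 1 y 0 := hy.contDiffAt.of_le (by norm_num)
  have hyd : ∀ᶠ ε in 𝓝 (0 : ℝ), DifferentiableAt ℝ y ε := by
    filter_upwards [hyc.eventually (by simp)] with ε hε using hε.differentiableAt (by simp)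
  have hTev : ∀ᶠ z in 𝓝 (y 0), DifferentiableAt ℝ T z := by
    have h1 : ContDiffAt ℝ 1 T (y 0) := hTy.of_le (by simp)
    filter_upwards [h1.eventually (by simp)] with z hz using hz.differentiableAt (by simp)
  have hd1 : deriv (fun ε => T (y ε)) =ᶠ[𝓝 0] fun ε => fderiv ℝ T (y ε) (deriv y ε) := by
    filter_upwards [hyd, hyc.continuousAt.eventually hTev] with ε h1 h2
    exact (h2.hasFDerivAt.comp_hasDerivAt ε h1.hasDerivAt).deriv
  have hyd2 : DifferentiableAt ℝ (deriv y) 0 := by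
    have h1 : ContDiffAt ℝ 1 (deriv y) 0 := hy.contDiffAt.deriv_two
    exact h1.differentiableAt (by simp)
  have hTd2 : DifferentiableAt ℝ (fderiv ℝ T) (y 0) :=
    (hTy.fderiv_right (m := ∞) (by simp)).differentiableAt (by simp)
  have hd2 : deriv (deriv (fun ε => T (y ε))) 0 = fderiv ℝ (fderiv ℝ T) p (deriv y 0) (deriv y 0)
      + fderiv ℝ T p (deriv (deriv y) 0) := by
    rw [hd1.deriv_eq]
    have h1 := (hTd2.hasFDerivAt.comp_hasDerivAt (0 : ℝ)
      (hyd.self_of_nhds.hasDerivAt)).clm_apply hyd2.hasDerivAt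
    rw [hy.zero] at h1
    simpa [hy.zero] using h1.deriv
  have hd1' : deriv (fun ε => T (y ε)) 0 = fderiv ℝ T p (deriv y 0) := by
    refine hd1.self_of_nhds.trans ?_
    change fderiv ℝ T (y 0) (deriv y 0) = _
    rw [hy.zero]
  have hp := hpull.self_of_nhds
  refine ⟨(hTy.of_le (by exact WithTop.coe_le_coe.2 (le_top : (2 : ℕ∞) ≤ ⊤))).comp 0 hy.contDiffAt, by rw [hy.zero], ?_, ?_, ?_⟩
  · rw [hd1', ← hp, hy.speed]
  · rw [hd1', ← hp, hy.orth]
  · intro e'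
    obtain ⟨e, rfl⟩ := hsurj e'
    have h1 := hy.geodesic e
    rw [fderiv_bil_pullback hT hB hB' hpull, fderiv_bil_pullback hT hB hB' hpull, hp] at h1
    -- Of the second derivatives of `T`, symmetry leaves only `T'' (y', y')`, which is the new term in
    -- the acceleration of `T ∘ y`.
    have h2 : fderiv ℝ (fderiv ℝ T) p e (deriv y 0) = fderiv ℝ (fderiv ℝ T) p (deriv y 0) e :=
      (hT.isSymmSndFDerivAt minSmoothness_two_le_infty).eq _ _
    rw [hd1', hd2, map_add, add_apply]
    rw [h2, hsymm (fderiv ℝ (fderiv ℝ T) p (deriv y 0) e)] at h1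
    linarith

/-- Two `C²` curves with the same derivatives up to second order agree up to `o(ε²)`. -/
theorem eventually_norm_sub_le_of_deriv_eq {y z : ℝ → E} (hy : ContDiffAt ℝ 2 y 0)
    (hz : ContDiffAt ℝ 2 z 0) (h0 : y 0 = z 0) (h1 : deriv y 0 = deriv z 0)
    (h2 : deriv (deriv y) 0 = deriv (deriv z) 0) {κ : ℝ} (hκ : 0 < κ) :
    ∀ᶠ ε in 𝓝[>] (0 : ℝ), ‖z ε - y ε‖ ≤ κ * ε ^ 2 := by
  set w : ℝ → E := fun ε => z ε - y ε with hw
  have hwc : ContDiffAt ℝ 2 w 0 := hz.sub hy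
  have hev : ∀ᶠ ε in 𝓝 (0 : ℝ), HasDerivAt w (deriv w ε) ε := by
    filter_upwards [(hwc.of_le (by norm_num : (1 : WithTop ℕ∞) ≤ 2)).eventually (by simp)] with ε hε
      using (hε.differentiableAt (by simp)).hasDerivAt
  have hdw : ∀ᶠ ε in 𝓝 (0 : ℝ), deriv w ε = deriv z ε - deriv y ε := by
    filter_upwards [(hy.of_le (by norm_num : (1 : WithTop ℕ∞) ≤ 2)).eventually (by simp),
      (hz.of_le (by norm_num : (1 : WithTop ℕ∞) ≤ 2)).eventually (by simp)] with ε h3 h4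
    exact deriv_sub (h4.differentiableAt (by simp)) (h3.differentiableAt (by simp))
  have hyd : DifferentiableAt ℝ (deriv y) 0 :=
    hy.deriv_two.differentiableAt (by simp)
  have hzd : DifferentiableAt ℝ (deriv z) 0 :=
    hz.deriv_two.differentiableAt (by simp)
  have hd : HasDerivAt (deriv w) 0 0 := by
    have h3 := (hzd.hasDerivAt.sub hyd.hasDerivAt).congr_of_eventuallyEq hdw
    rwa [h2, sub_self] at h3
  have hw0 : w 0 = 0 := by simp [hw, h0]
  have hw1 : deriv w 0 = 0 := by rw [hdw.self_of_nhds, h1, sub_self]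
  have hlo := hd.isLittleO
  simp only [hw1, sub_zero, smul_zero] at hlo
  have hb := hlo.def hκ
  obtain ⟨r, hr, hball⟩ := Metric.eventually_nhds_iff.1 (hev.and hb)
  filter_upwards [Ioo_mem_nhdsGT hr] with ε hε
  have hmem : ∀ x ∈ Icc (0 : ℝ) ε, HasDerivAt w (deriv w x) x ∧ ‖deriv w x‖ ≤ κ * ‖x‖ := fun x hx =>
    hball (by rw [Real.dist_eq, sub_zero, abs_of_nonneg hx.1]; exact hx.2.trans_lt hε.2)
  have h3 := Convex.norm_image_sub_le_of_norm_hasDerivWithin_le (f := w) (f' := deriv w)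
    (C := κ * ε) (s := Icc 0 ε) (x := 0) (y := ε)
    (fun x hx => (hmem x hx).1.hasDerivWithinAt) (fun x hx => (hmem x hx).2.trans (by
      rw [Real.norm_of_nonneg hx.1]
      exact mul_le_mul_of_nonneg_left hx.2 hκ.le)) (convex_Icc _ _) ⟨le_rfl, hε.1.le⟩ ⟨hε.1.le, le_rfl⟩
  rw [hw0, sub_zero, sub_zero, Real.norm_of_nonneg hε.1.le] at h3
  exact h3.trans_eq (by ring)

end Jets

/-! ### Transport of geodesic jets -/

section JetTransport

variable {E : Type*} [NormedAddCommGroup E] [NormedSpace ℝ E]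

theorem IsGeodesicJet.congr {B : E → Bil E} {p v : E} {η : ℝ} {y z : ℝ → E}
    (hy : IsGeodesicJet B p v η y) (hyz : z =ᶠ[𝓝 0] y) : IsGeodesicJet B p v η z where
  contDiffAt := hy.contDiffAt.congr_of_eventuallyEq hyz
  zero := hyz.self_of_nhds.trans hy.zero
  speed := by rw [hyz.deriv_eq]; exact hy.speed
  orth := by rw [hyz.deriv_eq]; exact hy.orth
  geodesic e := by rw [hyz.deriv_eq, hyz.deriv.deriv_eq]; exact hy.geodesic e

theorem IsGeodesicJet.const {B : E → Bil E} {p v : E} : IsGeodesicJet B p v 0 (fun _ => p) := by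
  refine ⟨contDiffAt_const, rfl, ?_, ?_, fun e => ?_⟩ <;> simp

theorem quadratic_jet (p ξ w : E) : ContDiffAt ℝ 2 (fun ε : ℝ => p + ε • ξ + (ε ^ 2 / 2) • w) 0 ∧
    deriv (fun ε : ℝ => p + ε • ξ + (ε ^ 2 / 2) • w) 0 = ξ ∧
    deriv (deriv (fun ε : ℝ => p + ε • ξ + (ε ^ 2 / 2) • w)) 0 = w := by
  have h1 : ∀ ε : ℝ, HasDerivAt (fun ε : ℝ => p + ε • ξ + (ε ^ 2 / 2) • w) (ξ + ε • w) ε := by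
    intro ε
    have e1 := ((hasDerivAt_id ε).smul_const ξ).const_add p
    have e2 : HasDerivAt (fun ε : ℝ => ε ^ 2 / 2) ε ε := by
      simpa using (hasDerivAt_pow 2 ε).div_const 2
    simpa using e1.fun_add (e2.smul_const w)
  have h2 : deriv (fun ε : ℝ => p + ε • ξ + (ε ^ 2 / 2) • w) = fun ε => ξ + ε • w :=
    funext fun ε => (h1 ε).deriv
  refine ⟨?_, ?_, ?_⟩
  · exact ((contDiff_const.add (contDiff_id.smul contDiff_const)).add
      (((contDiff_id.pow 2).div_const 2).smul contDiff_const)).contDiffAt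
  · rw [h2]; simp
  · rw [h2]
    simpa using (((hasDerivAt_id (0 : ℝ)).smul_const w).const_add ξ).deriv

variable {U : Set E} {A : E → Bil E} {δ : E → E → ℝ}

theorem IsLocalMetric.ext_of_pairing (h : IsLocalMetric U A δ) {p : E} (hp : p ∈ U) {x y : E}
    (hxy : ∀ e, A p x e = A p y e) : x = y := by
  by_contra hne
  refine (h.pos p hp (x - y) (sub_ne_zero.2 hne)).ne' ?_
  exact (DFunLike.congr_fun (map_sub (A p) x y) (x - y)).trans (by rw [sub_apply, hxy, sub_self])

/-- Along a geodesic, a geodesic jet orthogonal to it can be transported so that the distance of the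
transversal curves satisfies the second variation inequality; `k` is a lower bound for the
curvature. -/
theorem IsLocalMetric.exists_jet [FiniteDimensional ℝ E] (h : IsLocalMetric U A δ)
    (b : Module.Basis (Fin 2) ℝ E) {c : ℝ → E} {η k : ℝ → ℝ} {α β : ℝ}
    (hU : ∀ τ ∈ Ioo α β, c τ ∈ U) (hc : ContDiffOn ℝ 2 c (Ioo α β))
    (hunit : ∀ τ ∈ Ioo α β, A (c τ) (deriv c τ) (deriv c τ) = 1)
    (hgeo : ∀ τ ∈ Ioo α β, ∀ e,
      A (c τ) (deriv (deriv c) τ) e + fderiv ℝ A (c τ) (deriv c τ) (deriv c τ) e =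
        1 / 2 * fderiv ℝ A (c τ) e (deriv c τ) (deriv c τ))
    (hη : ContDiffOn ℝ 1 η (Ioo α β)) (hk : ContinuousOn k (Ioo α β))
    (hcurv : ∀ τ ∈ Ioo α β, ∀ n, A (c τ) (deriv c τ) n = 0 → A (c τ) n n = 1 →
      k τ ≤ frameCurvature (fderiv ℝ A (c τ)) (fderiv ℝ (fderiv ℝ A) (c τ)) (deriv c τ) n)
    {s t : ℝ} (hs : α < s) (hst : s ≤ t) (ht : t < β) {x : ℝ → E}
    (hx : IsGeodesicJet A (c s) (deriv c s) (η s) x) :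
    ∃ y, IsGeodesicJet A (c t) (deriv c t) (η t) y ∧ ∀ κ > 0, ∀ᶠ ε in 𝓝[>] (0 : ℝ),
      δ (x ε) (y ε) ≤
        (t - s) + ε ^ 2 / 2 * (∫ τ in s..t, (deriv η τ ^ 2 - k τ * η τ ^ 2)) + κ * ε ^ 2 := by
  have hJ : IsOpen (Ioo α β) := isOpen_Ioo
  have hc1 : ContDiffOn ℝ 1 c (Ioo α β) := hc.of_le (by norm_num)
  have hv1 : ContDiffOn ℝ 1 (deriv c) (Ioo α β) :=
    ((contDiffOn_succ_iff_deriv_of_isOpen (n := 1) hJ).1 hc).2.2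
  have hAc : ContDiffOn ℝ 1 (fun τ => A (c τ)) (Ioo α β) := fun τ hτ =>
    ((h.contDiffAt (hU τ hτ)).of_le (by simp)).comp_contDiffWithinAt τ (hc1 τ hτ)
  have hpos : ∀ τ ∈ Ioo α β, ∀ v, v ≠ 0 → 0 < A (c τ) v v := fun τ hτ => h.pos _ (hU τ hτ)
  have hsJ : s ∈ Ioo α β := ⟨hs, hst.trans_lt ht⟩
  have htJ : t ∈ Ioo α β := ⟨hs.trans_le hst, ht⟩
  have hsub : Icc s t ⊆ Ioo α β := Icc_subset_Ioo hs ht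
  -- the unit normal field whose sign is that of the given jet at `s`
  obtain ⟨n, hn, hvn, hnn, hspan, hns⟩ : ∃ n : ℝ → E, ContDiffOn ℝ 1 n (Ioo α β) ∧
      (∀ τ ∈ Ioo α β, A (c τ) (deriv c τ) (n τ) = 0) ∧
      (∀ τ ∈ Ioo α β, A (c τ) (n τ) (n τ) = 1) ∧
      (∀ τ ∈ Ioo α β, ∀ e,
        e = A (c τ) e (deriv c τ) • deriv c τ + A (c τ) e (n τ) • n τ) ∧
      deriv x 0 = η s • n s := by
    have m1 := contDiffOn_unitNormal b hAc hv1 (fun τ _ => h.symm (c τ)) hpos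
    have m2 : ∀ τ ∈ Ioo α β, A (c τ) (deriv c τ) (unitNormal b (A (c τ)) (deriv c τ)) = 0 :=
      fun τ _ => unitNormal_orth b _ _
    have m3 : ∀ τ ∈ Ioo α β, A (c τ) (unitNormal b (A (c τ)) (deriv c τ))
        (unitNormal b (A (c τ)) (deriv c τ)) = 1 := fun τ hτ =>
      unitNormal_self b (h.symm (c τ)) (hpos τ hτ) (hunit τ hτ)
    have m4 := fun τ (hτ : τ ∈ Ioo α β) => unitNormal_span b (h.symm (c τ)) (hpos τ hτ) (hunit τ hτ)
    have e1 := m4 s hsJ (deriv x 0)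
    rw [hx.orth, zero_smul, zero_add] at e1
    have e2 := congrArg (fun z => A (c s) z z) e1
    simp only [map_smul, smul_apply, smul_eq_mul, m3 s hsJ, hx.speed] at e2
    rcases sq_eq_sq_iff_eq_or_eq_neg.1 (e2.trans (by ring) : (η s) ^ 2 = _ ^ 2) with e3 | e3
    · exact ⟨_, m1, m2, m3, m4, e1.trans (by rw [e3])⟩
    · refine ⟨_, m1.neg, fun τ hτ => by rw [map_neg, m2 τ hτ, neg_zero], fun τ hτ => ?_,
        fun τ hτ e => ?_, ?_⟩
      · rw [map_neg, map_neg, neg_apply, neg_neg, m3 τ hτ]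
      · rw [map_neg, smul_neg, neg_smul, neg_neg]; exact m4 τ hτ e
      · rw [e3, smul_neg, neg_smul, neg_neg]; exact e1
  obtain ⟨w, hw, hlen⟩ := h.second_variation hU hc hunit hgeo hn hvn hnn hspan hη
  have hjet : ∀ τ ∈ Ioo α β, IsGeodesicJet A (c τ) (deriv c τ) (η τ)
      (fun ε => c τ + ε • (η τ • n τ) + (ε ^ 2 / 2) • w τ) := fun τ hτ => by
    obtain ⟨q1, q2, q3⟩ := quadratic_jet (c τ) (η τ • n τ) (w τ)
    refine ⟨q1, by simp, ?_, ?_, fun e => ?_⟩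
    · rw [q2]
      simp only [map_smul, smul_apply, smul_eq_mul, hnn τ hτ]
      ring
    · rw [q2, map_smul, smul_apply, h.symm, hvn τ hτ, smul_zero]
    · rw [q2, q3]; exact hw τ hτ e
  refine ⟨_, hjet t htJ, fun κ hκ => ?_⟩
  -- the given jet agrees to second order with the transversal curve at `s`
  have hxs : ∀ κ > 0, ∀ᶠ ε in 𝓝[>] (0 : ℝ),
      ‖(c s + ε • (η s • n s) + (ε ^ 2 / 2) • w s) - x ε‖ ≤ κ * ε ^ 2 := by
    intro κ hκ
    obtain ⟨q1, q2, q3⟩ := quadratic_jet (c s) (η s • n s) (w s)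
    refine eventually_norm_sub_le_of_deriv_eq hx.contDiffAt q1 (by rw [hx.zero]; simp)
      (hns.trans q2.symm) ?_ hκ
    rw [q3]
    refine h.ext_of_pairing (hU s hsJ) fun e => ?_
    have e1 := hx.geodesic e
    have e2 := hw s hsJ e
    rw [hns] at e1
    linarith
  obtain ⟨K, hK, hup⟩ := h.eventually_le (hU s hsJ)
  have hxt : Tendsto x (𝓝[>] 0) (𝓝 (c s)) := by
    have := hx.contDiffAt.continuousAt.tendsto
    rw [hx.zero] at this
    exact this.mono_left nhdsWithin_le_nhds
  have hVt : Tendsto (fun ε : ℝ => c s + ε • (η s • n s) + (ε ^ 2 / 2) • w s) (𝓝[>] 0)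
      (𝓝 (c s)) := by
    have := (hjet s hsJ).contDiffAt.continuousAt.tendsto
    rw [(hjet s hsJ).zero] at this
    exact this.mono_left nhdsWithin_le_nhds
  have hup' := (hxt.prodMk_nhds hVt).eventually hup
  have hκ1 : 0 < κ / 2 / (K + 1) := by positivity
  filter_upwards [hup', hxs _ hκ1, hlen s t hs hst ht (κ / 2) (by positivity)] with ε h1 h2 h3
  refine (h.triangle _ _ _).trans ((add_le_add h1 h3).trans ?_)
  have h4 : K * ‖(c s + ε • (η s • n s) + (ε ^ 2 / 2) • w s) - x ε‖ ≤ κ / 2 * ε ^ 2 := by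
    calc _ ≤ (K + 1) * (κ / 2 / (K + 1) * ε ^ 2) :=
          mul_le_mul (by linarith) h2 (norm_nonneg _) (by positivity)
      _ = _ := by field_simp
  have hηd : ContinuousOn (deriv η) (Icc s t) :=
    ((hη.continuousOn_deriv_of_isOpen hJ le_rfl)).mono hsub
  have hηc : ContinuousOn η (Icc s t) := hη.continuousOn.mono hsub
  have hcont : ContinuousOn (fun τ => frameCurvature (fderiv ℝ A (c τ)) (fderiv ℝ (fderiv ℝ A) (c τ))
      (deriv c τ) (n τ)) (Icc s t) := by
    refine continuousOn_frameCurvature (fun τ hτ => ?_) (fun τ hτ => ?_)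
      (hv1.continuousOn.mono hsub) (hn.continuousOn.mono hsub)
    · exact (h.contDiffAt_fderiv (hU τ (hsub hτ))).continuousAt.comp_continuousWithinAt
        ((hc.continuousOn.mono hsub) τ hτ)
    · exact ((h.contDiffAt_fderiv (hU τ (hsub hτ))).fderiv_right (m := 0)
        (by simp)).continuousAt.comp_continuousWithinAt ((hc.continuousOn.mono hsub) τ hτ)
  have h5 : (∫ τ in s..t, (deriv η τ ^ 2 -
        frameCurvature (fderiv ℝ A (c τ)) (fderiv ℝ (fderiv ℝ A) (c τ)) (deriv c τ) (n τ)
          * η τ ^ 2)) ≤ ∫ τ in s..t, (deriv η τ ^ 2 - k τ * η τ ^ 2) := by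
    refine intervalIntegral.integral_mono_on hst
      (((hηd.pow 2).sub (hcont.mul (hηc.pow 2))).intervalIntegrable_of_Icc hst)
      (((hηd.pow 2).sub ((hk.mono hsub).mul (hηc.pow 2))).intervalIntegrable_of_Icc hst)
      fun τ hτ => ?_
    have := hcurv τ (hsub hτ) (n τ) (hvn τ (hsub hτ)) (hnn τ (hsub hτ))
    nlinarith [sq_nonneg (η τ)]
  have h6 := mul_le_mul_of_nonneg_left h5 (by positivity : 0 ≤ ε ^ 2 / 2)
  linarith

/-- A geodesic jet of speed zero stays within `o(ε²)` of its initial point. -/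
theorem IsLocalMetric.eventually_le_of_jet_zero [FiniteDimensional ℝ E] (h : IsLocalMetric U A δ)
    {p v : E} (hp : p ∈ U) {y : ℝ → E} (hy : IsGeodesicJet A p v 0 y) {κ : ℝ} (hκ : 0 < κ) :
    ∀ᶠ ε in 𝓝[>] (0 : ℝ), δ (y ε) p ≤ κ * ε ^ 2 := by
  have hy1 : deriv y 0 = 0 := by
    by_contra hne
    have := hy.speed
    exact (h.pos p hp _ hne).ne' (by rw [this]; norm_num)
  -- The geodesic equation annihilates the acceleration as well.
  have hy2 : deriv (deriv y) 0 = 0 := h.ext_of_pairing hp fun e => by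
    have := hy.geodesic e
    simp only [hy1, map_zero, zero_apply, add_zero, mul_zero] at this
    rw [this, map_zero, zero_apply]
  obtain ⟨K, hK, hup⟩ := h.eventually_le hp
  have hyt : Tendsto y (𝓝[>] 0) (𝓝 p) := by
    have := hy.contDiffAt.continuousAt.tendsto
    rw [hy.zero] at this
    exact this.mono_left nhdsWithin_le_nhds
  have h1 := (hyt.prodMk_nhds tendsto_const_nhds).eventually hup
  have h2 := eventually_norm_sub_le_of_deriv_eq (z := fun _ => p) hy.contDiffAt contDiffAt_const
    hy.zero (by simp [hy1]) (by simp [hy2]) (κ := κ / (K + 1)) (by positivity)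
  filter_upwards [h1, h2] with ε h3 h4
  refine h3.trans ?_
  calc K * ‖p - y ε‖ ≤ (K + 1) * (κ / (K + 1) * ε ^ 2) :=
        mul_le_mul (by linarith) h4 (norm_nonneg _) (by positivity)
    _ = _ := by field_simp

end JetTransport

/-! ### The second variation inequality on a manifold -/

section MinimizingGeodesic

variable {E H M : Type*} [NormedAddCommGroup E] [NormedSpace ℝ E]
  [TopologicalSpace H] [TopologicalSpace M] [ChartedSpace H M]
  {I : ModelWithCorners ℝ E H} [IsManifold I ∞ M]
  (g : ContMDiffRiemannianMetric I ∞ E (fun x : M => TangentSpace I x))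

/-- The curve `γ` is a minimizing geodesic of length `D`, parametrized by arc length. -/
def IsMinimizing (γ : ℝ → M) (D : ℝ) : Prop :=
  ∀ s t, 0 ≤ s → s ≤ t → t ≤ D → rdist g (γ s) (γ t) = t - s

variable [I.Boundaryless] [FiniteDimensional ℝ E] [T2Space M] [CompactSpace M]
  [PreconnectedSpace M] {g} {γ : ℝ → M} {D : ℝ}

theorem IsMinimizing.continuousAt (h : IsMinimizing g γ D) {t : ℝ} (ht : t ∈ Ioo 0 D) :
    ContinuousAt γ t := by
  intro s hs
  obtain ⟨c, hc, hsub⟩ := exists_riemDist_ball_subset g hs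
  have h1 : Tendsto (fun τ : ℝ => ENNReal.ofReal |τ - t|) (𝓝 t) (𝓝 0) := by
    have : Continuous fun τ : ℝ => ENNReal.ofReal |τ - t| :=
      ENNReal.continuous_ofReal.comp (continuous_id.sub continuous_const).abs
    simpa using this.tendsto t
  change ∀ᶠ τ in 𝓝 t, γ τ ∈ s
  filter_upwards [h1.eventually (gt_mem_nhds hc), Ioo_mem_nhds ht.1 ht.2] with τ h2 h3
  refine hsub ?_
  have h4 : rdist g (γ t) (γ τ) = |τ - t| := by
    rcases le_total t τ with h5 | h5
    · rw [h t τ ht.1.le h5 h3.2.le, abs_of_nonneg (sub_nonneg.2 h5)]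
    · rw [rdist_comm, h τ t h3.1.le h5 ht.2.le, abs_sub_comm, abs_of_nonneg (sub_nonneg.2 h5)]
  change riemDist g (γ t) (γ τ) < c
  rwa [← ofReal_rdist, h4]

/-- In a chart, a minimizing geodesic is twice continuously differentiable, has unit speed, and
satisfies the geodesic equation. -/
theorem IsMinimizing.geodesic (h : IsMinimizing g γ D) {x₀ : M} {α β : ℝ}
    (hsub : Ioo α β ⊆ Ioo 0 D) (hU : ∀ τ ∈ Ioo α β, γ τ ∈ (extChartAt I x₀).source) :
    ContDiffOn ℝ 2 (fun τ => extChartAt I x₀ (γ τ)) (Ioo α β) ∧ ∀ τ ∈ Ioo α β,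
      chartBil g x₀ (extChartAt I x₀ (γ τ)) (deriv (fun τ => extChartAt I x₀ (γ τ)) τ)
        (deriv (fun τ => extChartAt I x₀ (γ τ)) τ) = 1 ∧ ∀ e,
      chartBil g x₀ (extChartAt I x₀ (γ τ)) (deriv (deriv (fun τ => extChartAt I x₀ (γ τ))) τ) e
        + fderiv ℝ (chartBil g x₀) (extChartAt I x₀ (γ τ))
          (deriv (fun τ => extChartAt I x₀ (γ τ)) τ) (deriv (fun τ => extChartAt I x₀ (γ τ)) τ) e =
        1 / 2 * fderiv ℝ (chartBil g x₀) (extChartAt I x₀ (γ τ)) e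
          (deriv (fun τ => extChartAt I x₀ (γ τ)) τ)
          (deriv (fun τ => extChartAt I x₀ (γ τ)) τ) := by
  refine (isLocalMetric_chart g x₀).geodesic (c := fun τ => extChartAt I x₀ (γ τ)) ?_
    (fun τ hτ => (extChartAt I x₀).map_source (hU τ hτ)) fun s t hs hst ht => ?_
  · intro τ hτ
    exact (ContinuousAt.comp (contMDiffAt_extChartAt_of_mem (hU τ hτ)).continuousAt
      (h.continuousAt (hsub hτ))).continuousWithinAt
  · have hs' : s ∈ Ioo α β := ⟨hs, hst.trans_lt ht⟩
    have ht' : t ∈ Ioo α β := ⟨hs.trans_le hst, ht⟩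
    simp only [(extChartAt I x₀).left_inv (hU s hs'), (extChartAt I x₀).left_inv (hU t ht')]
    exact h s t (hsub hs').1.le hst (hsub ht').2.le

/-- Near an interior time, a minimizing geodesic stays in a chart. -/
theorem IsMinimizing.exists_Ioo (h : IsMinimizing g γ D) {t : ℝ} (ht : t ∈ Ioo 0 D) {x₀ : M}
    (hx : γ t ∈ (extChartAt I x₀).source) {P : ℝ → Prop} (hP : ∀ᶠ τ in 𝓝 t, P τ) :
    ∃ ρ > 0, Ioo (t - ρ) (t + ρ) ⊆ Ioo 0 D ∧
      ∀ τ ∈ Ioo (t - ρ) (t + ρ), γ τ ∈ (extChartAt I x₀).source ∧ P τ := by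
  have h1 := (h.continuousAt ht).eventually ((isOpen_extChartAt_source (I := I) x₀).mem_nhds hx)
  have h2 : ∀ᶠ τ in 𝓝 t, τ ∈ Ioo 0 D := Ioo_mem_nhds ht.1 ht.2
  obtain ⟨ρ, hρ, hball⟩ := Metric.eventually_nhds_iff_ball.1 (h2.and (h1.and hP))
  rw [Real.ball_eq_Ioo] at hball
  exact ⟨ρ, hρ, fun τ hτ => (hball τ hτ).1, fun τ hτ => (hball τ hτ).2⟩

theorem IsMinimizing.differentiableAt (h : IsMinimizing g γ D) {t : ℝ} (ht : t ∈ Ioo 0 D) {x₀ : M}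
    (hx : γ t ∈ (extChartAt I x₀).source) :
    DifferentiableAt ℝ (fun τ => extChartAt I x₀ (γ τ)) t := by
  obtain ⟨ρ, hρ, hsub, hU⟩ := h.exists_Ioo ht hx (P := fun _ => True) (by simp)
  exact ((h.geodesic hsub fun τ hτ => (hU τ hτ).1).1.differentiableOn (by norm_num)).differentiableAt
    (Ioo_mem_nhds (by linarith) (by linarith))

variable (g) in
/-- In some chart, `x` is a geodesic jet at `γ s` orthogonal to `γ`, of speed `η`. -/
def HasGeodesicJet (γ : ℝ → M) (s η : ℝ) (x : ℝ → M) : Prop :=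
  ∃ x₀ : M, γ s ∈ (extChartAt I x₀).source ∧ (∀ᶠ ε in 𝓝 (0 : ℝ), x ε ∈ (extChartAt I x₀).source) ∧
    IsGeodesicJet (chartBil g x₀) (extChartAt I x₀ (γ s))
      (deriv (fun τ => extChartAt I x₀ (γ τ)) s) η (fun ε => extChartAt I x₀ (x ε))

/-- A geodesic jet in one chart is a geodesic jet in every chart around the point. -/
theorem HasGeodesicJet.chart {s η : ℝ} {x : ℝ → M} (hx : HasGeodesicJet g γ s η x)
    (h : IsMinimizing g γ D) (hs : s ∈ Ioo 0 D) {x₁ : M} (hx₁ : γ s ∈ (extChartAt I x₁).source) :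
    (∀ᶠ ε in 𝓝 (0 : ℝ), x ε ∈ (extChartAt I x₁).source) ∧
      IsGeodesicJet (chartBil g x₁) (extChartAt I x₁ (γ s))
        (deriv (fun τ => extChartAt I x₁ (γ τ)) s) η (fun ε => extChartAt I x₁ (x ε)) := by
  obtain ⟨x₀, h0, hxs, hj⟩ := hx
  set p := extChartAt I x₀ (γ s) with hp
  have hpt : p ∈ (extChartAt I x₀).target := (extChartAt I x₀).map_source h0
  have hps : (extChartAt I x₀).symm p = γ s := (extChartAt I x₀).left_inv h0
  have hxc : Tendsto x (𝓝 0) (𝓝 (γ s)) := by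
    have e1 := hj.contDiffAt.continuousAt.tendsto
    rw [hj.zero] at e1
    have e2 := (contMDiffAt_extChartAt_symm hpt).continuousAt.tendsto
    rw [hps] at e2
    refine (e2.comp e1).congr' ?_
    filter_upwards [hxs] with ε hε using (extChartAt I x₀).left_inv hε
  have hxs1 := hxc.eventually ((isOpen_extChartAt_source (I := I) x₁).mem_nhds hx₁)
  refine ⟨hxs1, ?_⟩
  set T : E → E := fun z => extChartAt I x₁ ((extChartAt I x₀).symm z) with hTdef
  have hTp : T p = extChartAt I x₁ (γ s) := congrArg (extChartAt I x₁) hps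
  have hT : ContDiffAt ℝ ∞ T p := by
    refine contMDiffAt_iff_contDiffAt.1 (ContMDiffAt.comp (I' := I) p
      (contMDiffAt_extChartAt_of_mem ?_) (contMDiffAt_extChartAt_symm hpt))
    rwa [hps]
  have hpull : ∀ᶠ z in 𝓝 p, ∀ v w, chartBil g x₀ z v w =
      chartBil g x₁ (T z) (fderiv ℝ T z v) (fderiv ℝ T z w) := by
    have e2 := (contMDiffAt_extChartAt_symm hpt).continuousAt.eventually
      ((isOpen_extChartAt_source (I := I) x₁).mem_nhds (by rwa [hps]))
    filter_upwards [e2, extChartAt_target_mem_nhds' hpt] with z hz1 hz2 v w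
    exact chartForm_transition g hz2 hz1 v w
  have hinj : Function.Injective (fderiv ℝ T p) := by
    refine (injective_iff_map_eq_zero _).2 fun v hv => ?_
    by_contra hne
    refine ((isLocalMetric_chart g x₀).pos p hpt v hne).ne' ?_
    rw [hpull.self_of_nhds, hv, map_zero]
  have hsurj : Function.Surjective (fderiv ℝ T p) :=
    (LinearMap.injective_iff_surjective (f := (fderiv ℝ T p).toLinearMap)).1 hinj
  have hd : deriv (fun τ => extChartAt I x₁ (γ τ)) s =
      fderiv ℝ T p (deriv (fun τ => extChartAt I x₀ (γ τ)) s) := by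
    have e1 : (fun τ => extChartAt I x₁ (γ τ)) =ᶠ[𝓝 s] fun τ => T (extChartAt I x₀ (γ τ)) := by
      filter_upwards [(h.continuousAt hs).eventually
        ((isOpen_extChartAt_source (I := I) x₀).mem_nhds h0)] with τ hτ
      exact congrArg (extChartAt I x₁) ((extChartAt I x₀).left_inv hτ).symm
    rw [e1.deriv_eq]
    have e2 : HasFDerivAt T (fderiv ℝ T p) (extChartAt I x₀ (γ s)) :=
      (hT.differentiableAt (by simp)).hasFDerivAt
    exact (e2.comp_hasDerivAt s (h.differentiableAt hs h0).hasDerivAt).deriv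
  rw [hd, ← hTp]
  have hB := ((isLocalMetric_chart g x₀).contDiffAt hpt).differentiableAt (by simp)
  have hB' : DifferentiableAt ℝ (chartBil g x₁) (T p) := by
    refine ((isLocalMetric_chart g x₁).contDiffAt ?_).differentiableAt (by simp)
    rw [hTp]
    exact (extChartAt I x₁).map_source hx₁
  refine (hj.comp hT hB hB' ((isLocalMetric_chart g x₁).symm _) hsurj hpull).congr ?_
  filter_upwards [hxs] with ε hε
  exact congrArg (extChartAt I x₁) ((extChartAt I x₀).left_inv hε).symm

/-- The second variation inequality of a minimizing geodesic on a surface: if `k` is a lower bound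
for the curvature along `γ`, then `∫ (η'² - k η²) ≥ 0` for all functions `η` that vanish at the ends
of an interval. -/
theorem IsMinimizing.integral_nonneg (h : IsMinimizing g γ D) (b : Module.Basis (Fin 2) ℝ E)
    {η k : ℝ → ℝ} (hη : ContDiffOn ℝ 1 η (Ioo 0 D)) (hk : ContinuousOn k (Ioo 0 D))
    (hcurv : ∀ t ∈ Ioo 0 D, ∀ᶠ τ in 𝓝 t, ∀ n,
      chartBil g (γ t) (extChartAt I (γ t) (γ τ))
        (deriv (fun τ => extChartAt I (γ t) (γ τ)) τ) n = 0 →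
      chartBil g (γ t) (extChartAt I (γ t) (γ τ)) n n = 1 →
      k τ ≤ frameCurvature (fderiv ℝ (chartBil g (γ t)) (extChartAt I (γ t) (γ τ)))
        (fderiv ℝ (fderiv ℝ (chartBil g (γ t))) (extChartAt I (γ t) (γ τ)))
        (deriv (fun τ => extChartAt I (γ t) (γ τ)) τ) n)
    {r s : ℝ} (hr : 0 < r) (hrs : r ≤ s) (hs : s < D) (hηr : η r = 0) (hηs : η s = 0) :
    0 ≤ ∫ τ in r..s, (deriv η τ ^ 2 - k τ * η τ ^ 2) := by
  set q : ℝ → ℝ := fun τ => deriv η τ ^ 2 - k τ * η τ ^ 2 with hq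
  have hqc : ContinuousOn q (Ioo 0 D) :=
    ((hη.continuousOn_deriv_of_isOpen isOpen_Ioo le_rfl).pow 2).sub (hk.mul (hη.continuousOn.pow 2))
  have hqi : ∀ x ∈ Icc r s, ∀ y ∈ Icc r s, IntervalIntegrable q volume x y := fun x hx y hy =>
    (hqc.mono ((uIcc_subset_Icc hx hy).trans (Icc_subset_Ioo hr hs))).intervalIntegrable
  -- Jets of speed `|η|` are carried along `γ` from chart to chart. The relation between two times
  -- holds locally by `IsLocalMetric.exists_jet` and is transitive by the triangle inequality.
  have key := rel_Icc_of_locally (P := fun r s => ∀ x, HasGeodesicJet g γ r (η r) x →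
    ∃ y, HasGeodesicJet g γ s (η s) y ∧ ∀ κ > 0, ∀ᶠ ε in 𝓝[>] (0 : ℝ),
      rdist g (x ε) (y ε) ≤ (s - r) + ε ^ 2 / 2 * (∫ τ in r..s, q τ) + κ * ε ^ 2) hrs ?_ ?_
  · have hr' : r ∈ Ioo 0 D := ⟨hr, hrs.trans_lt hs⟩
    have hs' : s ∈ Ioo 0 D := ⟨hr.trans_le hrs, hs⟩
    -- The constant jet at `γ r` ends in a jet of speed zero at `γ s`, so that the transported curves
    -- join `γ r` to a point within `o(ε²)` of `γ s`; they are not shorter than `γ`.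
    obtain ⟨y, hy, hdist⟩ := key (fun _ => γ r) ⟨γ r, mem_extChartAt_source _,
      Eventually.of_forall fun _ => mem_extChartAt_source _, by rw [hηr]; exact IsGeodesicJet.const⟩
    have hy1 := hy.chart h hs' (mem_extChartAt_source (γ s))
    rw [hηs] at hy1
    refine le_of_forall_pos_le_add fun κ hκ => ?_
    have h1 := (isLocalMetric_chart g (γ s)).eventually_le_of_jet_zero
      ((extChartAt I (γ s)).map_source (mem_extChartAt_source _)) hy1.2
      (by positivity : 0 < κ / 4)
    obtain ⟨ε, h2, h3, h4, h5⟩ := (h1.and ((hy1.1.filter_mono nhdsWithin_le_nhds).and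
      ((hdist (κ / 4) (by positivity)).and self_mem_nhdsWithin))).exists
    have h5 : 0 < ε := h5
    rw [(extChartAt I (γ s)).left_inv h3,
      (extChartAt I (γ s)).left_inv (mem_extChartAt_source _)] at h2
    have h6 := rdist_triangle g (γ r) (y ε) (γ s)
    rw [h r s hr.le hrs hs.le] at h6
    have h7 : 0 ≤ ε ^ 2 * ((∫ τ in r..s, q τ) + κ) := by nlinarith
    exact nonneg_of_mul_nonneg_right h7 (by positivity)
  · intro x₁ x₂ x₃ h1 h2 h3 h4 P1 P2 x hx
    obtain ⟨y, hy, hxy⟩ := P1 x hx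
    obtain ⟨z, hz, hyz⟩ := P2 y hy
    refine ⟨z, hz, fun κ hκ => ?_⟩
    have m1 : x₁ ∈ Icc r s := ⟨h1, (h2.trans h3).trans h4⟩
    have m2 : x₂ ∈ Icc r s := ⟨h1.trans h2, h3.trans h4⟩
    have m3 : x₃ ∈ Icc r s := ⟨(h1.trans h2).trans h3, h4⟩
    rw [← intervalIntegral.integral_add_adjacent_intervals (hqi _ m1 _ m2) (hqi _ m2 _ m3)]
    filter_upwards [hxy (κ / 2) (by positivity), hyz (κ / 2) (by positivity)] with ε e1 e2
    refine (rdist_triangle g _ (y ε) _).trans ((add_le_add e1 e2).trans_eq (by ring))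
  · intro t ht
    have ht' : t ∈ Ioo 0 D := ⟨hr.trans_le ht.1, ht.2.trans_lt hs⟩
    obtain ⟨ρ, hρ, hsub, hU⟩ := h.exists_Ioo ht' (mem_extChartAt_source (γ t)) (hcurv t ht')
    refine ⟨ρ, hρ, fun u v hu hv htu huv hvt x hx => ?_⟩
    obtain ⟨hc, hgeo⟩ := h.geodesic hsub fun τ hτ => (hU τ hτ).1
    have hu' : u ∈ Ioo (t - ρ) (t + ρ) := ⟨by linarith, by linarith⟩
    have hv' : v ∈ Ioo (t - ρ) (t + ρ) := ⟨by linarith, by linarith⟩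
    obtain ⟨hxs, hxj⟩ := hx.chart h (hsub hu') (hU u hu').1
    obtain ⟨y, hy, hdist⟩ := (isLocalMetric_chart g (γ t)).exists_jet b (k := k) (η := η)
      (fun τ hτ => (extChartAt I (γ t)).map_source (hU τ hτ).1) hc (fun τ hτ => (hgeo τ hτ).1)
      (fun τ hτ => (hgeo τ hτ).2) (hη.mono hsub) (hk.mono hsub) (fun τ hτ => (hU τ hτ).2)
      hu'.1 huv hv'.2 hxj
    have hvt' : extChartAt I (γ t) (γ v) ∈ (extChartAt I (γ t)).target :=
      (extChartAt I (γ t)).map_source (hU v hv').1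
    have hyt : ∀ᶠ ε in 𝓝 (0 : ℝ), y ε ∈ (extChartAt I (γ t)).target := by
      refine hy.contDiffAt.continuousAt.eventually ?_
      rw [hy.zero]
      exact extChartAt_target_mem_nhds' hvt'
    refine ⟨fun ε => (extChartAt I (γ t)).symm (y ε), ⟨γ t, (hU v hv').1, ?_, hy.congr ?_⟩,
      fun κ hκ => ?_⟩
    · filter_upwards [hyt] with ε hε using (extChartAt I (γ t)).map_target hε
    · filter_upwards [hyt] with ε hε using (extChartAt I (γ t)).right_inv hε
    · filter_upwards [hdist κ hκ, hxs.filter_mono nhdsWithin_le_nhds] with ε e1 e2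
      rwa [(extChartAt I (γ t)).left_inv e2] at e1

end MinimizingGeodesic

/-! ### The curvature bound along a minimizing geodesic -/

section OrthonormalFrame

variable {E : Type*} [NormedAddCommGroup E] [NormedSpace ℝ E]

/-- Any orthonormal frame of a plane spans it: its second vector is the unit normal up to sign. -/
theorem span_of_orthonormal (b : Module.Basis (Fin 2) ℝ E) {B : Bil E}
    (hs : ∀ x y, B x y = B y x) (hB : ∀ v, v ≠ 0 → 0 < B v v) {v n : E} (hv : B v v = 1)
    (hvn : B v n = 0) (hn : B n n = 1) (e : E) : e = B e v • v + B e n • n := by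
  have h1 := unitNormal_span b hs hB hv
  have h2 := h1 n
  rw [hs n v, hvn, zero_smul, zero_add] at h2
  set m := unitNormal b B v
  have h3 := congrArg (B n) h2
  rw [hn, map_smul, smul_eq_mul] at h3
  have h4 : B e n = B n m * B e m := by
    refine (congrArg (B e) h2).trans ?_
    rw [map_smul, smul_eq_mul]
  have h5 : B e n • n = B e m • m := by
    rw [h4]
    conv_lhs => rw [h2]
    rw [smul_smul, ← h2]
    congr 1
    linear_combination -(B e m) * h3
  rw [h5]
  exact h1 e

end OrthonormalFrame

section CurvatureBound

variable {E H M : Type*} [NormedAddCommGroup E] [NormedSpace ℝ E]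
  [TopologicalSpace H] [TopologicalSpace M] [ChartedSpace H M]
  {I : ModelWithCorners ℝ E H} [IsManifold I ∞ M] [I.Boundaryless] [FiniteDimensional ℝ E]
  [T2Space M] [CompactSpace M] [PreconnectedSpace M]
  {g : ContMDiffRiemannianMetric I ∞ E (fun x : M => TangentSpace I x)}

theorem contDiffOn_comp_extChartAt_symm {f : M → ℝ} (hf : ContMDiff I 𝓘(ℝ, ℝ) ∞ f) (x₀ : M) :
    ContDiffOn ℝ ∞ (fun y => f ((extChartAt I x₀).symm y)) (extChartAt I x₀).target :=
  contMDiffOn_iff_contDiffOn.1 (hf.comp_contMDiffOn (contMDiffOn_extChartAt_symm x₀))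

theorem contMDiff_log {f : M → ℝ} (hf : ContMDiff I 𝓘(ℝ, ℝ) ∞ f) (hpos : ∀ x, 0 < f x) :
    ContMDiff I 𝓘(ℝ, ℝ) ∞ (fun x => Real.log (f x)) := fun x =>
  (Real.contDiffAt_log.2 (hpos x).ne').comp_contMDiffAt (hf x)

/-- The coordinate expressions of a metric on a surface and of the functions `log φ_a` are smooth. -/
theorem warpedData_chart {N : ℕ} {φ : Fin N → M → ℝ} (hφ : ∀ i, ContMDiff I 𝓘(ℝ, ℝ) ∞ (φ i))
    (hpos : ∀ i x, 0 < φ i x) (b : Module.Basis (Fin 2) ℝ E) (x₀ : M) :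
    WarpedData (fun y => Matrix.of fun i j => chartBil g x₀ y (b i) (b j))
      (fun a y => Real.log (φ a ((extChartAt I x₀).symm y))) (extChartAt I x₀).target := by
  have h := isLocalMetric_chart g x₀
  refine WarpedData.of_two h.isOpen (fun y hy => ?_) (fun i j => ?_) fun a =>
    contDiffOn_comp_extChartAt_symm (contMDiff_log (hφ a) (hpos a)) x₀
  · have h1 := gramDet_pos b (h.symm y) (h.pos y hy)
    rw [gramDet] at h1
    rw [Matrix.det_fin_two]
    simp only [Matrix.of_apply]
    rw [h.symm y (b 1) (b 0), ← sq]
    exact h1.ne'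
  · have h1 : ContDiffOn ℝ ∞ (F := E →L[ℝ] E →L[ℝ] ℝ) (chartBil g x₀) (extChartAt I x₀).target :=
      h.smooth
    exact (ContDiffOn.clm_apply (G := E →L[ℝ] ℝ) h1 contDiffOn_const).clm_apply contDiffOn_const

/-- A lower bound for the scalar curvature of the warped extension gives, near each point, a lower
bound for the curvature of the conformal metric in terms of the derivatives of the warping
functions. -/
theorem eventually_le_frameCurvature {N : ℕ} {φ : Fin N → M → ℝ}
    (hφ : ∀ i, ContMDiff I 𝓘(ℝ, ℝ) ∞ (φ i)) (hpos : ∀ i x, 0 < φ i x)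
    (b : Module.Basis (Fin 2) ℝ E) {σ σ' : ℝ}
    (hSc : ∀ p : M × EuclideanSpace ℝ (Fin N), σ ≤ scalarCurvature (warpedExtension g φ hφ hpos)
      (b.prod (EuclideanSpace.basisFun (Fin N) ℝ).toBasis) p) (hσ : σ' < σ) {U : M → ℝ}
    (hU : ContMDiff I 𝓘(ℝ, ℝ) ∞ U) (hUeq : ∀ x, U x = ∑ a, Real.log (φ a x)) (x₀ : M) :
    ∀ᶠ y in 𝓝 (extChartAt I x₀ x₀), ∀ v n, chartBil (conformalMetric g U hU) x₀ y v v = 1 →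
      chartBil (conformalMetric g U hU) x₀ y v n = 0 →
      chartBil (conformalMetric g U hU) x₀ y n n = 1 →
      1 / 2 * (σ' * Real.exp (-2 * U ((extChartAt I x₀).symm y))
        + ∑ a, fderiv ℝ (fun z => Real.log (φ a ((extChartAt I x₀).symm z))) y v ^ 2
        + fderiv ℝ (fun z => U ((extChartAt I x₀).symm z)) y v ^ 2) ≤
      frameCurvature (fderiv ℝ (chartBil (conformalMetric g U hU) x₀) y)
        (fderiv ℝ (fderiv ℝ (chartBil (conformalMetric g U hU) x₀)) y) v n := by
  have hd := warpedData_chart (g := g) hφ hpos b x₀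
  have hloc := isLocalMetric_chart g x₀
  have hloc' := isLocalMetric_chart (conformalMetric g U hU) x₀
  set G : E → Matrix (Fin 2) (Fin 2) ℝ := fun y => Matrix.of fun i j => chartBil g x₀ y (b i) (b j)
    with hG
  set u : Fin N → E → ℝ := fun a y => Real.log (φ a ((extChartAt I x₀).symm y)) with hu
  have hx₀ : extChartAt I x₀ x₀ ∈ (extChartAt I x₀).target := mem_extChartAt_target x₀
  -- The curvature bound `σ` at the centre of the chart yields the bound `σ'` nearby by continuity.
  have hc := (hd.continuousOn_scalarCurvature (b := b)
    (b' := (EuclideanSpace.basisFun (Fin N) ℝ).toBasis) (0 : EuclideanSpace ℝ (Fin N))).continuousAt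
    (extChartAt_target_mem_nhds' hx₀)
  have hval : σ ≤ scalarCurvatureCoord (b.prod (EuclideanSpace.basisFun (Fin N) ℝ).toBasis)
      (warpedMatrix G u) (extChartAt I x₀ x₀, (0 : EuclideanSpace ℝ (Fin N))) := by
    have h1 := hSc (x₀, 0)
    have hpt : extChartAt (I.prod (𝓡 N)) (x₀, (0 : EuclideanSpace ℝ (Fin N))) (x₀, 0) =
        (extChartAt I x₀ x₀, 0) := by
      rw [extChartAt_prod]; simp [chartAt_self_eq]
    rw [scalarCurvature, hpt] at h1
    refine h1.trans_eq (scalarCurvatureCoord_congr ?_)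
    have h2 : ∀ᶠ q : E × EuclideanSpace ℝ (Fin N) in
        𝓝 (extChartAt I x₀ x₀, (0 : EuclideanSpace ℝ (Fin N))), q.1 ∈ (extChartAt I x₀).target :=
      continuous_fst.continuousAt.eventually (extChartAt_target_mem_nhds' hx₀)
    filter_upwards [h2] with q hq
    exact metricInChart_warpedExtension g φ hφ hpos b (x₀, 0) hq
  filter_upwards [hc.eventually (lt_mem_nhds (hσ.trans_le hval)),
    extChartAt_target_mem_nhds' hx₀] with y hy hyt v n hvv hvn hnn
  have h3 := scalarCurvatureCoord_warpedMatrix_conformal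
    (b' := (EuclideanSpace.basisFun (Fin N) ℝ).toBasis) hloc.smooth hloc.symm hd
    (q := (y, (0 : EuclideanSpace ℝ (Fin N)))) hyt (f := fun z => U ((extChartAt I x₀).symm z))
    (fun z => hUeq _) (B := chartBil (conformalMetric g U hU) x₀) (fun z => rfl) hvv hvn hnn
    (span_of_orthonormal b (hloc'.symm y) (hloc'.pos y hyt) hvv hvn hnn)
  rw [h3] at hy
  have h4 : Real.exp (-2 * U ((extChartAt I x₀).symm y)) *
      Real.exp (2 * U ((extChartAt I x₀).symm y)) = 1 := by
    rw [← Real.exp_add]; simp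
  have h5 := mul_lt_mul_of_pos_left hy (Real.exp_pos (-2 * U ((extChartAt I x₀).symm y)))
  rw [← mul_assoc, h4, one_mul, Finset.sum_add_distrib] at h5
  -- The derivatives in the normal direction have a favourable sign and are dropped.
  have h6 : 0 ≤ ∑ a, fderiv ℝ (u a) y n ^ 2 := Finset.sum_nonneg fun a _ => sq_nonneg _
  have h7 := sq_nonneg (fderiv ℝ (fun z => U ((extChartAt I x₀).symm z)) y n)
  simp only at h5
  linarith

/-- A smooth function is `C²` along a minimizing geodesic, with the derivative given by the chain
rule in a chart. -/
theorem IsMinimizing.hasDerivAt_comp {γ : ℝ → M} {D : ℝ} (h : IsMinimizing g γ D) {f : M → ℝ}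
    (hf : ContMDiff I 𝓘(ℝ, ℝ) ∞ f) {t : ℝ} (ht : t ∈ Ioo 0 D) {x₀ : M}
    (hx : γ t ∈ (extChartAt I x₀).source) :
    ContDiffAt ℝ 2 (fun τ => f (γ τ)) t ∧ HasDerivAt (fun τ => f (γ τ))
      (fderiv ℝ (fun y => f ((extChartAt I x₀).symm y)) (extChartAt I x₀ (γ t))
        (deriv (fun τ => extChartAt I x₀ (γ τ)) t)) t := by
  have h1 : (fun τ => f (γ τ)) =ᶠ[𝓝 t]
      fun τ => (fun y => f ((extChartAt I x₀).symm y)) (extChartAt I x₀ (γ τ)) := by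
    filter_upwards [(h.continuousAt ht).eventually
      ((isOpen_extChartAt_source (I := I) x₀).mem_nhds hx)] with τ hτ
    exact congrArg f ((extChartAt I x₀).left_inv hτ).symm
  have h2 : ContDiffAt ℝ ∞ (fun y => f ((extChartAt I x₀).symm y)) (extChartAt I x₀ (γ t)) :=
    (contDiffOn_comp_extChartAt_symm hf x₀).contDiffAt
      (extChartAt_target_mem_nhds' ((extChartAt I x₀).map_source hx))
  obtain ⟨ρ, hρ, hsub, hU⟩ := h.exists_Ioo ht hx (P := fun _ => True) (by simp)
  have h3 : ContDiffAt ℝ 2 (fun τ => extChartAt I x₀ (γ τ)) t :=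
    (h.geodesic hsub fun τ hτ => (hU τ hτ).1).1.contDiffAt
      (Ioo_mem_nhds (by linarith) (by linarith))
  refine ⟨ContDiffAt.congr_of_eventuallyEq ?_ h1, HasDerivAt.congr_of_eventuallyEq ?_ h1⟩
  · exact ContDiffAt.comp (g := fun y => f ((extChartAt I x₀).symm y)) t
      (h2.of_le (WithTop.coe_le_coe.2 (le_top : (2 : ℕ∞) ≤ ⊤))) h3
  · exact (h2.differentiableAt (by simp)).hasFDerivAt.comp_hasDerivAt t
      (h3.differentiableAt (by norm_num)).hasDerivAt

/-- The second variation inequality along a minimizing geodesic of the conformal metric, with the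
curvature bounded below through the scalar curvature of the warped extension. -/
theorem IsMinimizing.integral_warped_nonneg {N : ℕ} {φ : Fin N → M → ℝ}
    (hφ : ∀ i, ContMDiff I 𝓘(ℝ, ℝ) ∞ (φ i)) (hpos : ∀ i x, 0 < φ i x)
    (b : Module.Basis (Fin 2) ℝ E) {σ σ' : ℝ}
    (hSc : ∀ p : M × EuclideanSpace ℝ (Fin N), σ ≤ scalarCurvature (warpedExtension g φ hφ hpos)
      (b.prod (EuclideanSpace.basisFun (Fin N) ℝ).toBasis) p) (hσ : σ' < σ) {U : M → ℝ}
    (hU : ContMDiff I 𝓘(ℝ, ℝ) ∞ U) (hUeq : ∀ x, U x = ∑ a, Real.log (φ a x)) {γ : ℝ → M} {D : ℝ}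
    (h : IsMinimizing (conformalMetric g U hU) γ D) {η : ℝ → ℝ} (hη : ContDiffOn ℝ 1 η (Ioo 0 D))
    {r s : ℝ} (hr : 0 < r) (hrs : r ≤ s) (hs : s < D) (hηr : η r = 0) (hηs : η s = 0) :
    0 ≤ ∫ τ in r..s, (deriv η τ ^ 2 - 1 / 2 * (σ' * Real.exp (-2 * U (γ τ))
        + ∑ a, deriv (fun τ => Real.log (φ a (γ τ))) τ ^ 2 + deriv (fun τ => U (γ τ)) τ ^ 2)
        * η τ ^ 2) := by
  have hfc : ∀ {f : M → ℝ}, ContMDiff I 𝓘(ℝ, ℝ) ∞ f → ContinuousOn (fun τ => f (γ τ)) (Ioo 0 D) ∧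
      ContinuousOn (deriv fun τ => f (γ τ)) (Ioo 0 D) := fun {f} hf => by
    have h1 : ContDiffOn ℝ 1 (fun τ => f (γ τ)) (Ioo 0 D) := fun τ hτ =>
      ((h.hasDerivAt_comp hf hτ (mem_extChartAt_source _)).1.of_le
        (by norm_num)).contDiffWithinAt
    exact ⟨h1.continuousOn, h1.continuousOn_deriv_of_isOpen isOpen_Ioo le_rfl⟩
  have hlog := fun a => contMDiff_log (hφ a) (hpos a)
  refine h.integral_nonneg b hη (k := fun τ => 1 / 2 * (σ' * Real.exp (-2 * U (γ τ))
        + ∑ a, deriv (fun τ => Real.log (φ a (γ τ))) τ ^ 2 + deriv (fun τ => U (γ τ)) τ ^ 2))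
    ?_ ?_ hr hrs hs hηr hηs
  · exact continuousOn_const.mul (((continuousOn_const.mul
      (Real.continuous_exp.comp_continuousOn (continuousOn_const.mul (hfc hU).1))).add
      (continuousOn_finsetSum _ fun a _ => (hfc (hlog a)).2.pow 2)).add ((hfc hU).2.pow 2))
  · intro t ht
    have h1 : Tendsto (fun τ => extChartAt I (γ t) (γ τ)) (𝓝 t) (𝓝 (extChartAt I (γ t) (γ t))) :=
      (h.differentiableAt ht (mem_extChartAt_source _)).continuousAt
    obtain ⟨ρ, hρ, hsub, hball⟩ := h.exists_Ioo ht (mem_extChartAt_source (γ t))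
      (h1.eventually (eventually_le_frameCurvature hφ hpos b hSc hσ hU hUeq (γ t)))
    filter_upwards [Ioo_mem_nhds (by linarith : t - ρ < t) (by linarith : t < t + ρ)]
      with τ hτ n hvn hnn
    have hgeo := (h.geodesic hsub fun τ hτ => (hball τ hτ).1).2 τ hτ
    have h2 := (hball τ hτ).2 _ n hgeo.1 hvn hnn
    have h3 : ∀ {f : M → ℝ}, ContMDiff I 𝓘(ℝ, ℝ) ∞ f → deriv (fun τ => f (γ τ)) τ =
        fderiv ℝ (fun y => f ((extChartAt I (γ t)).symm y)) (extChartAt I (γ t) (γ τ))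
          (deriv (fun τ => extChartAt I (γ t) (γ τ)) τ) := fun hf =>
      (h.hasDerivAt_comp hf (hsub hτ) (hball τ hτ).1).2.deriv
    rw [(extChartAt I (γ t)).left_inv (hball τ hτ).1] at h2
    simp only [h3 hU, h3 (hlog _)]
    exact h2

/-- The distance of the endpoints of a geodesic of the conformal metric `e^{2U} g`, measured
by `g`. -/
theorem IsMinimizing.rdist_le_integral {U : M → ℝ} (hU : ContMDiff I 𝓘(ℝ, ℝ) ∞ U) {γ : ℝ → M}
    {D : ℝ} (h : IsMinimizing (conformalMetric g U hU) γ D) {r s : ℝ} (hr : 0 < r) (hrs : r ≤ s)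
    (hs : s < D) : rdist g (γ r) (γ s) ≤ ∫ τ in r..s, Real.exp (-U (γ τ)) := by
  have hc : ContinuousOn (fun τ => Real.exp (-U (γ τ))) (Ioo 0 D) := fun τ hτ =>
    (Real.continuous_exp.continuousAt.comp (ContinuousAt.neg
      (hU.continuous.continuousAt.comp (h.continuousAt hτ)))).continuousWithinAt
  have hi : ∀ x ∈ Icc r s, ∀ y ∈ Icc r s,
      IntervalIntegrable (fun τ => Real.exp (-U (γ τ))) volume x y := fun x hx y hy =>
    (hc.mono ((uIcc_subset_Icc hx hy).trans (Icc_subset_Ioo hr hs))).intervalIntegrable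
  refine rel_Icc_of_locally
    (P := fun r s => rdist g (γ r) (γ s) ≤ ∫ τ in r..s, Real.exp (-U (γ τ))) hrs ?_ ?_
  · intro x₁ x₂ x₃ h1 h2 h3 h4 P1 P2
    have m1 : x₁ ∈ Icc r s := ⟨h1, (h2.trans h3).trans h4⟩
    have m2 : x₂ ∈ Icc r s := ⟨h1.trans h2, h3.trans h4⟩
    have m3 : x₃ ∈ Icc r s := ⟨(h1.trans h2).trans h3, h4⟩
    rw [← intervalIntegral.integral_add_adjacent_intervals (hi _ m1 _ m2) (hi _ m2 _ m3)]
    exact (rdist_triangle g _ _ _).trans (add_le_add P1 P2)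
  · intro t ht
    have ht' : t ∈ Ioo 0 D := ⟨hr.trans_le ht.1, ht.2.trans_lt hs⟩
    obtain ⟨ρ, hρ, hsub, hU'⟩ := h.exists_Ioo ht' (mem_extChartAt_source (γ t))
      (P := fun _ => True) (by simp)
    refine ⟨ρ, hρ, fun u v hu hv htu huv hvt => ?_⟩
    have huv' : Icc u v ⊆ Ioo (t - ρ) (t + ρ) := Icc_subset_Ioo htu hvt
    obtain ⟨hc2, hgeo⟩ := h.geodesic hsub fun τ hτ => (hU' τ hτ).1
    obtain ⟨K, hK⟩ := (hc2.mono huv').exists_lipschitzOnWith (by norm_num) (convex_Icc u v)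
      isCompact_Icc
    have key := (isLocalMetric_chart g (γ t)).le_integral
      (V := fun τ => extChartAt I (γ t) (γ τ)) (V' := deriv fun τ => extChartAt I (γ t) (γ τ))
      (L := fun τ => Real.exp (-U (γ τ))) huv hK
      (fun τ hτ => (extChartAt I (γ t)).map_source (hU' τ (huv' hτ)).1)
      (ae_of_all _ fun τ hτ => ?_) (hi u hu v hv) (ae_of_all _ fun τ hτ => ?_)
    · rwa [(extChartAt I (γ t)).left_inv (hU' u (huv' ⟨le_rfl, huv⟩)).1,
        (extChartAt I (γ t)).left_inv (hU' v (huv' ⟨huv, le_rfl⟩)).1] at key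
    · exact (h.differentiableAt (hsub (huv' (Ioo_subset_Icc_self hτ)))
        (hU' τ (huv' (Ioo_subset_Icc_self hτ))).1).hasDerivAt
    · have hτ' := huv' (Ioo_subset_Icc_self hτ)
      have h1 := (hgeo τ hτ').1
      have h2 : Real.exp (2 * U ((extChartAt I (γ t)).symm (extChartAt I (γ t) (γ τ)))) *
          chartBil g (γ t) (extChartAt I (γ t) (γ τ)) (deriv (fun τ => extChartAt I (γ t) (γ τ)) τ)
            (deriv (fun τ => extChartAt I (γ t) (γ τ)) τ) = 1 := h1
      rw [(extChartAt I (γ t)).left_inv (hU' τ hτ').1] at h2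
      refine le_of_eq ?_
      rw [Real.sqrt_eq_iff_mul_self_eq_of_pos (Real.exp_pos _), ← Real.exp_add]
      have h3 : Real.exp (-U (γ τ) + -U (γ τ)) * Real.exp (2 * U (γ τ)) = 1 := by
        rw [← Real.exp_add, ← Real.exp_zero]; congr 1; ring
      exact mul_left_cancel₀ (Real.exp_pos (2 * U (γ τ))).ne' (by rw [h2, mul_comm, h3])

end CurvatureBound

/-! ### The test function -/

section TestFunction

/-- The completion of the square that produces the constant `N / (N + 2)`: by the Cauchy–Schwarz
inequality, the sum of the squares of `N` numbers is at least `1 / N` times the square of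
their sum. -/
theorem mul_mul_le_of_sum {N : ℕ} (p : Fin N → ℝ) (f f' : ℝ) :
    (∑ a, p a) * f * f' - (1 / 4 * (∑ a, p a) ^ 2 + 1 / 2 * ∑ a, p a ^ 2) * f ^ 2 ≤
      (N : ℝ) / (N + 2) * f' ^ 2 := by
  have hcs : (∑ a, p a) ^ 2 ≤ N * ∑ a, p a ^ 2 := by
    simpa using sq_sum_le_card_mul_sum_sq (s := Finset.univ) (f := p)
  have hN2 : (0 : ℝ) < N + 2 := by positivity
  rcases Nat.eq_zero_or_pos N with h0 | h0
  · subst h0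
    simp
  have hN : (0 : ℝ) < N := by exact_mod_cast h0
  set P := ∑ a, p a
  set S := ∑ a, p a ^ 2
  have h1 : P ^ 2 / N ≤ S := by rwa [div_le_iff₀' hN]
  have h2 : (1 / 4 * P ^ 2 + 1 / 2 * (P ^ 2 / N)) * f ^ 2 ≤ (1 / 4 * P ^ 2 + 1 / 2 * S) * f ^ 2 := by
    gcongr
  have h3 : (N : ℝ) / (N + 2) * f' ^ 2 - P * f * f' + (1 / 4 * P ^ 2 + 1 / 2 * (P ^ 2 / N)) * f ^ 2 =
      N / (N + 2) * (f' - (N + 2) / (2 * N) * P * f) ^ 2 := by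
    field_simp
    ring
  have h4 : 0 ≤ (N : ℝ) / (N + 2) * (f' - (N + 2) / (2 * N) * P * f) ^ 2 := by positivity
  linarith

variable {N : ℕ} {u : Fin N → ℝ → ℝ} {U : ℝ → ℝ} {D κ : ℝ}

/-- The test function `e^{U/2} sin (π s / ℓ)` in the second variation inequality, where `s` is the
arc length `∫ e^{-U}` and `ℓ` its total value. -/
theorem sq_integral_exp_mul_le (hu : ∀ a, ContDiffOn ℝ 1 (u a) (Ioo 0 D))
    (hU : ∀ τ, U τ = ∑ a, u a τ)
    (hvar : ∀ η : ℝ → ℝ, ContDiffOn ℝ 1 η (Ioo 0 D) → ∀ r s, 0 < r → r ≤ s → s < D → η r = 0 →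
      η s = 0 → 0 ≤ ∫ τ in r..s, (deriv η τ ^ 2 - 1 / 2 * (κ * Real.exp (-2 * U τ)
        + ∑ a, deriv (u a) τ ^ 2 + deriv U τ ^ 2) * η τ ^ 2))
    {r s : ℝ} (hr : 0 < r) (hrs : r < s) (hs : s < D) :
    κ * (∫ τ in r..s, Real.exp (-U τ)) ^ 2 ≤ 4 * Real.pi ^ 2 * ((N + 1) / (N + 2)) := by
  have hJ : IsOpen (Ioo 0 D) := isOpen_Ioo
  have hUeq : U = fun τ => ∑ a, u a τ := funext hU
  have hU1 : ContDiffOn ℝ 1 U (Ioo 0 D) := by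
    rw [hUeq]; exact ContDiffOn.sum fun a _ => hu a
  have hud := fun a τ hτ => (hu a).hasDerivAt_of_isOpen hJ (τ := τ) hτ
  have hUd := fun τ hτ => hU1.hasDerivAt_of_isOpen hJ (τ := τ) hτ
  have hdU : ∀ τ ∈ Ioo 0 D, deriv U τ = ∑ a, deriv (u a) τ := fun τ hτ => by
    rw [hUeq]
    exact (HasDerivAt.fun_sum fun a _ => hud a τ hτ).deriv
  have hec : ContinuousOn (fun τ => Real.exp (-U τ)) (Ioo 0 D) :=
    Real.continuous_exp.comp_continuousOn hU1.continuousOn.neg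
  have hrm : r ∈ Ioo 0 D := ⟨hr, hrs.trans hs⟩
  set S : ℝ → ℝ := fun τ => ∫ x in r..τ, Real.exp (-U x) with hS
  have hSd : ∀ τ ∈ Ioo 0 D, HasDerivAt S (Real.exp (-U τ)) τ := fun τ hτ =>
    intervalIntegral.integral_hasDerivAt_right
      (hec.mono (ordConnected_Ioo.uIcc_subset hrm hτ)).intervalIntegrable
      (hec.stronglyMeasurableAtFilter hJ τ hτ) (hec.continuousAt (hJ.mem_nhds hτ))
  have hS1 : ContDiffOn ℝ 1 S (Ioo 0 D) := by
    refine (contDiffOn_succ_iff_deriv_of_isOpen (n := 0) hJ).2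
      ⟨fun τ hτ => (hSd τ hτ).differentiableAt.differentiableWithinAt, by simp,
        contDiffOn_zero.2 (hec.congr fun τ hτ => (hSd τ hτ).deriv)⟩
  set l := S s with hl
  have hlpos : 0 < l := intervalIntegral.intervalIntegral_pos_of_pos_on
    (hec.mono (ordConnected_Ioo.uIcc_subset hrm ⟨hr.trans hrs, hs⟩)).intervalIntegrable
    (fun x _ => Real.exp_pos _) hrs
  have hSr : S r = 0 := intervalIntegral.integral_same
  set θ : ℝ → ℝ := fun τ => Real.pi / l * S τ with hθ
  have hθd : ∀ τ ∈ Ioo 0 D, HasDerivAt θ (Real.pi / l * Real.exp (-U τ)) τ := fun τ hτ =>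
    (hSd τ hτ).const_mul _
  have hθr : θ r = 0 := by rw [hθ]; simp [hSr]
  have hθs : θ s = Real.pi := by
    change Real.pi / l * l = Real.pi
    field_simp
  have hθ1 : ContDiffOn ℝ 1 θ (Ioo 0 D) := contDiffOn_const.mul hS1
  set η : ℝ → ℝ := fun τ => Real.exp (U τ / 2) * Real.sin (θ τ) with hη
  have hη1 : ContDiffOn ℝ 1 η (Ioo 0 D) :=
    (Real.contDiff_exp.comp_contDiffOn (hU1.div_const 2)).mul (Real.contDiff_sin.comp_contDiffOn hθ1)
  have hηd : ∀ τ ∈ Ioo 0 D, deriv η τ = Real.exp (U τ / 2) * (deriv U τ / 2) * Real.sin (θ τ)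
      + Real.exp (U τ / 2) * (Real.cos (θ τ) * (Real.pi / l * Real.exp (-U τ))) := fun τ hτ =>
    (((hUd τ hτ).div_const 2).exp.mul (hθd τ hτ).sin).deriv
  have h0 := hvar η hη1 r s hr hrs.le hs (by simp [hη, hθr]) (by simp [hη, hθs])
  have hsub : Icc r s ⊆ Ioo 0 D := Icc_subset_Ioo hr hs
  set C : ℝ := 2 * ((N + 1) / (N + 2)) * (Real.pi / l) ^ 2 with hC
  -- the pointwise estimate of the integrand
  have hpt : ∀ τ ∈ Icc r s, deriv η τ ^ 2 - 1 / 2 * (κ * Real.exp (-2 * U τ)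
        + ∑ a, deriv (u a) τ ^ 2 + deriv U τ ^ 2) * η τ ^ 2 ≤
      C * (Real.exp (-U τ) * Real.cos (θ τ) ^ 2)
        - κ / 2 * (Real.exp (-U τ) * Real.sin (θ τ) ^ 2) := fun τ hτ => by
    have h1 := mul_mul_le_of_sum (fun a => deriv (u a) τ) (Real.sin (θ τ))
      (Real.cos (θ τ) * (Real.pi / l * Real.exp (-U τ)))
    rw [← hdU τ (hsub hτ)] at h1
    rw [hηd τ (hsub hτ), hη]
    set E := Real.exp (U τ / 2) with hE
    set e := Real.exp (-U τ) with he
    have e1 : Real.exp (-2 * U τ) = e ^ 2 := by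
      rw [he, sq, ← Real.exp_add]; congr 1; ring
    have e2 : E ^ 2 * e = 1 := by
      rw [hE, he, sq, ← Real.exp_add, ← Real.exp_add, ← Real.exp_zero]; congr 1; ring
    have e3 : (0 : ℝ) ≤ E ^ 2 := sq_nonneg _
    have hN2 : (N : ℝ) + 2 ≠ 0 := by positivity
    have e4 : 2 * (((N : ℝ) + 1) / (N + 2)) = 1 + N / (N + 2) := by
      field_simp
      ring
    rw [e1, hC, e4]
    set m := Real.pi / l
    set sn := Real.sin (θ τ)
    set cs := Real.cos (θ τ)
    set P := deriv U τ
    set Q := ∑ a, deriv (u a) τ ^ 2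
    have h2 := mul_le_mul_of_nonneg_left h1 e3
    set K := (N : ℝ) / (N + 2)
    have e5 : E ^ 2 * (m * e) ^ 2 = m ^ 2 * e := by linear_combination m ^ 2 * e * e2
    have e6 : E ^ 2 * e ^ 2 = e := by linear_combination e * e2
    have h3 : (E * (P / 2) * sn + E * (cs * (m * e))) ^ 2
        - 1 / 2 * (κ * e ^ 2 + Q + P ^ 2) * (E * sn) ^ 2 =
        E ^ 2 * (P * sn * (cs * (m * e)) - (1 / 4 * P ^ 2 + 1 / 2 * Q) * sn ^ 2)
          + cs ^ 2 * (m ^ 2 * e) - κ / 2 * (e * sn ^ 2) := by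
      linear_combination cs ^ 2 * e5 - κ / 2 * sn ^ 2 * e6
    have h4 : E ^ 2 * (K * (cs * (m * e)) ^ 2) = K * cs ^ 2 * (m ^ 2 * e) := by
      linear_combination K * cs ^ 2 * e5
    rw [h3]
    rw [h4] at h2
    linarith
  have hq : ContinuousOn (fun τ => deriv η τ ^ 2 - 1 / 2 * (κ * Real.exp (-2 * U τ)
        + ∑ a, deriv (u a) τ ^ 2 + deriv U τ ^ 2) * η τ ^ 2) (Icc r s) := by
    refine ContinuousOn.mono ?_ hsub
    have c1 : ∀ {f : ℝ → ℝ}, ContDiffOn ℝ 1 f (Ioo 0 D) → ContinuousOn (deriv f) (Ioo 0 D) :=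
      fun hf => hf.continuousOn_deriv_of_isOpen hJ le_rfl
    exact ((c1 hη1).pow 2).sub ((continuousOn_const.mul (((continuousOn_const.mul
      (Real.continuous_exp.comp_continuousOn (continuousOn_const.mul hU1.continuousOn))).add
      (continuousOn_finsetSum _ fun a _ => (c1 (hu a)).pow 2)).add ((c1 hU1).pow 2))).mul
      (hη1.continuousOn.pow 2))
  have hcc : ContinuousOn (fun τ => Real.exp (-U τ) * Real.cos (θ τ) ^ 2) (Icc r s) :=
    (hec.mul ((Real.continuous_cos.comp_continuousOn hθ1.continuousOn).pow 2)).mono hsub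
  have hcs : ContinuousOn (fun τ => Real.exp (-U τ) * Real.sin (θ τ) ^ 2) (Icc r s) :=
    (hec.mul ((Real.continuous_sin.comp_continuousOn hθ1.continuousOn).pow 2)).mono hsub
  have icc := hcc.intervalIntegrable_of_Icc (μ := volume) hrs.le
  have ics := hcs.intervalIntegrable_of_Icc (μ := volume) hrs.le
  have h1 := intervalIntegral.integral_mono_on hrs.le (hq.intervalIntegrable_of_Icc hrs.le)
    ((icc.const_mul C).sub (ics.const_mul (κ / 2))) hpt
  rw [intervalIntegral.integral_sub (icc.const_mul C) (ics.const_mul (κ / 2)),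
    intervalIntegral.integral_const_mul, intervalIntegral.integral_const_mul] at h1
  -- both integrals are half of the total arc length
  have hanti : ∀ τ ∈ Ioo 0 D, HasDerivAt (fun τ => Real.sin (θ τ) * Real.cos (θ τ))
      (Real.cos (θ τ) * (Real.pi / l * Real.exp (-U τ)) * Real.cos (θ τ)
        + Real.sin (θ τ) * (-Real.sin (θ τ) * (Real.pi / l * Real.exp (-U τ)))) τ := fun τ hτ =>
    (hθd τ hτ).sin.mul (hθd τ hτ).cos
  have hl0 : l ≠ 0 := hlpos.ne'
  have hicos : ∫ τ in r..s, Real.exp (-U τ) * Real.cos (θ τ) ^ 2 = l / 2 := by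
    rw [intervalIntegral.integral_eq_sub_of_hasDerivAt
      (f := fun τ => 1 / 2 * S τ + l / (2 * Real.pi) * (Real.sin (θ τ) * Real.cos (θ τ)))
      (fun τ hτ => ?_) icc]
    · simp only [hθr, hθs, hSr, Real.sin_pi, Real.sin_zero]
      ring
    · rw [uIcc_of_le hrs.le] at hτ
      refine (((hSd τ (hsub hτ)).const_mul _).fun_add
        ((hanti τ (hsub hτ)).const_mul _)).congr_deriv ?_
      have := Real.sin_sq_add_cos_sq (θ τ)
      field_simp
      linear_combination -this
  have hisin : ∫ τ in r..s, Real.exp (-U τ) * Real.sin (θ τ) ^ 2 = l / 2 := by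
    rw [intervalIntegral.integral_eq_sub_of_hasDerivAt
      (f := fun τ => 1 / 2 * S τ - l / (2 * Real.pi) * (Real.sin (θ τ) * Real.cos (θ τ)))
      (fun τ hτ => ?_) ics]
    · simp only [hθr, hθs, hSr, Real.sin_pi, Real.sin_zero]
      ring
    · rw [uIcc_of_le hrs.le] at hτ
      refine (((hSd τ (hsub hτ)).const_mul _).fun_sub
        ((hanti τ (hsub hτ)).const_mul _)).congr_deriv ?_
      have := Real.sin_sq_add_cos_sq (θ τ)
      field_simp
      linear_combination -this
  rw [hicos, hisin] at h1
  have h2 := h0.trans h1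
  have h3 : (0 : ℝ) ≤ 2 * ((N + 1) / (N + 2)) * Real.pi ^ 2 - κ / 2 * l ^ 2 := by
    have h4 := mul_nonneg h2 (by positivity : 0 ≤ 2 * l)
    refine h4.trans_eq ?_
    rw [hC]
    field_simp
  linarith

end TestFunction

/-! ### The diameter bound -/

section DiameterBound

variable {E H M : Type*} [NormedAddCommGroup E] [NormedSpace ℝ E]
  [TopologicalSpace H] [TopologicalSpace M] [ChartedSpace H M]
  {I : ModelWithCorners ℝ E H} [IsManifold I ∞ M] [I.Boundaryless] [FiniteDimensional ℝ E]
  [T2Space M] [CompactSpace M] [PreconnectedSpace M]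
  {g : ContMDiffRiemannianMetric I ∞ E (fun x : M => TangentSpace I x)}

/-- The distances of two Riemannian metrics define the same topology. -/
theorem exists_rdist_lt_imp (g' : ContMDiffRiemannianMetric I ∞ E (fun x : M => TangentSpace I x))
    (x : M) {ε : ℝ} (hε : 0 < ε) : ∃ ρ > 0, ∀ z, rdist g' x z < ρ → rdist g x z < ε := by
  obtain ⟨c, hc, hsub⟩ := exists_riemDist_ball_subset g' (eventually_rdist_lt g x hε)
  have hm : min c 1 ≠ ⊤ := ((min_le_right c 1).trans_lt ENNReal.one_lt_top).ne
  refine ⟨(min c 1).toReal, ENNReal.toReal_pos (lt_min hc one_pos).ne' hm, fun z hz => hsub ?_⟩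
  have h1 : riemDist g' x z < min c 1 := by
    rw [← ofReal_rdist]
    exact (ENNReal.ofReal_lt_iff_lt_toReal (rdist_nonneg g' x z) hm).2 hz
  exact h1.trans_le (min_le_left c 1)

/-- The diameter bound for two points. A minimizing geodesic of the conformal metric `e^{2U} g`,
`U = ∑ log φ_a`, joins them; the bound is proved between its interior points and extends to the
ends by continuity. -/
theorem rdist_le_of_le_scalarCurvature {N : ℕ} {φ : Fin N → M → ℝ}
    (hφ : ∀ i, ContMDiff I 𝓘(ℝ, ℝ) ∞ (φ i)) (hpos : ∀ i x, 0 < φ i x)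
    (b : Module.Basis (Fin 2) ℝ E) {σ : ℝ} (hσ : 0 < σ)
    (hSc : ∀ p : M × EuclideanSpace ℝ (Fin N), σ ≤ scalarCurvature (warpedExtension g φ hφ hpos)
      (b.prod (EuclideanSpace.basisFun (Fin N) ℝ).toBasis) p) (x y : M) :
    rdist g x y ≤ 2 * Real.pi * √(((N : ℝ) + 1) / (((N : ℝ) + 2) * σ)) := by
  set R := 2 * Real.pi * √(((N : ℝ) + 1) / (((N : ℝ) + 2) * σ)) with hR
  have hR0 : 0 ≤ R := by positivity
  have hR2 : R ^ 2 * σ = 4 * Real.pi ^ 2 * ((N + 1) / (N + 2)) := by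
    rw [hR, mul_pow, Real.sq_sqrt (by positivity)]
    field_simp
    ring
  set U : M → ℝ := fun x => ∑ a, Real.log (φ a x) with hUdef
  have hU : ContMDiff I 𝓘(ℝ, ℝ) ∞ U := contMDiff_finsetSum fun a _ => contMDiff_log (hφ a) (hpos a)
  obtain ⟨γ, h0, hD, hγ⟩ := exists_rdist_geodesic (conformalMetric g U hU) x y
  set D := rdist (conformalMetric g U hU) x y with hDdef
  have hmin : IsMinimizing (conformalMetric g U hU) γ D := hγ
  -- the bound for the interior points of the geodesic
  have hint : ∀ r s, 0 < r → r < s → s < D → rdist g (γ r) (γ s) ≤ R := by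
    intro r s hr hrs hs
    set l := ∫ τ in r..s, Real.exp (-U (γ τ)) with hl
    have h1 : rdist g (γ r) (γ s) ≤ l := hmin.rdist_le_integral hU hr hrs.le hs
    refine h1.trans (abs_le_of_sq_le_sq' ?_ hR0).2
    refine le_of_mul_le_mul_right ?_ hσ
    rw [hR2, mul_comm]
    have h2 : ∀ σ' < σ, σ' * l ^ 2 ≤ 4 * Real.pi ^ 2 * ((N + 1) / (N + 2)) := fun σ' hσ' =>
      sq_integral_exp_mul_le (u := fun a τ => Real.log (φ a (γ τ))) (U := fun τ => U (γ τ))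
        (fun a τ hτ => ((hmin.hasDerivAt_comp (contMDiff_log (hφ a) (hpos a)) hτ
          (mem_extChartAt_source _)).1.of_le (by norm_num)).contDiffWithinAt) (fun τ => rfl)
        (fun η hη r s hr hrs hs hηr hηs => hmin.integral_warped_nonneg hφ hpos b hSc hσ' hU
          (fun x => rfl) hη hr hrs hs hηr hηs) hr hrs hs
    -- The curvature bound is available for every `σ' < σ`; let `σ'` tend to `σ`.
    have h3 : Tendsto (fun σ' : ℝ => σ' * l ^ 2) (𝓝[<] σ) (𝓝 (σ * l ^ 2)) :=
      ((continuous_id.mul continuous_const).tendsto σ).mono_left nhdsWithin_le_nhds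
    exact le_of_tendsto h3 (eventually_mem_nhdsWithin.mono h2)
  refine le_of_forall_pos_le_add fun ε hε => ?_
  obtain ⟨ρ₁, hρ₁, hx⟩ := exists_rdist_lt_imp (g := g) (conformalMetric g U hU) x (half_pos hε)
  obtain ⟨ρ₂, hρ₂, hy⟩ := exists_rdist_lt_imp (g := g) (conformalMetric g U hU) y (half_pos hε)
  rcases (rdist_nonneg (conformalMetric g U hU) x y).eq_or_lt with hD0 | hD0
  · have := hx y (by rw [← hD0]; exact hρ₁)
    linarith
  -- The ends of the geodesic are shortened by a small amount `e`.
  set e := min (D / 3) (min (ρ₁ / 2) (ρ₂ / 2)) with he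
  have he0 : 0 < e := by positivity
  have he1 : e ≤ D / 3 := min_le_left _ _
  have he2 : e ≤ ρ₁ / 2 := (min_le_right _ _).trans (min_le_left _ _)
  have he3 : e ≤ ρ₂ / 2 := (min_le_right _ _).trans (min_le_right _ _)
  have h1 := hint e (D - e) he0 (by linarith) (by linarith)
  have h2 : rdist g x (γ e) < ε / 2 := hx _ (by
    have := hγ 0 e le_rfl he0.le (by linarith)
    rw [h0] at this
    rw [this]; linarith)
  have h3 : rdist g y (γ (D - e)) < ε / 2 := hy _ (by
    have := hγ (D - e) D (by linarith) (by linarith) le_rfl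
    rw [hD] at this
    rw [rdist_comm, this]; linarith)
  have h4 := rdist_triangle g x (γ e) y
  have h5 := rdist_triangle g (γ e) (γ (D - e)) y
  rw [rdist_comm g (γ (D - e)) y] at h5
  linarith

end DiameterBound

end

theorem mainTheorem11 {X : Type*} [TopologicalSpace X] [T2Space X] [CompactSpace X]
    [ConnectedSpace X] [ChartedSpace (EuclideanSpace ℝ (Fin 2)) X] [IsManifold (𝓡 2) ∞ X]
    (g : ContMDiffRiemannianMetric (𝓡 2) ∞ (EuclideanSpace ℝ (Fin 2))
      (fun x : X => TangentSpace (𝓡 2) x))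
    (N : ℕ) (φ : Fin N → X → ℝ) (hφ : ∀ i, ContMDiff (𝓡 2) 𝓘(ℝ, ℝ) ∞ (φ i))
    (hpos : ∀ i x, 0 < φ i x) (σ : ℝ) (hσ : 0 < σ)
    (hSc : ∀ p : X × EuclideanSpace ℝ (Fin N),
      σ ≤ scalarCurvature (warpedExtension g φ hφ hpos)
        ((EuclideanSpace.basisFun (Fin 2) ℝ).toBasis.prod
          (EuclideanSpace.basisFun (Fin N) ℝ).toBasis) p) :
    riemannianDiam g ≤ ENNReal.ofReal (2 * Real.pi * √(((N : ℝ) + 1) / (((N : ℝ) + 2) * σ))) ∧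
      2 * Real.pi * √(((N : ℝ) + 1) / (((N : ℝ) + 2) * σ)) < 2 * Real.pi / √σ := by
  refine ⟨?_, ?_⟩
  · change ⨆ (x : X) (y : X), riemDist g x y ≤ _
    refine iSup₂_le fun x y => ?_
    rw [← ofReal_rdist]
    exact ENNReal.ofReal_le_ofReal (rdist_le_of_le_scalarCurvature hφ hpos _ hσ hSc x y)
  · rw [div_eq_mul_inv _ (√σ), ← Real.sqrt_inv]
    refine mul_lt_mul_of_pos_left (Real.sqrt_lt_sqrt (by positivity) ?_) Real.two_pi_pos
    rw [div_lt_iff₀ (by positivity)]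
    field_simp
    linarith
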